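/- **Setting.** Let $\hat V:\mathbb Z^3\to[0,\infty)$ with $\|\hat V\|_1=\sum_k\hat V(k)<\infty$, let $0<\delta<1/6$, $0<\theta<1/2$, $C_0\in\mathbb R$, and fix a branch of the complex logarithm with imaginary part in $(t-2\pi,t]$, $0<t<2\pi$ (so that $\log 1=0$). For $k_F>0$ put $B_F=\{p\in\mathbb Z^3:|p|\le k_F\}$, $N=|B_F|$, $\hbar=N^{-1/3}$, $\kappa=k_FN^{-1/3}$. On the fermionic Fock space $\mathcal F$ over $L^2(\mathbb T^3)$ let $a_p^*,a_p$ ($p\in\mathbb Z^3$) be the creation and annihilation operators of plane waves, and $$\mathcal N=\sum_p a_p^*a_p,\qquad \mathcal N_\delta=\sum_{p:\,||p|-k_F|>\theta N^{-\delta}}a_p^*a_p .$$ *Patches.* Let $R>0$, let $M$ be even, and let $p_1,\dots,p_M$ be measurable subsets of the unit sphere with marked points (centers) $\hat\omega_\alpha\in p_\alpha$, where $M/2$ of the pairs $(p_\alpha,\hat\omega_\alpha)$ lie in a closed half sphere and the other $M/2$ are their reflections at the origin, such that $\operatorname{diam}p_\alpha\le C_0M^{-1/2}$, $|\operatorname{area}(p_\alpha)-4\pi/M|\le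 C_0(1+R)N^{-1/3}M^{-1/2}$, and the patches $B_\alpha=\{p\in\mathbb R^3:k_F-R\le|p|\le k_F+R,\ p/|p|\in p_\alpha\}$ have pairwise distances larger than $R$: $|p-q|>R$ for $p\in B_\alpha$, $q\in B_\beta$, $\alpha\ne\beta$. *Pair operators.* Let $\Gamma^{\rm nor}$ be the set of $k\in\mathbb Z^3$ with $|k|<R$ and either $k_3>0$, or $k_3=0<k_2$, or $k_3=k_2=0<k_1$. Let $\mathcal I_k^\pm=\{\alpha:\pm k\cdot\hat\omega_\alpha\ge N^{-\delta}\}$, $\mathcal I_k=\mathcal I_k^+\cup\mathcal I_k^-$. For $\alpha\in\mathcal I_k^+$ let $n_\alpha(k)^2$ be the number of $p\in B_F^c\cap B_\alpha$ with $p-k\in B_F\cap B_\alpha$, and $b_\alpha^*(k)=n_\alpha(k)^{-1}\sum_pa_p^*a_{p-k}^*$, the sum running over these $p$ (and $b_\alpha^*(k)=0$ if there are none). For $k\in\Gamma^{\rm nor}$ let $c_\alpha^*(k)=b_\alpha^*(k)$ if $\alpha\in\mathcal I_k^+$; if $\alpha\in\mathcal I_k^-$, let $c_\alpha^*(k)=b_\alpha^*(-k)$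 and $n_\alpha(k):=n_\alpha(-k)$. *Kernels.* For $k\in\Gamma^{\rm nor}$ let $D,W,\widetilde W$ be the real symmetric matrices indexed by $\mathcal I_k$ with $D_{\alpha\beta}=\delta_{\alpha\beta}|\hat k\cdot\hat\omega_\alpha|$, where $\hat k=k/|k|$; $W_{\alpha\beta}=\frac{\hat V(k)}{2\hbar\kappa N|k|}n_\alpha(k)n_\beta(k)$ if $\alpha,\beta$ both lie in $\mathcal I_k^+$ or both in $\mathcal I_k^-$, and $0$ otherwise; $\widetilde W_{\alpha\beta}$ is the same number if one of $\alpha,\beta$ lies in $\mathcal I_k^+$ and the other in $\mathcal I_k^-$, and $0$ otherwise. Let $E=[(D+W-\widetilde W)^{1/2}(D+W+\widetilde W)(D+W-\widetilde W)^{1/2}]^{1/2}$, $S_1=(D+W-\widetilde W)^{1/2}E^{-1/2}$, $K(k)=\log|S_1^T|$, and let $O$ be the orthogonal factor in the polar decomposition $S_1=O|S_1|$. On $\mathcal I_k^+$ let $d=\operatorname{diag}(|\hat k\cdot\hat\omega_\alpha|)$, $v_\alpha=\hbar n_\alpha(k)/(\kappa|k|^{1/2})$, $b=\frac{\kappa\hat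 V(k)}{2}|v\rangle\langle v|$, and let $A$ be the orthogonal factor in the polar decomposition of $(d+2b)^{1/2}d^{1/2}$. Identifying $\mathcal I_k^-$ with $\mathcal I_k^+$ by reflection, let $U=\frac1{\sqrt2}\begin{pmatrix}1&1\\1&-1\end{pmatrix}$, $\widetilde O=U\begin{pmatrix}1&0\\0&A\end{pmatrix}U^T$ and $L(k)=\log(O\widetilde O)$. For $\lambda\in\mathbb R$ set $$T_\lambda=\exp\Big(\frac\lambda2\sum_{k\in\Gamma^{\rm nor}}\sum_{\alpha,\beta\in\mathcal I_k}K(k)_{\alpha\beta}c_\alpha^*(k)c_\beta^*(k)-\text{h.c.}\Big),\qquad Z_\lambda=\exp\Big(\lambda\sum_{k\in\Gamma^{\rm nor}}\sum_{\alpha,\beta\in\mathcal I_k}L(k)_{\alpha\beta}c_\alpha^*(k)c_\beta(k)\Big).$$ **Lemma (stability of number operators).** There is $A_0>0$, depending only on $\hat V,\delta,\theta,t,C_0$, and for every $m\in\mathbb N_0$ there is $C>0$, depending only on these data and $m$, such that for all $k_F>0$, $R>0$, all $M$ and all patch decompositions as above with $M\ge A_0N^{2\delta}R^2$, and all $\lambda\in[-1,1]$,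 $$T_\lambda^*\mathcal N^mT_\lambda\le C(\mathcal N+1)^m,\qquad T_\lambda^*\mathcal N_\delta\mathcal N^mT_\lambda\le C(\mathcal N_\delta+1)(\mathcal N+1)^m,$$ $$Z_\lambda^*\mathcal N^mZ_\lambda=\mathcal N^m,\qquad Z_\lambda^*\mathcal N_\delta\mathcal N^mZ_\lambda\le C\,\mathcal N_\delta\mathcal N^m .$$ The inequalities are inequalities of quadratic forms on all of $\mathcal F$ with values in $[0,\infty]$; the equality is one of unbounded operators, including their domains. -/

import Mathlib

open scoped ENNReal NNReal

namespace RPA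

noncomputable section

/-! ### Momenta and the Fermi ball -/

/-- Momenta `p ∈ ℤ³`. -/
abbrev Mom := Fin 3 → ℤ

/-- Euclidean three-space. -/
abbrev E3 := EuclideanSpace ℝ (Fin 3)

/-- The inclusion `ℤ³ ⊆ ℝ³`. -/
def toE3 (p : Mom) : E3 := WithLp.toLp 2 (fun i => (p i : ℝ))

/-- The lattice points of the cube `[-⌈r⌉, ⌈r⌉]³`, which contains the ball of radius `r`. -/
def box (r : ℝ) : Finset Mom := Finset.Icc (fun _ => -⌈r⌉) (fun _ => ⌈r⌉)

open Classical in
/-- The Fermi ball `B_F = {p ∈ ℤ³ : |p| ≤ k_F}`. -/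
def fermiBall (kF : ℝ) : Finset Mom := {p ∈ box kF | ‖toE3 p‖ ≤ kF}

theorem mem_box {r : ℝ} {p : Mom} (h : ‖toE3 p‖ ≤ r) : p ∈ box r := by
  have h1 : ∀ i, |(p i : ℝ)| ≤ r := fun i => by
    have := PiLp.norm_apply_le (toE3 p) i
    simpa [toE3] using this.trans h
  have h2 : ∀ i, (p i : ℝ) ≤ (⌈r⌉ : ℤ) ∧ -((⌈r⌉ : ℤ) : ℝ) ≤ p i := fun i => by
    have h3 := abs_le.mp (h1 i)
    have h4 := Int.le_ceil r
    constructor <;> linarith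
  refine Finset.mem_Icc.mpr ⟨fun i => ?_, fun i => ?_⟩
  · exact_mod_cast (h2 i).2
  · exact_mod_cast (h2 i).1

theorem mem_fermiBall {kF : ℝ} {p : Mom} : p ∈ fermiBall kF ↔ ‖toE3 p‖ ≤ kF := by
  unfold fermiBall
  rw [Finset.mem_filter]
  exact ⟨fun h => h.2, fun h => ⟨mem_box h, h⟩⟩

/-- The particle number `N = |B_F|`. -/
def numN (kF : ℝ) : ℕ := (fermiBall kF).card

/-- `ħ = N^{-1/3}`. -/
def hbar (kF : ℝ) : ℝ := (numN kF : ℝ) ^ (-(1 / 3) : ℝ)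

/-- `κ`, defined by `k_F = κ N^{1/3}`. -/
def kappa (kF : ℝ) : ℝ := kF / (numN kF : ℝ) ^ (1 / 3 : ℝ)

/-! ### Fermionic Fock space

The fermionic Fock space over `L²(𝕋³)` in the occupation number representation.  The plane waves
`f_p`, `p ∈ ℤ³`, form an orthonormal basis of `L²(𝕋³)`, so the Slater determinants
`e_S = f_{p₁} ∧ … ∧ f_{pₙ}`, one for each finite set `S = {p₁ < … < pₙ}` of momenta (ordered
lexicographically), form an orthonormal basis of Fock space.  A Fock space vector is the family of
its coefficients `ψ S` in this basis. -/

/-- Fermionic Fock space. -/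
abbrev Fock := lp (fun _ : Finset Mom => ℂ) 2

open Classical in
/-- The sign `(-1)^{|{q ∈ S : q < p}|}`. -/
def jwSign (p : Mom) (S : Finset Mom) : ℂ :=
  (-1) ^ (S.filter (fun q => toLex q < toLex p)).card

/-- The coefficients of `a_p ψ`: one has `a_p e_{S ∪ {p}} = ± e_S` if `p ∉ S`, and `a_p e_S = 0`
otherwise. -/
def annCoeff (p : Mom) (ψ : Finset Mom → ℂ) (S : Finset Mom) : ℂ :=
  if p ∈ S then 0 else jwSign p S * ψ (insert p S)

theorem norm_jwSign (p : Mom) (S : Finset Mom) : ‖jwSign p S‖ = 1 := by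
  simp [jwSign]

theorem sum_annCoeff_le (p : Mom) (ψ : Fock) (s : Finset (Finset Mom)) :
    ∑ S ∈ s, ‖annCoeff p ψ S‖ ^ (2 : ℝ≥0∞).toReal ≤ ‖ψ‖ ^ (2 : ℝ≥0∞).toReal := by
  classical
  have h2 : 0 < (2 : ℝ≥0∞).toReal := by norm_num
  have h1 : ∑ S ∈ s, ‖annCoeff p ψ S‖ ^ (2 : ℝ≥0∞).toReal
      = ∑ S ∈ s.filter (fun S => p ∉ S), ‖ψ (insert p S)‖ ^ (2 : ℝ≥0∞).toReal := by
    rw [Finset.sum_filter]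
    refine Finset.sum_congr rfl fun S _ => ?_
    by_cases h : p ∈ S
    · simp [annCoeff, h]
    · simp [annCoeff, h, norm_jwSign]
  have h3 : Set.InjOn (fun S : Finset Mom => insert p S)
      ((s.filter (fun S => p ∉ S) : Finset (Finset Mom)) : Set (Finset Mom)) := by
    intro S hS T hT h
    have hS' : p ∉ S := (Finset.mem_filter.mp hS).2
    have hT' : p ∉ T := (Finset.mem_filter.mp hT).2
    rw [← Finset.erase_insert hS', ← Finset.erase_insert hT']
    exact congrArg (fun U => Finset.erase U p) h
  rw [h1, ← Finset.sum_image (f := fun S => ‖ψ S‖ ^ (2 : ℝ≥0∞).toReal) h3]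
  exact lp.sum_rpow_le_norm_rpow h2 ψ _

theorem memℓp_annCoeff (p : Mom) (ψ : Fock) : Memℓp (annCoeff p ψ) 2 :=
  memℓp_gen' (sum_annCoeff_le p ψ)

/-- The annihilation operator `a_p`. -/
def ann (p : Mom) : Fock →L[ℂ] Fock :=
  LinearMap.mkContinuous
    { toFun := fun ψ => ⟨annCoeff p ψ, memℓp_annCoeff p ψ⟩
      map_add' := fun ψ φ => by
        ext S
        change annCoeff p (ψ + φ) S = annCoeff p ψ S + annCoeff p φ S
        by_cases h : p ∈ S <;> simp [annCoeff, h, mul_add]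
      map_smul' := fun c ψ => by
        ext S
        change annCoeff p (c • ψ) S = c * annCoeff p ψ S
        by_cases h : p ∈ S <;> simp [annCoeff, h, mul_left_comm] }
    1 (fun ψ => by
      rw [one_mul]
      exact lp.norm_le_of_forall_sum_le (by norm_num) (norm_nonneg _) (sum_annCoeff_le p ψ))

/-- The creation operator `a_p^*`. -/
def cre (p : Mom) : Fock →L[ℂ] Fock := ContinuousLinearMap.adjoint (ann p)

/-! ### Number operators

The operator `a_p^* a_p` is diagonal, `a_p^* a_p e_S = 1_{p ∈ S} e_S` (`cre_ann_apply`), hence so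
are the number operators: `∑_{p ∈ G} a_p^* a_p` multiplies the coefficient `ψ S` by `|S ∩ G|`, and
products of number operators act by multiplication with the products of the multipliers. -/

theorem cre_ann_apply (p : Mom) (ψ : Fock) (S : Finset Mom) :
    cre p (ann p ψ) S = if p ∈ S then ψ S else 0 := by
  classical
  have h1 : ∀ φ : Fock, φ S = inner ℂ (lp.single 2 S (1 : ℂ) : Fock) φ := fun φ => by
    rw [lp.inner_single_left]
    simp
  have h2 : ann p (lp.single 2 S (1 : ℂ) : Fock)
      = if p ∈ S then (lp.single 2 (S.erase p) (jwSign p (S.erase p)) : Fock) else 0 := by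
    ext U
    have h3 : ann p (lp.single 2 S (1 : ℂ) : Fock) U
        = if p ∈ U then 0 else jwSign p U * (Pi.single S (1 : ℂ) : Finset Mom → ℂ) (insert p U) :=
      rfl
    rw [h3]
    by_cases hS : p ∈ S
    · by_cases hU : p ∈ U
      · have hne : U ≠ S.erase p := fun h => by simp [h] at hU
        simp [hS, hU, lp.single_apply, hne]
      · by_cases hUS : U = S.erase p
        · subst hUS
          simp [hS, lp.single_apply]
        · have hne : insert p U ≠ S := fun h => hUS (by rw [← h, Finset.erase_insert hU])
          simp [hS, hU, lp.single_apply, hUS, hne]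
    · have hne : insert p U ≠ S := fun h => hS (by rw [← h]; exact Finset.mem_insert_self p U)
      simp [hS, hne]
  have h4 : ∀ V : Finset Mom, ann p ψ V = if p ∈ V then 0 else jwSign p V * ψ (insert p V) :=
    fun _ => rfl
  rw [h1 (cre p (ann p ψ)), cre, ContinuousLinearMap.adjoint_inner_right, h2]
  by_cases hS : p ∈ S
  · rw [if_pos hS, if_pos hS, lp.inner_single_left, h4, if_neg (by simp), Finset.insert_erase hS]
    have h5 : jwSign p (S.erase p) * jwSign p (S.erase p) = 1 := by
      rw [jwSign, ← pow_add, ← two_mul, pow_mul]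
      simp
    have h6 : (starRingEnd ℂ) (jwSign p (S.erase p)) = jwSign p (S.erase p) := by
      simp [jwSign]
    simp only [RCLike.inner_apply, h6]
    rw [mul_right_comm, h5, one_mul]
  · simp [hS]

open Classical in
/-- The multiplier `|S ∩ G|` of the number operator `∑_{p ∈ G} a_p^* a_p`. -/
def cnt (G : Set Mom) (S : Finset Mom) : ℕ := (S.filter (fun p => p ∈ G)).card

/-- The multiplier `|S|` of the number operator `𝓝 = ∑_p a_p^* a_p`. -/
def nTot (S : Finset Mom) : ℕ := cnt Set.univ S

/-- The momenta at distance more than `g` from the Fermi sphere. -/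
def gapSet (kF g : ℝ) : Set Mom := {p | g < |‖toE3 p‖ - kF|}

/-- The multiplier of the gapped number operator
`∑_{p : ||p| - k_F| > θ N^{-δ}} a_p^* a_p`. -/
def nGap (kF δ θ : ℝ) (S : Finset Mom) : ℕ :=
  cnt (gapSet kF (θ * (numN kF : ℝ) ^ (-δ))) S

/-- The (in general unbounded) self-adjoint operator of multiplication by `w`, on its maximal
domain. -/
def mulOp (w : Finset Mom → ℕ) : Fock →ₗ.[ℂ] Fock where
  domain :=
    { carrier := {ψ | Memℓp (fun S => (w S : ℂ) * ψ S) 2}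
      add_mem' := fun {ψ φ} hψ hφ => by
        have h := Memℓp.add hψ hφ
        have e : (fun S => (w S : ℂ) * (ψ + φ) S)
            = (fun S => (w S : ℂ) * ψ S) + fun S => (w S : ℂ) * φ S := by
          funext S
          simp [mul_add]
        simpa only [Set.mem_ofPred_eq, e] using h
      zero_mem' := by
        have e : (fun S => (w S : ℂ) * (0 : Fock) S) = 0 := by
          funext S
          simp
        simpa only [Set.mem_ofPred_eq, e] using (zero_memℓp : Memℓp (0 : Finset Mom → ℂ) 2)
      smul_mem' := fun c ψ hψ => by
        have h := Memℓp.const_smul hψ c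
        have e : (fun S => (w S : ℂ) * (c • ψ) S) = c • fun S => (w S : ℂ) * ψ S := by
          funext S
          simp [mul_left_comm]
        simpa only [Set.mem_ofPred_eq, e] using h }
  toFun :=
    { toFun := fun ψ => ⟨fun S => (w S : ℂ) * ψ.1 S, ψ.2⟩
      map_add' := fun ψ φ => by
        ext S
        change (w S : ℂ) * (ψ.1 + φ.1) S = w S * ψ.1 S + w S * φ.1 S
        simp [mul_add]
      map_smul' := fun c ψ => by
        ext S
        change (w S : ℂ) * (c • ψ.1) S = c * (w S * ψ.1 S)
        simp [mul_left_comm] }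

/-- The quadratic form `⟨ψ, A ψ⟩ = ‖A^{1/2} ψ‖² ∈ [0, ∞]` of the non-negative self-adjoint operator
`A = mulOp w`; it is finite exactly on the form domain of `A`.  For operators `A, B` of this kind
and a unitary `U`, the operator inequality `U^* A U ≤ C B` means that
`⟨U ψ, A U ψ⟩ ≤ C ⟨ψ, B ψ⟩` in `[0, ∞]` for all `ψ`, that is, `U` maps the form domain of `B` into
that of `A`, and the inequality holds there. -/
def form (w : Finset Mom → ℕ) (ψ : Fock) : ℝ≥0∞ := ∑' S, (w S : ℝ≥0∞) * ‖ψ S‖ₑ ^ 2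

/-- The operator `U^* A U`, with domain `{ψ : U ψ ∈ D(A)}`. -/
def conjOp (U : Fock →L[ℂ] Fock) (A : Fock →ₗ.[ℂ] Fock) : Fock →ₗ.[ℂ] Fock where
  domain := A.domain.comap U.toLinearMap
  toFun := (ContinuousLinearMap.adjoint U).toLinearMap ∘ₗ A.toFun ∘ₗ
    (U.toLinearMap.restrict (fun _ h => h) : A.domain.comap U.toLinearMap →ₗ[ℂ] A.domain)

/-! ### Patches on the Fermi sphere -/

/-- The part of the shell `k_F - R ≤ |p| ≤ k_F + R` whose radial projection lies in the subset
`c` of the unit sphere. -/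
def shell (kF R : ℝ) (c : Set E3) : Set E3 :=
  {p | kF - R ≤ ‖p‖ ∧ ‖p‖ ≤ kF + R ∧ ‖p‖⁻¹ • p ∈ c}

/-- A decomposition of the shell of thickness `2R` around the Fermi sphere into `M = 2n` patches
`B_α`.  A patch is given by its radial projection `p_α = cap α` to the unit sphere and by its
normalized center `ω̂_α`.  The label `(i, true)` is a patch in a half sphere, `(i, false)` is its
reflection at the origin.  The `p_α` have diameter at most `C₀ M^{-1/2}` and area `4π / M` up to
corrections of order `(1 + R) N^{-1/3} M^{-1/2}`, and different patches
are separated by corridors larger than `R`. -/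
structure PatchDecomposition (kF R C₀ : ℝ) (n : ℕ) where
  cap : Fin n × Bool → Set E3
  center : Fin n × Bool → E3
  cap_subset : ∀ α, cap α ⊆ Metric.sphere 0 1
  measurable_cap : ∀ α, MeasurableSet (cap α)
  center_mem : ∀ α, center α ∈ cap α
  half : ∀ i, ∀ x ∈ cap (i, true), 0 ≤ x 2
  cap_mirror : ∀ i, ∀ x, x ∈ cap (i, false) ↔ -x ∈ cap (i, true)
  center_mirror : ∀ i, center (i, false) = -center (i, true)
  diam_le : ∀ α, ∀ x ∈ cap α, ∀ y ∈ cap α, dist x y ≤ C₀ * (2 * n : ℝ) ^ (-(1 / 2) : ℝ)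
  area : ∀ α,
    |((MeasureTheory.volume : MeasureTheory.Measure E3).toSphere
        {x : Metric.sphere (0 : E3) 1 | (x : E3) ∈ cap α}).toReal - 4 * Real.pi / (2 * n)|
      ≤ C₀ * (1 + R) * (numN kF : ℝ) ^ (-(1 / 3) : ℝ) * (2 * n : ℝ) ^ (-(1 / 2) : ℝ)
  corridor : ∀ α β, α ≠ β → ∀ p ∈ shell kF R (cap α), ∀ q ∈ shell kF R (cap β), R < dist p q

variable {kF R C₀ : ℝ} {n : ℕ}

namespace PatchDecomposition

/-- The patch `B_α`. -/
def patch (P : PatchDecomposition kF R C₀ n) (α : Fin n × Bool) : Set E3 :=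
  shell kF R (P.cap α)

open Classical in
/-- The `p ∈ B_F^c ∩ B_α` with `p - k ∈ B_F ∩ B_α`, as a finite set. -/
def pairs (P : PatchDecomposition kF R C₀ n) (α : Fin n × Bool) (k : Mom) : Finset Mom :=
  {p ∈ (fermiBall kF).image (fun h => h + k) |
    p ∉ fermiBall kF ∧ toE3 p ∈ P.patch α ∧ toE3 (p - k) ∈ P.patch α}

theorem mem_pairs (P : PatchDecomposition kF R C₀ n) (α : Fin n × Bool) (k p : Mom) :
    p ∈ P.pairs α k ↔ p ∉ fermiBall kF ∧ toE3 p ∈ P.patch α ∧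
      p - k ∈ fermiBall kF ∧ toE3 (p - k) ∈ P.patch α := by
  classical
  unfold pairs
  rw [Finset.mem_filter, Finset.mem_image]
  constructor
  · rintro ⟨⟨h, hh, rfl⟩, h1, h2, h3⟩
    exact ⟨h1, h2, by simpa using hh, h3⟩
  · rintro ⟨h1, h2, h3, h4⟩
    exact ⟨⟨p - k, h3, by simp⟩, h1, h2, h4⟩

/-- The normalization `n_α(k)`, the square root of the number of particle-hole pairs of relative
momentum `k` in `B_α`. -/
def nrm (P : PatchDecomposition kF R C₀ n) (α : Fin n × Bool) (k : Mom) : ℝ :=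
  √((P.pairs α k).card : ℝ)

/-- The pair creation operator `b_α^*(k)`. -/
def bStar (P : PatchDecomposition kF R C₀ n) (α : Fin n × Bool) (k : Mom) : Fock →L[ℂ] Fock :=
  (((P.nrm α k)⁻¹ : ℝ) : ℂ) • ∑ p ∈ P.pairs α k, cre p ∘L cre (p - k)

/-- The set `𝓘_k^+` of the `α` with `k · ω̂_α ≥ N^{-δ}`, as a type. -/
def IPlus (P : PatchDecomposition kF R C₀ n) (δ : ℝ) (k : Mom) : Type :=
  {α : Fin n × Bool // (numN kF : ℝ) ^ (-δ) ≤ inner ℝ (toE3 k) (P.center α)}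

instance (P : PatchDecomposition kF R C₀ n) (δ : ℝ) (k : Mom) : DecidableEq (P.IPlus δ k) :=
  Classical.decEq _

instance (P : PatchDecomposition kF R C₀ n) (δ : ℝ) (k : Mom) : Fintype (P.IPlus δ k) :=
  @Fintype.ofFinite _ (inferInstanceAs (Finite {_α : Fin n × Bool // _}))

/-- The index set `𝓘_k = 𝓘_k^+ ∪ 𝓘_k^-`.  Since `𝓘_k^-` consists of the reflections of the elements
of `𝓘_k^+`, it is written as two copies of `𝓘_k^+`: the index `inl α` stands for `α ∈ 𝓘_k^+`, and
`inr α` for the reflection of `α`, an element of `𝓘_k^-` (see `label`). -/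
abbrev I (P : PatchDecomposition kF R C₀ n) (δ : ℝ) (k : Mom) : Type :=
  P.IPlus δ k ⊕ P.IPlus δ k

section kernels

variable (P : PatchDecomposition kF R C₀ n) (Vhat : Mom → ℝ) (δ : ℝ) (k : Mom)

/-- The patch that an index in `𝓘_k` stands for. -/
def label : P.I δ k → Fin n × Bool
  | Sum.inl α => α.1
  | Sum.inr α => (α.1.1, !α.1.2)

/-- `k` for the indices in `𝓘_k^+`, and `-k` for those in `𝓘_k^-`. -/
def signedMom : P.I δ k → Mom
  | Sum.inl _ => k
  | Sum.inr _ => -k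

/-- `c_α^*(k)`, that is, `b_α^*(k)` for `α ∈ 𝓘_k^+` and `b_α^*(-k)` for `α ∈ 𝓘_k^-`. -/
def cStar (α : P.I δ k) : Fock →L[ℂ] Fock := P.bStar (P.label δ k α) (P.signedMom δ k α)

/-- `c_α(k)`. -/
def c (α : P.I δ k) : Fock →L[ℂ] Fock := ContinuousLinearMap.adjoint (P.cStar δ k α)

/-- `n_α(k)` for `α ∈ 𝓘_k` (with `-k` in place of `k` if `α ∈ 𝓘_k^-`). -/
def nI (α : P.I δ k) : ℝ := P.nrm (P.label δ k α) (P.signedMom δ k α)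

/-- `|k̂ · ω̂_α|`. -/
def cosAngle (α : Fin n × Bool) : ℝ := |inner ℝ (toE3 k) (P.center α)| / ‖toE3 k‖

/-- `D(k)_{α,β} = δ_{α,β} |k̂ · ω̂_α|`. -/
def D : Matrix (P.I δ k) (P.I δ k) ℝ :=
  Matrix.diagonal fun α => P.cosAngle k (P.label δ k α)

/-- `W(k)`: equal to `V̂(k) n_α(k) n_β(k) / (2 ħ κ N |k|)` if `α, β` are both in `𝓘_k^+` or both
in `𝓘_k^-`, and `0` otherwise. -/
def W : Matrix (P.I δ k) (P.I δ k) ℝ := fun α β =>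
  if α.isLeft = β.isLeft then
    Vhat k / (2 * hbar kF * kappa kF * numN kF * ‖toE3 k‖) * (P.nI δ k α * P.nI δ k β)
  else 0

/-- `W̃(k)`: equal to `V̂(k) n_α(k) n_β(k) / (2 ħ κ N |k|)` if one of `α, β` is in `𝓘_k^+` and the
other in `𝓘_k^-`, and `0` otherwise. -/
def Wt : Matrix (P.I δ k) (P.I δ k) ℝ := fun α β =>
  if α.isLeft = β.isLeft then 0
  else Vhat k / (2 * hbar kF * kappa kF * numN kF * ‖toE3 k‖) * (P.nI δ k α * P.nI δ k β)

end kernels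

end PatchDecomposition

/-! ### The Bogoliubov kernels -/

/-- The square root of a positive semidefinite real matrix. -/
def msqrt {ι : Type} [Fintype ι] [DecidableEq ι] (A : Matrix ι ι ℝ) : Matrix ι ι ℝ :=
  cfc Real.sqrt A

/-- The logarithm of a positive definite real matrix. -/
def mlog {ι : Type} [Fintype ι] [DecidableEq ι] (A : Matrix ι ι ℝ) : Matrix ι ι ℝ :=
  cfc Real.log A

/-- `|A| = (Aᵀ A)^{1/2}`. -/
def mabs {ι : Type} [Fintype ι] [DecidableEq ι] (A : Matrix ι ι ℝ) : Matrix ι ι ℝ :=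
  msqrt (A.transpose * A)

/-- The orthogonal factor `A |A|⁻¹` in the polar decomposition of an invertible real matrix. -/
def polarFactor {ι : Type} [Fintype ι] [DecidableEq ι] (A : Matrix ι ι ℝ) : Matrix ι ι ℝ :=
  A * (mabs A)⁻¹

/-- The branch of the complex logarithm with imaginary part in `(t - 2π, t]`; for `0 < t < 2π` its
value at `1` is `0`. -/
def branchLog (t : ℝ) (z : ℂ) : ℂ :=
  Complex.log (z * Complex.exp ((Real.pi - t : ℝ) * Complex.I)) - (Real.pi - t : ℝ) * Complex.I

open scoped Matrix.Norms.L2Operator in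
/-- The logarithm of an orthogonal matrix, for the branch `branchLog t`. -/
def orthLog {ι : Type} [Fintype ι] [DecidableEq ι] (t : ℝ) (Q : Matrix ι ι ℝ) : Matrix ι ι ℂ :=
  cfc (branchLog t) (Q.map (fun x => (x : ℂ)))

namespace PatchDecomposition

section kernels

variable (P : PatchDecomposition kF R C₀ n) (Vhat : Mom → ℝ) (δ : ℝ) (k : Mom)

/-- `E = [(D + W - W̃)^{1/2} (D + W + W̃) (D + W - W̃)^{1/2}]^{1/2}`. -/
def E : Matrix (P.I δ k) (P.I δ k) ℝ :=
  msqrt (msqrt (P.D δ k + P.W Vhat δ k - P.Wt Vhat δ k)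
    * (P.D δ k + P.W Vhat δ k + P.Wt Vhat δ k)
    * msqrt (P.D δ k + P.W Vhat δ k - P.Wt Vhat δ k))

/-- `S₁ = (D + W - W̃)^{1/2} E^{-1/2}`. -/
def S1 : Matrix (P.I δ k) (P.I δ k) ℝ :=
  msqrt (P.D δ k + P.W Vhat δ k - P.Wt Vhat δ k) * (msqrt (P.E Vhat δ k))⁻¹

/-- The Bogoliubov kernel `K(k) = log |S₁ᵀ|`. -/
def K : Matrix (P.I δ k) (P.I δ k) ℝ := mlog (mabs (P.S1 Vhat δ k).transpose)

/-- The orthogonal matrix `O(k)` in the polar decomposition `S₁ = O |S₁|`. -/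
def O : Matrix (P.I δ k) (P.I δ k) ℝ := polarFactor (P.S1 Vhat δ k)

/-- `d = diag(u_α²)` with `u_α² = |k̂ · ω̂_α|`, `α ∈ 𝓘_k^+`. -/
def d : Matrix (P.IPlus δ k) (P.IPlus δ k) ℝ := Matrix.diagonal fun α => P.cosAngle k α.1

/-- `v_α = ħ n_α(k) / (κ |k|^{1/2})`, `α ∈ 𝓘_k^+`. -/
def v : P.IPlus δ k → ℝ := fun α => hbar kF / (kappa kF * √‖toE3 k‖) * P.nrm α.1 k

/-- `b = g |v⟩⟨v|` with `g = κ V̂(k) / 2`. -/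
def b : Matrix (P.IPlus δ k) (P.IPlus δ k) ℝ :=
  (kappa kF / 2 * Vhat k) • Matrix.vecMulVec (P.v δ k) (P.v δ k)

/-- The orthogonal matrix `A` in the polar decomposition of `X = (d + 2b)^{1/2} d^{1/2}`. -/
def A : Matrix (P.IPlus δ k) (P.IPlus δ k) ℝ :=
  polarFactor (msqrt (P.d δ k + (2 : ℝ) • P.b Vhat δ k) * msqrt (P.d δ k))

/-- `U = 2^{-1/2} ((1, 1), (1, -1))`, with respect to `𝓘_k = 𝓘_k^+ ∪ 𝓘_k^-`. -/
def U : Matrix (P.I δ k) (P.I δ k) ℝ := (√2)⁻¹ • Matrix.fromBlocks 1 1 1 (-1)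

/-- `Õ = U ((1, 0), (0, A)) Uᵀ`. -/
def Ot : Matrix (P.I δ k) (P.I δ k) ℝ :=
  P.U δ k * Matrix.fromBlocks 1 0 0 (P.A Vhat δ k) * (P.U δ k).transpose

/-- `L(k) = log (O(k) Õ(k))`, for the branch of the logarithm given by `t`. -/
def L (t : ℝ) : Matrix (P.I δ k) (P.I δ k) ℂ := orthLog t (P.O Vhat δ k * P.Ot Vhat δ k)

end kernels

end PatchDecomposition

/-! ### The approximate Bogoliubov transformations -/

open Classical in
/-- `Γ^nor`: half of the lattice points `k ≠ 0` with `|k| < R` (the coordinates `k₁, k₂, k₃` are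
`k 0, k 1, k 2`). -/
def gammaNor (R : ℝ) : Finset Mom :=
  {k ∈ box R | ‖toE3 k‖ < R ∧
    (0 < k 2 ∨ (k 2 = 0 ∧ 0 < k 1) ∨ (k 2 = 0 ∧ k 1 = 0 ∧ 0 < k 0))}

namespace PatchDecomposition

variable (P : PatchDecomposition kF R C₀ n) (Vhat : Mom → ℝ) (δ : ℝ)

/-- `½ ∑_{k ∈ Γ^nor} ∑_{α,β ∈ 𝓘_k} K(k)_{α,β} c_α^*(k) c_β^*(k)`. -/
def expT : Fock →L[ℂ] Fock :=
  (1 / 2 : ℂ) • ∑ k ∈ gammaNor R, ∑ α : P.I δ k, ∑ β : P.I δ k,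
    (P.K Vhat δ k α β : ℂ) • (P.cStar δ k α ∘L P.cStar δ k β)

/-- `T_λ`. -/
def T (lam : ℝ) : Fock →L[ℂ] Fock :=
  NormedSpace.exp ((lam : ℂ) •
    (P.expT Vhat δ - ContinuousLinearMap.adjoint (P.expT Vhat δ)))

/-- `∑_{k ∈ Γ^nor} ∑_{α,β ∈ 𝓘_k} L(k)_{α,β} c_α^*(k) c_β(k)`. -/
def expZ (t : ℝ) : Fock →L[ℂ] Fock :=
  ∑ k ∈ gammaNor R, ∑ α : P.I δ k, ∑ β : P.I δ k,
    P.L Vhat δ k t α β • (P.cStar δ k α ∘L P.c δ k β)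

/-- `Z_λ`. -/
def Z (t lam : ℝ) : Fock →L[ℂ] Fock := NormedSpace.exp ((lam : ℂ) • P.expZ Vhat δ t)

end PatchDecomposition

end

end RPA

namespace RPA

/-! ### Counting lattice points leaving a ball -/

/-! The estimates are a Grönwall argument. In the occupation basis number operators multiply the
coefficient at `S` by a weight `w S`, and `s ↦ ⟨e^{sX}ψ, w e^{sX}ψ⟩` grows at most exponentially
once the form of the commutator `[w, X]` is bounded by a constant times that of `w`
(`re_inner_exp_le`). Bounded truncations of the weights, exhausting them monotonically, give the
result on all of Fock space with values in `[0, ∞]`.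

The commutator bound has two inputs. The first is combinatorial. An exponent of `T` changes the
particle number by four, so `[w, X]` only sees increments of `w`; for the weights in question these
are of size `w / (nGap + 1)`. Each admissible pair contains a momentum outside the gap (`Fine.gap`)
and the patches are disjoint, so a configuration contains at most `nGap` pairs for each `k`
(`Fine.sum_card_filter_le`). Two pair annihilations thus cost a factor `nGap`, compensated by the
increment, and Cauchy-Schwarz over the patch indices leaves only the Hilbert-Schmidt norm of the
kernel (`norm_sum_comm_le`). An exponent of `Z` moves one pair: it preserves the particle number and
changes `nGap` by at most two, so one factor `nGap` suffices and no `+ 1` is needed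
(`norm_sum_comm_move_le`). Preservation of the particle number also gives the exact identity for
`Z`, which is unitary.

The second input is that the Hilbert-Schmidt norms of `K(k)` and `L(k)` are at most a constant times
`V̂(k)`, which is summable. In symmetric and antisymmetric variables the matrices become block
diagonal, and both kernels are controlled by `τ = ∑ b_αα / d_α` (`RPA.kernel_bounds`). The point of
multiplying `O` by `Õ` is that the product acts by the same orthogonal matrix on both blocks, and
this matrix is close to `1`.

It remains to bound `τ` uniformly in the cutoff on angles. Up to constants it is `V̂(k) / k_F²`
times the sum of `k_F / (k · p)` over lattice points `p` that leave the Fermi ball under translation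
by `k`; `sum_exit_le` bounds this by counting lattice lines parallel to `k`. Finally `fine_of_le`
turns the lower bound on the number of patches into the smallness needed, using that the corridors
limit how many patches fit on the sphere. -/

theorem sum_inv_sqrt_le (n : ℕ) : ∑ i ∈ Finset.range n, 1 / √((i : ℝ) + 1) ≤ 2 * √(n : ℝ) := by
  induction n with
  | zero => simp
  | succ n ih =>
    rw [Finset.sum_range_succ]
    have h1 : 0 < √((n : ℝ) + 1) := Real.sqrt_pos.mpr (by positivity)
    have h2 : √((n : ℝ) + 1) ^ 2 = n + 1 := Real.sq_sqrt (by positivity)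
    have h3 : √(n : ℝ) ^ 2 = n := Real.sq_sqrt (by positivity)
    have h4 : 0 ≤ √(n : ℝ) := Real.sqrt_nonneg _
    have h5 : 1 / √((n : ℝ) + 1) ≤ 2 * √((n : ℝ) + 1) - 2 * √(n : ℝ) := by
      rw [div_le_iff₀ h1]
      nlinarith [sq_nonneg (√((n : ℝ) + 1) - √(n : ℝ))]
    push_cast
    linarith

/-- The reciprocals of `√(α ρ (ρ - t))` over a `1`-separated set of `t`, cut off at `μ`. -/
theorem sum_inv_max_le_of_floor (Y : Finset ℤ) (s : ℤ → ℝ) (g : ℤ → ℝ) (ρ μ : ℝ)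
    (hμ : 0 < μ) (hs : ∀ y ∈ Y, 0 ≤ s y) (hsρ : ∀ y ∈ Y, s y ≤ ρ)
    (hinj : ∀ y ∈ Y, ∀ y' ∈ Y, ⌊s y⌋₊ = ⌊s y'⌋₊ → y = y')
    (hgμ : ∀ y ∈ Y, μ ≤ g y) (hg : ∀ y ∈ Y, ρ * s y / 2 ≤ g y ^ 2) :
    ∑ y ∈ Y, 1 / g y ≤ 1 / μ + 2 * √2 := by
  classical
  -- Each value `i` of the floor of `s` is taken at most once. The bucket `i = 0` is paid for by the
  -- cutoff `μ`; for `i ≥ 1` one has `g² ≥ ρ i / 2`, and `∑ 1/√i ≤ 2√ρ` cancels the `√ρ`.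
  set F : ℕ → ℝ := fun i => if i = 0 then 1 / μ else √2 / √ρ * (1 / √(i : ℝ)) with hF
  have h2 : 0 < √(2 : ℝ) := Real.sqrt_pos.mpr (by norm_num)
  have hF0 : ∀ i, 0 ≤ F i := fun i => by
    simp only [hF]; split_ifs <;> positivity
  have h1 : ∀ y ∈ Y, 1 / g y ≤ F ⌊s y⌋₊ := by
    intro y hy
    have hgp : 0 < g y := hμ.trans_le (hgμ y hy)
    by_cases h0 : ⌊s y⌋₊ = 0
    · simp only [hF, h0, if_true]
      exact one_div_le_one_div_of_le hμ (hgμ y hy)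
    · simp only [hF, h0, if_false]
      have hi : (⌊s y⌋₊ : ℝ) ≤ s y := Nat.floor_le (hs y hy)
      have hip : (0 : ℝ) < ⌊s y⌋₊ := by exact_mod_cast Nat.pos_of_ne_zero h0
      have hρ : 0 < ρ := by linarith [hsρ y hy]
      have h3 : √ρ * √(⌊s y⌋₊ : ℝ) / √2 ≤ g y := by
        rw [← Real.sqrt_mul hρ.le, ← Real.sqrt_div' _ (by norm_num)]
        rw [Real.sqrt_le_left hgp.le]
        refine le_trans ?_ (hg y hy)
        have := mul_le_mul_of_nonneg_left hi hρ.le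
        linarith
      have h4 : 0 < √ρ * √(⌊s y⌋₊ : ℝ) / √2 :=
        div_pos (mul_pos (Real.sqrt_pos.mpr hρ) (Real.sqrt_pos.mpr hip)) h2
      refine (one_div_le_one_div_of_le h4 h3).trans (le_of_eq ?_)
      have := Real.sqrt_pos.mpr hρ
      have := Real.sqrt_pos.mpr hip
      field_simp
  calc ∑ y ∈ Y, 1 / g y ≤ ∑ y ∈ Y, F ⌊s y⌋₊ := Finset.sum_le_sum h1
    _ = ∑ i ∈ Y.image (fun y => ⌊s y⌋₊), F i := by
        rw [Finset.sum_image]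
        intro y hy y' hy' h
        exact hinj y hy y' hy' h
    _ ≤ ∑ i ∈ Finset.range (⌊ρ⌋₊ + 1), F i := by
        refine Finset.sum_le_sum_of_subset_of_nonneg ?_ fun i _ _ => hF0 i
        intro i hi
        obtain ⟨y, hy, rfl⟩ := Finset.mem_image.mp hi
        exact Finset.mem_range.mpr (Nat.lt_succ_of_le (Nat.floor_mono (hsρ y hy)))
    _ ≤ 1 / μ + 2 * √2 := by
        rw [Finset.sum_range_succ']
        have h5 : ∀ i : ℕ, F (i + 1) = √2 / √ρ * (1 / √((i : ℝ) + 1)) := fun i => by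
          simp [hF]
        have h6 : F 0 = 1 / μ := by simp [hF]
        rw [h6, Finset.sum_congr rfl fun i _ => h5 i, ← Finset.mul_sum, add_comm]
        refine add_le_add le_rfl ?_
        refine (mul_le_mul_of_nonneg_left (sum_inv_sqrt_le _) (by positivity)).trans ?_
        by_cases hρ : 0 < ρ
        · have h7 := Real.sqrt_pos.mpr hρ
          have h8 : √(⌊ρ⌋₊ : ℝ) ≤ √ρ := Real.sqrt_le_sqrt (Nat.floor_le hρ.le)
          rw [div_mul_eq_mul_div, div_le_iff₀ h7]
          nlinarith
        · have : ⌊ρ⌋₊ = 0 := Nat.floor_of_nonpos (not_lt.mp hρ)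
          simp [this]

/-- Write the quadratic as `α (ρ - |y - y₀|)(ρ + |y - y₀|)`, which is at least `ρ / 2` times the
distance `ρ - |y - y₀|` to the nearer root. On each side of `y₀` these distances are `1`-separated,
so `sum_inv_max_le_of_floor` applies twice; `4√2 ≤ 6`. -/
theorem sum_inv_le_of_quadratic (Y : Finset ℤ) (g : ℤ → ℝ) (r α y₀ μ : ℝ) (hμ : 0 < μ)
    (hα : 1 / 2 ≤ α) (hf : ∀ y : ℤ, y ∈ Y → 0 ≤ r - α * ((y : ℝ) - y₀) ^ 2) (hgμ : ∀ y ∈ Y, μ ≤ g y)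
    (hg : ∀ y : ℤ, y ∈ Y → r - α * ((y : ℝ) - y₀) ^ 2 ≤ g y ^ 2) :
    ∑ y ∈ Y, 1 / g y ≤ 2 / μ + 6 := by
  classical
  have hα0 : 0 < α := by linarith
  set ρ := √(r / α) with hρ
  have key : ∀ y : ℤ, y ∈ Y → |(y : ℝ) - y₀| ≤ ρ ∧ ρ * (ρ - |(y : ℝ) - y₀|) / 2 ≤ g y ^ 2 := by
    intro y hy
    have h1 := hf y hy
    have hr : 0 ≤ r / α := by
      have : 0 ≤ r := by nlinarith [sq_nonneg ((y : ℝ) - y₀)]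
      positivity
    have h2 : ρ ^ 2 = r / α := Real.sq_sqrt hr
    have h3 : r = α * ρ ^ 2 := by rw [h2]; field_simp
    have h4 : |(y : ℝ) - y₀| ≤ ρ := by
      apply abs_le_of_sq_le_sq _ (Real.sqrt_nonneg _)
      rw [h2, le_div_iff₀ hα0]
      linarith
    refine ⟨h4, ?_⟩
    have h5 : 0 ≤ ρ := Real.sqrt_nonneg _
    have h6 : 0 ≤ |(y : ℝ) - y₀| := abs_nonneg _
    have h7 : |(y : ℝ) - y₀| ^ 2 = ((y : ℝ) - y₀) ^ 2 := sq_abs _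
    refine le_trans ?_ (hg y hy)
    rw [h3, ← h7]
    have h8 : α * ρ ^ 2 - α * |(y : ℝ) - y₀| ^ 2
        = α * ((ρ - |(y : ℝ) - y₀|) * (ρ + |(y : ℝ) - y₀|)) := by ring
    rw [h8]
    have h9 : ρ * (ρ - |(y : ℝ) - y₀|) ≤ (ρ - |(y : ℝ) - y₀|) * (ρ + |(y : ℝ) - y₀|) := by
      nlinarith
    have h10 : 0 ≤ ρ * (ρ - |(y : ℝ) - y₀|) := mul_nonneg h5 (by linarith)
    nlinarith
  have hsplit : ∑ y ∈ Y, 1 / g y = ∑ y ∈ Y.filter (fun y : ℤ => y₀ ≤ (y : ℝ)), 1 / g y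
      + ∑ y ∈ Y.filter (fun y : ℤ => ¬ y₀ ≤ (y : ℝ)), 1 / g y := (Finset.sum_filter_add_sum_filter_not _ _ _).symm
  have hfl : ∀ (a : ℝ) (x y : ℤ), 0 ≤ a - x → 0 ≤ a - y →
      ⌊a - x⌋₊ = ⌊a - y⌋₊ → x = y := by
    intro a x y hx hy h
    have h1 := Nat.floor_le hx
    have h2 := Nat.lt_floor_add_one (a - x)
    have h3 := Nat.floor_le hy
    have h4 := Nat.lt_floor_add_one (a - y)
    rw [h] at h1 h2
    have h5 : (x : ℝ) < y + 1 := by linarith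
    have h6 : (y : ℝ) < x + 1 := by linarith
    have h7 : x < y + 1 := by exact_mod_cast h5
    have h8 : y < x + 1 := by exact_mod_cast h6
    omega
  have hA : ∑ y ∈ Y.filter (fun y : ℤ => y₀ ≤ (y : ℝ)), 1 / g y ≤ 1 / μ + 2 * √2 := by
    refine sum_inv_max_le_of_floor _ (fun y => ρ - |(y : ℝ) - y₀|) g ρ μ hμ ?_ ?_ ?_ ?_ ?_
    · intro y hy
      linarith [(key y (Finset.mem_filter.mp hy).1).1]
    · intro y hy
      linarith [abs_nonneg ((y : ℝ) - y₀)]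
    · intro y hy y' hy' h
      obtain ⟨hy, hy0⟩ := Finset.mem_filter.mp hy
      obtain ⟨hy', hy0'⟩ := Finset.mem_filter.mp hy'
      have e1 := (key y hy).1
      have e2 := (key y' hy').1
      rw [abs_of_nonneg (by linarith)] at e1 e2
      simp only [abs_of_nonneg (sub_nonneg.mpr hy0), abs_of_nonneg (sub_nonneg.mpr hy0'),
        sub_sub_eq_add_sub] at h
      exact hfl (ρ + y₀) y y' (by linarith) (by linarith) h
    · intro y hy
      exact hgμ y (Finset.mem_filter.mp hy).1
    · intro y hy
      exact (key y (Finset.mem_filter.mp hy).1).2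
  have hB : ∑ y ∈ Y.filter (fun y : ℤ => ¬ y₀ ≤ (y : ℝ)), 1 / g y ≤ 1 / μ + 2 * √2 := by
    refine sum_inv_max_le_of_floor _ (fun y => ρ - |(y : ℝ) - y₀|) g ρ μ hμ ?_ ?_ ?_ ?_ ?_
    · intro y hy
      linarith [(key y (Finset.mem_filter.mp hy).1).1]
    · intro y hy
      linarith [abs_nonneg ((y : ℝ) - y₀)]
    · intro y hy y' hy' h
      obtain ⟨hy, hy0⟩ := Finset.mem_filter.mp hy
      obtain ⟨hy', hy0'⟩ := Finset.mem_filter.mp hy'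
      have e1 := (key y hy).1
      have e2 := (key y' hy').1
      rw [abs_of_nonpos (by linarith)] at e1 e2
      rw [abs_of_nonpos (by linarith), abs_of_nonpos (by linarith)] at h
      have h' := hfl (ρ - y₀) (-y) (-y') (by push_cast; linarith) (by push_cast; linarith)
        (by
          have a1 : ρ - y₀ - ((-y : ℤ) : ℝ) = ρ - -((y : ℝ) - y₀) := by push_cast; ring
          have a2 : ρ - y₀ - ((-y' : ℤ) : ℝ) = ρ - -((y' : ℝ) - y₀) := by push_cast; ring
          rw [a1, a2]; exact h)
      omega
    · intro y hy
      exact hgμ y (Finset.mem_filter.mp hy).1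
    · intro y hy
      exact (key y (Finset.mem_filter.mp hy).1).2
  have h2 : √(2 : ℝ) ≤ 3 / 2 := by
    rw [Real.sqrt_le_left (by norm_num)]; norm_num
  rw [hsplit]
  have : 2 / μ = 1 / μ + 1 / μ := by ring
  linarith

/-- The free permutation lets the largest component of `k` be moved to the last place in
`sum_exit_le`. -/
theorem norm_sq_toE3 (p : Mom) (σ : Equiv.Perm (Fin 3)) :
    ‖toE3 p‖ ^ 2 = (p (σ 0) : ℝ) ^ 2 + (p (σ 1) : ℝ) ^ 2 + (p (σ 2) : ℝ) ^ 2 := by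
  rw [EuclideanSpace.norm_sq_eq, ← Equiv.sum_comp σ, Fin.sum_univ_three]
  simp [toE3]

theorem inner_toE3 (p q : Mom) (σ : Equiv.Perm (Fin 3)) :
    inner ℝ (toE3 p) (toE3 q) = (p (σ 0) : ℝ) * q (σ 0) + (p (σ 1) : ℝ) * q (σ 1)
      + (p (σ 2) : ℝ) * q (σ 2) := by
  rw [PiLp.inner_apply, ← Equiv.sum_comp σ, Fin.sum_univ_three]
  simp [toE3, mul_comm]

theorem toE3_add (p q : Mom) : toE3 (p + q) = toE3 p + toE3 q := by
  ext i; simp [toE3]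

theorem toE3_sub (p q : Mom) : toE3 (p - q) = toE3 p - toE3 q := by
  ext i; simp [toE3]

theorem toE3_neg (p : Mom) : toE3 (-p) = -toE3 p := by
  ext i; simp [toE3]

theorem toE3_zsmul (m : ℤ) (p : Mom) : toE3 (m • p) = (m : ℝ) • toE3 p := by
  ext i; simp [toE3]

theorem abs_apply_le_norm (p : Mom) (i : Fin 3) : |(p i : ℝ)| ≤ ‖toE3 p‖ := by
  simpa [toE3] using PiLp.norm_apply_le (toE3 p) i

/-- A lattice line leaves a ball at most once. -/
theorem eq_of_exit {kF : ℝ} {k p p' : Mom} (m : ℤ) (hp : kF < ‖toE3 p‖)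
    (hpk : ‖toE3 (p - k)‖ ≤ kF) (hp' : kF < ‖toE3 p'‖) (hpk' : ‖toE3 (p' - k)‖ ≤ kF)
    (h : p' = p + m • k) : p' = p := by
  -- For `m > 0` the point `p` is the convex combination of `p - k` and `p' - k` with weights `1 -
  -- 1/m` and `1/m`, hence lies in the ball.
  have aux : ∀ (p p' : Mom) (m : ℤ), kF < ‖toE3 p‖ → ‖toE3 (p - k)‖ ≤ kF →
      ‖toE3 (p' - k)‖ ≤ kF → p' = p + m • k → 0 < m → False := by
    intro p p' m hp hpk hpk' h hm
    have hm' : (0 : ℝ) < m := by exact_mod_cast hm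
    have hconv := (convex_closedBall (0 : E3) kF)
    have h1 : toE3 (p - k) ∈ Metric.closedBall (0 : E3) kF := by simpa using hpk
    have h2 : toE3 (p' - k) ∈ Metric.closedBall (0 : E3) kF := by simpa using hpk'
    have h3 := hconv h1 h2 (a := 1 - 1 / m) (b := 1 / m)
      (by rw [sub_nonneg, div_le_one hm']; exact_mod_cast hm) (by positivity) (by ring)
    have h4 : (1 - 1 / (m : ℝ)) • toE3 (p - k) + (1 / (m : ℝ)) • toE3 (p' - k) = toE3 p := by
      rw [h, toE3_sub, toE3_sub, toE3_add, toE3_zsmul]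
      have : (1 / (m : ℝ)) • (m : ℝ) • toE3 k = toE3 k := by
        rw [smul_smul, one_div_mul_cancel hm'.ne', one_smul]
      rw [smul_sub (1 / (m : ℝ)), smul_add, this]
      module
    rw [h4] at h3
    simp at h3
    linarith
  rcases lt_trichotomy 0 m with hm | hm | hm
  · exact (aux p p' m hp hpk hpk' h hm).elim
  · subst hm; simpa using h
  · exact (aux p' p (-m) hp' hpk' hpk (by rw [h]; simp) (by omega)).elim

/-- Sort the points by the lattice line parallel to `k` on which they lie; each line contributes at
most one point. If `q` is the component of `p` orthogonal to `k`, then `|p| > k_F` gives `(k · p)² /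
|k|² ≥ k_F² - |q|²`. Lines are labelled by integers `(x, y, z)`; for fixed `(x, z)` the right side
is a concave quadratic in `y`, so `sum_inv_le_of_quadratic` bounds the sum over `y`. The factor
`1/|k|` gained there cancels the `|k|` in the number of pairs `(x, z)`. -/
theorem sum_exit_le {kF J : ℝ} {k : Mom} (hk0 : k ≠ 0) (hk1 : 1 ≤ ‖toE3 k‖) (hkF : ‖toE3 k‖ ≤ kF)
    (hJ : 0 < J) (F : Finset Mom)
    (hF : ∀ p ∈ F, kF < ‖toE3 p‖ ∧ ‖toE3 (p - k)‖ ≤ kF ∧ J ≤ inner ℝ (toE3 k) (toE3 p)) :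
    ∑ p ∈ F, 1 / inner ℝ (toE3 k) (toE3 p) ≤ 11 * kF * (2 * ‖toE3 k‖ / J + 6) := by
  classical
  obtain ⟨i, -, hi⟩ := Finset.exists_max_image Finset.univ (fun i => |k i|) Finset.univ_nonempty
  -- The component `c` of largest modulus is used to divide along `k`. Its maximality bounds the
  -- shift of `x` and makes the quadratic in `y` uniformly concave.
  set σ := Equiv.swap i 2 with hσ
  have hσ2 : σ 2 = i := by simp [hσ]
  set a := k (σ 0) with ha
  set b := k (σ 1) with hb
  set c := k (σ 2) with hc
  have hac : |a| ≤ |c| := by rw [hc, hσ2]; exact hi _ (Finset.mem_univ _)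
  have hbc : |b| ≤ |c| := by rw [hc, hσ2]; exact hi _ (Finset.mem_univ _)
  have hc0 : c ≠ 0 := by
    intro h
    apply hk0
    ext j
    have := hi j (Finset.mem_univ _)
    rw [← hσ2, ← hc, h] at this
    simpa using this
  set κ := ‖toE3 k‖ with hκ
  have hκ0 : 0 < κ := by linarith
  have hkF0 : 1 ≤ kF := hk1.trans hkF
  have hκsq : κ ^ 2 = (a : ℝ) ^ 2 + (b : ℝ) ^ 2 + (c : ℝ) ^ 2 := norm_sq_toE3 k σ
  have hcκ : |(c : ℝ)| ≤ κ := abs_apply_le_norm k (σ 2)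
  have hbc2 : (b : ℝ) ^ 2 ≤ (c : ℝ) ^ 2 := by
    rw [sq_le_sq]; exact_mod_cast hbc
  have hb2 : (b : ℝ) ^ 2 ≤ κ ^ 2 / 2 := by nlinarith [sq_nonneg (a : ℝ)]
  -- With `w = p (σ 2) / c` the integer quotient, `p = (X, Y, Z) + w k` in the permuted coordinates,
  -- and `0 ≤ Z < |c|`: this is a representative of the line through `p`.
  set Z : Mom → ℤ := fun p => p (σ 2) % c with hZ
  set X : Mom → ℤ := fun p => p (σ 0) - p (σ 2) / c * a with hX
  set Y : Mom → ℤ := fun p => p (σ 1) - p (σ 2) / c * b with hY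
  have hpF : ∀ p ∈ F, ‖toE3 p‖ ≤ 2 * kF := fun p hp => by
    have : toE3 p = toE3 (p - k) + toE3 k := by rw [← toE3_add, sub_add_cancel]
    rw [this]
    linarith [norm_add_le (toE3 (p - k)) (toE3 k), (hF p hp).2.1]
  set m : ℕ := ⌊5 * kF⌋₊ with hm
  set B : Finset (ℤ × ℤ) := Finset.Icc (-m : ℤ) m ×ˢ Finset.Ico 0 |c| with hB
  have hmem : ∀ p ∈ F, (X p, Z p) ∈ B := by
    intro p hp
    rw [hB, Finset.mem_product]
    constructor
    -- Here `|p| ≤ 2 k_F`, and `|w a| ≤ |w c| ≤ |p (σ 2)| + |c| ≤ 3 k_F`.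
    · have h1 : |(X p : ℝ)| ≤ 5 * kF := by
        have e1 : (p (σ 2) : ℝ) = c * ((p (σ 2) / c : ℤ) : ℝ) + (Z p : ℝ) := by
          exact_mod_cast (Int.mul_ediv_add_emod (p (σ 2)) c).symm
        have e2 : |(Z p : ℝ)| ≤ |(c : ℝ)| := by
          have h1 := Int.emod_nonneg (p (σ 2)) hc0
          have h2 := Int.emod_lt_abs (p (σ 2)) hc0
          have : |Z p| ≤ |c| := by rw [abs_of_nonneg h1]; exact h2.le
          exact_mod_cast this
        have e3 : |((p (σ 2) / c : ℤ) : ℝ) * a| ≤ |(p (σ 2) : ℝ)| + |(c : ℝ)| := by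
          have h0 : |((p (σ 2) / c : ℤ) : ℝ) * a| ≤ |(c : ℝ) * ((p (σ 2) / c : ℤ) : ℝ)| := by
            rw [abs_mul, abs_mul, mul_comm]
            exact mul_le_mul_of_nonneg_right (by exact_mod_cast hac) (abs_nonneg _)
          have h1 : (c : ℝ) * ((p (σ 2) / c : ℤ) : ℝ) = p (σ 2) - Z p := by linarith
          rw [h1] at h0
          linarith [abs_sub (p (σ 2) : ℝ) (Z p : ℝ)]
        have e4 : (X p : ℝ) = p (σ 0) - ((p (σ 2) / c : ℤ) : ℝ) * a := by simp [hX]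
        rw [e4]
        have := abs_sub (p (σ 0) : ℝ) (((p (σ 2) / c : ℤ) : ℝ) * a)
        have := abs_apply_le_norm p (σ 0)
        have := abs_apply_le_norm p (σ 2)
        have := hpF p hp
        linarith
      have h2 : ((X p).natAbs : ℝ) ≤ 5 * kF := by
        rw [Nat.cast_natAbs]; exact_mod_cast h1
      have h3 : (X p).natAbs ≤ m := Nat.le_floor h2
      rw [Finset.mem_Icc]
      show -(m : ℤ) ≤ X p ∧ X p ≤ m
      omega
    · rw [Finset.mem_Ico]
      exact ⟨Int.emod_nonneg _ hc0, Int.emod_lt_abs _ hc0⟩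
  have hcard : (B.card : ℝ) ≤ 11 * kF * κ := by
    rw [hB, Finset.card_product, Int.card_Icc, Int.card_Ico]
    have h1 : ((m : ℤ) + 1 - -m).toNat = 2 * m + 1 := by omega
    have h2 : ((|c| - 0).toNat : ℝ) = |(c : ℝ)| := by
      have : ((|c| - 0).toNat : ℤ) = |c| := by rw [sub_zero]; exact Int.toNat_of_nonneg (abs_nonneg _)
      exact_mod_cast this
    rw [h1, Nat.cast_mul, h2]
    have h3 : (m : ℝ) ≤ 5 * kF := Nat.floor_le (by linarith)
    push_cast
    have : 2 * (m : ℝ) + 1 ≤ 11 * kF := by linarith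
    exact mul_le_mul this hcκ (abs_nonneg _) (by linarith)
  have hfib : ∀ u ∈ B, ∑ p ∈ F with (X p, Z p) = u, 1 / inner ℝ (toE3 k) (toE3 p)
      ≤ 1 / κ * (2 / (J / κ) + 6) := by
    rintro ⟨x, z⟩ -
    set G := F.filter (fun p => (X p, Z p) = (x, z)) with hG
    have hG' : ∀ p ∈ G, p ∈ F ∧ X p = x ∧ Z p = z := fun p hp => by
      simpa [hG, Prod.ext_iff] using hp
    have hrep : ∀ p ∈ G, (p (σ 0) : ℝ) = x + ((p (σ 2) / c : ℤ) : ℝ) * a ∧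
        (p (σ 1) : ℝ) = Y p + ((p (σ 2) / c : ℤ) : ℝ) * b ∧
        (p (σ 2) : ℝ) = z + ((p (σ 2) / c : ℤ) : ℝ) * c := by
      intro p hp
      obtain ⟨-, h1, h2⟩ := hG' p hp
      refine ⟨?_, ?_, ?_⟩
      · rw [← h1]; simp [hX]
      · simp [hY]
      · rw [← h2]
        have := Int.mul_ediv_add_emod (p (σ 2)) c
        have h3 : p (σ 2) = Z p + p (σ 2) / c * c := by simp only [hZ]; linarith
        exact_mod_cast h3
    -- Equal `X`, `Y` and `Z` mean the same line, which leaves the ball only once.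
    have hinj : Set.InjOn Y G := by
      intro p hp p' hp' hYY
      obtain ⟨hpF', hx, hz⟩ := hG' p hp
      obtain ⟨hpF'', hx', hz'⟩ := hG' p' hp'
      have h1 := hF p hpF'
      have h2 := hF p' hpF''
      refine (eq_of_exit (p' (σ 2) / c - p (σ 2) / c) h1.1 h1.2.1 h2.1 h2.2.1 ?_).symm
      have f0 : p' (σ 0) = p (σ 0) + (p' (σ 2) / c - p (σ 2) / c) * a := by
        have : X p' = X p := hx'.trans hx.symm
        simp only [hX] at this; linarith
      have f1 : p' (σ 1) = p (σ 1) + (p' (σ 2) / c - p (σ 2) / c) * b := by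
        simp only [hY] at hYY; linarith
      have f2 : p' (σ 2) = p (σ 2) + (p' (σ 2) / c - p (σ 2) / c) * c := by
        have h3 : Z p' = Z p := hz'.trans hz.symm
        have h4 := Int.mul_ediv_add_emod (p (σ 2)) c
        have h5 := Int.mul_ediv_add_emod (p' (σ 2)) c
        simp only [hZ] at h3
        linarith
      have hall : ∀ j : Fin 3, p' (σ j) = (p + (p' (σ 2) / c - p (σ 2) / c) • k) (σ j) := by
        intro j
        fin_cases j
        · simpa using f0
        · simpa using f1
        · simpa using f2
      ext j
      simpa using hall (σ.symm j)
    -- `-α` is the leading coefficient in `y` of `k_F² - |q|²`; it is bounded away from zero because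
    -- `b² ≤ c²` forces `b² ≤ κ² / 2`.
    set α := 1 - (b : ℝ) ^ 2 / κ ^ 2 with hα
    have hα2 : 1 / 2 ≤ α := by
      have : (b : ℝ) ^ 2 / κ ^ 2 ≤ 1 / 2 := by
        rw [div_le_iff₀ (by positivity)]; linarith
      linarith
    have hα0 : α ≠ 0 := by linarith
    set e := (a : ℝ) * x + c * z with he
    set y₀ := b * e / (κ ^ 2 * α) with hy₀
    set r := kF ^ 2 - ((x : ℝ) ^ 2 + z ^ 2 - e ^ 2 / κ ^ 2) + α * y₀ ^ 2 with hr
    have hquad : ∀ y : ℝ, r - α * (y - y₀) ^ 2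
        = kF ^ 2 - ((x : ℝ) ^ 2 + y ^ 2 + z ^ 2 - (e + b * y) ^ 2 / κ ^ 2) := by
      intro y
      have h1 : α * y₀ = b * e / κ ^ 2 := by rw [hy₀]; field_simp
      have h2 : r - α * (y - y₀) ^ 2
          = kF ^ 2 - ((x : ℝ) ^ 2 + z ^ 2 - e ^ 2 / κ ^ 2) - α * y ^ 2 + 2 * (α * y₀) * y := by
        rw [hr]; ring
      rw [h2, h1, hα]
      field_simp
      ring
    -- The squared distance of a line from the origin may be computed at any of its points. It is
    -- used at `p - k` for the sign of the quadratic and at `p` for the lower bound on `k · p`.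
    have hQ : ∀ (u : Mom) (w y : ℝ), (u (σ 0) : ℝ) = x + w * a → (u (σ 1) : ℝ) = y + w * b →
        (u (σ 2) : ℝ) = z + w * c →
        (x : ℝ) ^ 2 + y ^ 2 + z ^ 2 - (e + b * y) ^ 2 / κ ^ 2
          = ‖toE3 u‖ ^ 2 - inner ℝ (toE3 k) (toE3 u) ^ 2 / κ ^ 2 := by
      intro u w y h0 h1 h2
      rw [norm_sq_toE3 u σ, inner_toE3 k u σ, h0, h1, h2, ← ha, ← hb, ← hc]
      have h3 : (a : ℝ) * (x + w * a) + b * (y + w * b) + c * (z + w * c)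
          = (e + b * y) + w * κ ^ 2 := by rw [hκsq, he]; ring
      rw [h3]
      have h4 : ((e + b * y) + w * κ ^ 2) ^ 2 / κ ^ 2
          = (e + b * y) ^ 2 / κ ^ 2 + 2 * w * (e + b * y) + w ^ 2 * κ ^ 2 := by
        field_simp
        ring
      rw [h4, hκsq, he]
      ring
    set g : ℤ → ℝ := fun y => if h : ∃ p ∈ G, Y p = y then
      inner ℝ (toE3 k) (toE3 h.choose) / κ else 0 with hg
    have hgY : ∀ p ∈ G, g (Y p) = inner ℝ (toE3 k) (toE3 p) / κ := by
      intro p hp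
      have h : ∃ q ∈ G, Y q = Y p := ⟨p, hp, rfl⟩
      have h1 : h.choose = p := hinj h.choose_spec.1 hp h.choose_spec.2
      simp only [hg, dif_pos h, h1]
    have hsum : ∑ p ∈ G, 1 / inner ℝ (toE3 k) (toE3 p) = 1 / κ * ∑ y ∈ G.image Y, 1 / g y := by
      rw [Finset.sum_image hinj, Finset.mul_sum]
      refine Finset.sum_congr rfl fun p hp => ?_
      rw [hgY p hp]
      have : 0 < inner ℝ (toE3 k) (toE3 p) := hJ.trans_le (hF p (hG' p hp).1).2.2
      field_simp
    rw [hsum]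
    refine mul_le_mul_of_nonneg_left ?_ (by positivity)
    refine sum_inv_le_of_quadratic _ g r α y₀ (J / κ) (by positivity) hα2 ?_ ?_ ?_
    · intro y hy
      obtain ⟨p, hp, rfl⟩ := Finset.mem_image.mp hy
      obtain ⟨h0, h1, h2⟩ := hrep p hp
      rw [hquad, hQ (p - k) (((p (σ 2) / c : ℤ) : ℝ) - 1) (Y p)]
      · have h3 := (hF p (hG' p hp).1).2.1
        have h4 : ‖toE3 (p - k)‖ ^ 2 ≤ kF ^ 2 := by gcongr
        have h5 : 0 ≤ inner ℝ (toE3 k) (toE3 (p - k)) ^ 2 / κ ^ 2 := by positivity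
        linarith
      · simp only [Pi.sub_apply, Int.cast_sub, h0, ← ha]; ring
      · simp only [Pi.sub_apply, Int.cast_sub, h1, ← hb]; ring
      · simp only [Pi.sub_apply, Int.cast_sub]; rw [← hc]; linarith
    · intro y hy
      obtain ⟨p, hp, rfl⟩ := Finset.mem_image.mp hy
      rw [hgY p hp]
      have := (hF p (hG' p hp).1).2.2
      gcongr
    · intro y hy
      obtain ⟨p, hp, rfl⟩ := Finset.mem_image.mp hy
      obtain ⟨h0, h1, h2⟩ := hrep p hp
      rw [hgY p hp, hquad, hQ p _ (Y p) h0 h1 h2, div_pow]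
      have h3 := (hF p (hG' p hp).1).1
      have h4 : kF ^ 2 ≤ ‖toE3 p‖ ^ 2 := by gcongr
      linarith
  calc ∑ p ∈ F, 1 / inner ℝ (toE3 k) (toE3 p)
      = ∑ u ∈ B, ∑ p ∈ F with (X p, Z p) = u, 1 / inner ℝ (toE3 k) (toE3 p) :=
        (Finset.sum_fiberwise_of_maps_to hmem _).symm
    _ ≤ ∑ _u ∈ B, 1 / κ * (2 / (J / κ) + 6) := Finset.sum_le_sum hfib
    _ = B.card * (1 / κ * (2 / (J / κ) + 6)) := by rw [Finset.sum_const, nsmul_eq_mul]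
    _ ≤ 11 * kF * κ * (1 / κ * (2 / (J / κ) + 6)) := by gcongr
    _ = 11 * kF * (2 * κ / J + 6) := by field_simp

end RPA

namespace RPA

/-! ### Geometry of the patches -/

theorem one_le_numN {kF : ℝ} (h : 0 < kF) : 1 ≤ numN kF := by
  refine Finset.card_pos.mpr ⟨0, mem_fermiBall.mpr ?_⟩
  have : toE3 0 = 0 := by ext i; simp [toE3]
  rw [this]; simpa using h.le

/-- The Fermi ball contains the lattice cube of half side `⌊k_F / 2⌋`, since `3 / 4 ≤ 1`. -/
theorem half_le_numN_rpow {kF : ℝ} (h : 0 < kF) : kF / 2 ≤ (numN kF : ℝ) ^ (1 / 3 : ℝ) := by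
  classical
  set m : ℕ := ⌊kF / 2⌋₊ with hm
  have hmk : (m : ℝ) ≤ kF / 2 := Nat.floor_le (by linarith)
  have hsub : (Finset.Icc (fun _ => -(m : ℤ)) (fun _ => (m : ℤ)) : Finset Mom) ⊆ fermiBall kF := by
    intro p hp
    rw [mem_fermiBall]
    have hp' := Finset.mem_Icc.mp hp
    have h1 : ∀ i, (p i : ℝ) ^ 2 ≤ (kF / 2) ^ 2 := fun i => by
      have a1 : -(m : ℤ) ≤ p i := hp'.1 i
      have a2 : p i ≤ (m : ℤ) := hp'.2 i
      have a1' : -(m : ℝ) ≤ p i := by exact_mod_cast a1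
      have a2' : (p i : ℝ) ≤ m := by exact_mod_cast a2
      rw [sq_le_sq, abs_of_pos (by linarith : 0 < kF / 2)]
      exact abs_le.mpr ⟨by linarith, by linarith⟩
    have h2 := norm_sq_toE3 p 1
    have h3 : ‖toE3 p‖ ^ 2 ≤ kF ^ 2 := by
      rw [h2]
      have := h1 0; have := h1 1; have := h1 2
      simp only [Equiv.Perm.coe_one, id_eq]
      nlinarith
    exact le_of_sq_le_sq h3 h.le
  have hcard : (2 * m + 1) ^ 3 ≤ numN kF := by
    have h1 := Finset.card_le_card hsub
    rw [Pi.card_Icc] at h1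
    simp only [Int.card_Icc, Finset.prod_const, Finset.card_univ, Fintype.card_fin] at h1
    have h2 : ((m : ℤ) + 1 - -m).toNat = 2 * m + 1 := by omega
    rwa [h2] at h1
  have h1 : kF / 2 ≤ 2 * (m : ℝ) + 1 := by
    have := Nat.lt_floor_add_one (kF / 2)
    have : (0 : ℝ) ≤ m := by positivity
    linarith
  have h2 : (kF / 2) ^ 3 ≤ (numN kF : ℝ) := by
    have h3 : (kF / 2) ^ 3 ≤ (2 * (m : ℝ) + 1) ^ 3 := by gcongr
    exact h3.trans (by exact_mod_cast hcard)
  calc kF / 2 = ((kF / 2) ^ (3 : ℕ)) ^ (1 / 3 : ℝ) := by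
        rw [← Real.rpow_natCast, ← Real.rpow_mul (by linarith)]; norm_num
    _ ≤ _ := Real.rpow_le_rpow (by positivity) h2 (by norm_num)

theorem gammaNor_spec {R : ℝ} {k : Mom} (hk : k ∈ gammaNor R) :
    k ≠ 0 ∧ 1 ≤ ‖toE3 k‖ ∧ ‖toE3 k‖ < R := by
  classical
  unfold gammaNor at hk
  obtain ⟨-, h1, h2⟩ := Finset.mem_filter.mp hk
  have key : ∃ i, k i ≠ 0 := by
    rcases h2 with h | ⟨-, h⟩ | ⟨-, -, h⟩
    · exact ⟨2, h.ne'⟩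
    · exact ⟨1, h.ne'⟩
    · exact ⟨0, h.ne'⟩
  obtain ⟨i, hi⟩ := key
  refine ⟨fun h => hi (by simp [h]), ?_, h1⟩
  refine le_trans ?_ (abs_apply_le_norm k i)
  exact_mod_cast Int.one_le_abs hi

namespace PatchDecomposition

variable {kF R C₀ : ℝ} {n : ℕ} (P : PatchDecomposition kF R C₀ n)

theorem norm_center (α : Fin n × Bool) : ‖P.center α‖ = 1 := by
  simpa using P.cap_subset α (P.center_mem α)

theorem smul_center_mem_patch (α : Fin n × Bool) {r : ℝ} (hr : 0 < r) (h1 : kF - R ≤ r)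
    (h2 : r ≤ kF + R) : r • P.center α ∈ P.patch α := by
  have h3 : ‖r • P.center α‖ = r := by
    rw [norm_smul, P.norm_center, mul_one, Real.norm_of_nonneg hr.le]
  refine ⟨by rwa [h3], by rwa [h3], ?_⟩
  rw [h3, smul_smul, inv_mul_cancel₀ hr.ne', one_smul]
  exact P.center_mem α

/-- If `k_F ≤ R`, the shells reach down to the origin, and the points at radius `R / 4` in two
opposite patches are at distance at most `R / 2`, violating the corridor. -/
theorem R_lt_kF (P : PatchDecomposition kF R C₀ n) (hn : 0 < n) (hkF : 0 < kF) (hR : 0 < R) : R < kF := by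
  by_contra hcon
  push Not at hcon
  have hr : 0 < R / 4 := by linarith
  have h := P.corridor (⟨0, hn⟩, true) (⟨0, hn⟩, false) (by simp) _
    (P.smul_center_mem_patch _ hr (by linarith) (by linarith)) _
    (P.smul_center_mem_patch _ hr (by linarith) (by linarith))
  rw [dist_eq_norm] at h
  have h1 := norm_sub_le ((R / 4) • P.center (⟨0, hn⟩, true)) ((R / 4) • P.center (⟨0, hn⟩, false))
  rw [norm_smul, norm_smul, P.norm_center, P.norm_center, Real.norm_of_nonneg hr.le] at h1
  linarith

theorem eq_of_mem_patch (hR : 0 < R) {α β : Fin n × Bool} {p : E3} (h1 : p ∈ P.patch α)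
    (h2 : p ∈ P.patch β) : α = β := by
  by_contra h
  have := P.corridor α β h p h1 p h2
  rw [dist_self] at this
  linarith

open MeasureTheory in
/-- The number of patches is bounded by comparing volumes. -/
theorem card_mul_sq_le (P : PatchDecomposition kF R C₀ n) (hR : 0 < R) (hRk : R < kF) : (2 * n : ℝ) * R ^ 2 ≤ 32 * kF ^ 2 := by
  set μ : Measure E3 := volume
  set B : Fin n × Bool → Set E3 := fun α => Metric.ball (kF • P.center α) (R / 2) with hB
  have hkF : 0 < kF := hR.trans hRk
  have hfin : Module.finrank ℝ E3 = 3 := by simp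
  -- The corridors make the balls of radius `R / 2` about the centers on the Fermi sphere disjoint.
  -- They fit between the radii `k_F - R/2` and `k_F + R/2`, which yields `M R³ / 8 ≤ 3 k_F² R + R³
  -- / 4`.
  have hdisj : Pairwise (Function.onFun Disjoint B) := by
    intro α β hαβ
    refine Metric.ball_disjoint_ball ?_
    have := P.corridor α β hαβ _ (P.smul_center_mem_patch α hkF (by linarith) (by linarith)) _
      (P.smul_center_mem_patch β hkF (by linarith) (by linarith))
    linarith
  have hnorm : ∀ α, ‖kF • P.center α‖ = kF := fun α => by
    rw [norm_smul, P.norm_center, mul_one, Real.norm_of_nonneg hkF.le]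
  have hsub : (⋃ α, B α) ∪ Metric.closedBall 0 (kF - R / 2) ⊆ Metric.ball 0 (kF + R / 2) := by
    refine Set.union_subset (Set.iUnion_subset fun α => ?_) ?_
    · refine Metric.ball_subset_ball' ?_
      rw [dist_zero_right, hnorm]; linarith
    · exact Metric.closedBall_subset_ball (by linarith)
  have hdisj2 : Disjoint (⋃ α, B α) (Metric.closedBall (0 : E3) (kF - R / 2)) := by
    rw [Set.disjoint_iUnion_left]
    intro α
    refine (Metric.closedBall_disjoint_ball ?_).symm
    rw [dist_zero_left, hnorm]; linarith
  have h1 : μ.real ((⋃ α, B α) ∪ Metric.closedBall 0 (kF - R / 2))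
      ≤ μ.real (Metric.ball 0 (kF + R / 2)) :=
    measureReal_mono hsub (by exact measure_ball_lt_top.ne)
  have hBfin : ∀ α, μ (B α) ≠ ⊤ := fun α => measure_ball_lt_top.ne
  rw [measureReal_union hdisj2 Metric.isClosed_closedBall.measurableSet
    (by
      refine ((measure_iUnion_le B).trans_lt ?_).ne
      rw [tsum_fintype]
      exact ENNReal.sum_lt_top.mpr fun α _ => (hBfin α).lt_top)
    (by exact measure_closedBall_lt_top.ne)] at h1
  have h2 : μ.real (⋃ α, B α) = ∑ α, μ.real (B α) := by
    rw [measureReal_def, measure_iUnion hdisj (fun α => Metric.isOpen_ball.measurableSet),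
      tsum_fintype, ENNReal.toReal_sum fun α _ => hBfin α]
    rfl
  have hball : ∀ (x : E3) {r : ℝ}, 0 ≤ r →
      μ.real (Metric.ball x r) = r ^ 3 * μ.real (Metric.ball 0 1) := by
    intro x r hr
    rw [measureReal_def, Measure.addHaar_ball μ x hr, hfin, ENNReal.toReal_mul,
      ENNReal.toReal_ofReal (by positivity)]
    rfl
  have hcball : ∀ (x : E3) {r : ℝ}, 0 ≤ r →
      μ.real (Metric.closedBall x r) = r ^ 3 * μ.real (Metric.ball 0 1) := by
    intro x r hr
    rw [measureReal_def, Measure.addHaar_closedBall μ x hr, hfin, ENNReal.toReal_mul,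
      ENNReal.toReal_ofReal (by positivity)]
    rfl
  have hpos : 0 < μ.real (Metric.ball (0 : E3) 1) :=
    ENNReal.toReal_pos (Metric.measure_ball_pos μ _ one_pos).ne' measure_ball_lt_top.ne
  rw [h2, hcball _ (by linarith), hball 0 (by linarith : 0 ≤ kF + R / 2),
    Finset.sum_congr rfl fun α _ => hball (kF • P.center α) (by linarith : 0 ≤ R / 2),
    Finset.sum_const, nsmul_eq_mul, Finset.card_univ, Fintype.card_prod, Fintype.card_fin,
    Fintype.card_bool, ← mul_assoc, ← add_mul] at h1
  have h3 := le_of_mul_le_mul_right h1 hpos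
  push_cast at h3
  have h4 : (2 * n : ℝ) * R ^ 3 ≤ 32 * kF ^ 2 * R := by
    have e1 : R ^ 2 ≤ kF ^ 2 := by gcongr
    have e2 := mul_le_mul_of_nonneg_right e1 hR.le
    have e3 : 0 ≤ kF ^ 2 * R := by positivity
    nlinarith
  have h5 : (2 * n : ℝ) * R ^ 3 = (2 * n : ℝ) * R ^ 2 * R := by ring
  rw [h5] at h4
  exact le_of_mul_le_mul_right h4 hR

/-- The smallness conditions on the patches, with `ε` measuring the size of a patch in comparison
with the cutoff `N^{-δ}`. -/
structure Fine (P : PatchDecomposition kF R C₀ n) (δ ε : ℝ) : Prop where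
  R_pos : 0 < R
  R_lt : R < kF
  diam : C₀ * (2 * n : ℝ) ^ (-(1 / 2) : ℝ) * R ≤ ε * (numN kF : ℝ) ^ (-δ)
  sq : R ^ 2 ≤ ε * kF * (numN kF : ℝ) ^ (-δ)

/-- The summand `C₀²` of the constant gives the diameter condition. The summand `32` gives the other
one: multiplied by `R²` and combined with the packing bound `M R² ≤ 32 k_F²`, the assumption becomes
`N^{2δ} R⁴ ≤ ε² k_F²`. -/
theorem fine_of_le {δ ε : ℝ} (hε : 0 < ε) (hkF : 0 < kF) (hR : 0 < R)
    (h : (C₀ ^ 2 + 32) / ε ^ 2 * ((numN kF : ℝ) ^ (2 * δ) * R ^ 2) ≤ 2 * n) :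
    P.Fine δ ε := by
  have hN : (0 : ℝ) < numN kF := by exact_mod_cast one_le_numN hkF
  set x := (numN kF : ℝ) ^ δ with hx
  have hx0 : 0 < x := Real.rpow_pos_of_pos hN δ
  have hx2 : (numN kF : ℝ) ^ (2 * δ) = x ^ 2 := by
    rw [hx, ← Real.rpow_natCast, ← Real.rpow_mul hN.le]; congr 1; push_cast; ring
  have hxn : (numN kF : ℝ) ^ (-δ) = x⁻¹ := Real.rpow_neg hN.le δ
  rw [hx2] at h
  have hn' : (0 : ℝ) < 2 * n := lt_of_lt_of_le (by positivity) h
  have hn : 0 < n := by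
    have : (0 : ℝ) < n := by linarith
    exact_mod_cast this
  have hRk := P.R_lt_kF hn hkF hR
  have hpack := P.card_mul_sq_le hR hRk
  have hM : (2 * n : ℝ) ^ (-(1 / 2) : ℝ) = (√(2 * n : ℝ))⁻¹ := by
    rw [Real.rpow_neg hn'.le, Real.sqrt_eq_rpow]
  have hs : 0 < √(2 * n : ℝ) := Real.sqrt_pos.mpr hn'
  have hs2 : √(2 * n : ℝ) ^ 2 = 2 * n := Real.sq_sqrt hn'.le
  have h' : (C₀ ^ 2 + 32) * (x ^ 2 * R ^ 2) ≤ ε ^ 2 * (2 * n) := by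
    rw [div_mul_eq_mul_div, div_le_iff₀ (by positivity)] at h
    linarith
  refine ⟨hR, hRk, ?_, ?_⟩
  · rw [hM, hxn]
    have h1 : (C₀ * R * x) ^ 2 ≤ (ε * √(2 * n : ℝ)) ^ 2 := by
      rw [mul_pow ε, hs2]
      nlinarith [sq_nonneg (x * R)]
    have h2 := abs_le_of_sq_le_sq h1 (by positivity)
    have h3 := (le_abs_self _).trans h2
    rw [← div_eq_mul_inv, ← div_eq_mul_inv, div_mul_eq_mul_div, div_le_div_iff₀ hs hx0]
    linarith
  · rw [hxn, ← div_eq_mul_inv, le_div_iff₀ hx0]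
    have h1 : (R ^ 2 * x) ^ 2 ≤ (ε * kF) ^ 2 := by
      have e1 : 32 * (x ^ 2 * R ^ 2) ≤ ε ^ 2 * (2 * n) :=
        le_trans (by nlinarith [sq_nonneg (C₀ * (x * R))]) h'
      have e2 := mul_le_mul_of_nonneg_right e1 (sq_nonneg R)
      have e3 := mul_le_mul_of_nonneg_left hpack (sq_nonneg ε)
      nlinarith
    exact (le_abs_self _).trans (abs_le_of_sq_le_sq h1 (by positivity))

variable {P}

/-- The direction of `x` differs from the center by at most the diameter of the cap, and `|k| < R`.
This allows `k · p` to be replaced by `|p| (k · ω̂_α)` for momenta in a patch. -/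
theorem abs_inner_sub_le {δ ε : ℝ} (hP : P.Fine δ ε) {α : Fin n × Bool} {k : Mom}
    (hkR : ‖toE3 k‖ < R) {x : E3} (hx : x ≠ 0)
    (hxα : x ∈ P.patch α) :
    |inner ℝ (toE3 k) x - ‖x‖ * inner ℝ (toE3 k) (P.center α)|
      ≤ ‖x‖ * (ε * (numN kF : ℝ) ^ (-δ)) := by
  have hx0 : 0 < ‖x‖ := norm_pos_iff.mpr hx
  have h1 : inner ℝ (toE3 k) x - ‖x‖ * inner ℝ (toE3 k) (P.center α)
      = ‖x‖ * inner ℝ (toE3 k) (‖x‖⁻¹ • x - P.center α) := by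
    rw [inner_sub_right, inner_smul_right, mul_sub, ← mul_assoc, mul_inv_cancel₀ hx0.ne', one_mul]
  rw [h1, abs_mul, abs_of_pos hx0]
  refine mul_le_mul_of_nonneg_left ?_ hx0.le
  refine (abs_real_inner_le_norm _ _).trans (le_trans ?_ hP.diam)
  have h2 := P.diam_le α _ hxα.2.2 _ (P.center_mem α)
  rw [dist_eq_norm] at h2
  calc ‖toE3 k‖ * ‖‖x‖⁻¹ • x - P.center α‖
      ≤ R * (C₀ * (2 * n : ℝ) ^ (-(1 / 2) : ℝ)) :=
        mul_le_mul hkR.le h2 (norm_nonneg _) hP.R_pos.le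
    _ = _ := by ring

/-- For the pairs of a patch, `1 / (k · ω̂_α)` is at most `4 k_F / (k · p)`. By disjointness of the
patches the whole sum is then one sum over exiting lattice points with `k · p ≥ k_F N^{-δ} / 2`, to
which `sum_exit_le` applies. -/
theorem Fine.sum_card_pairs_le {δ ε : ℝ} (hP : P.Fine δ ε) (hε : 0 < ε) (hε2 : ε ≤ 1 / 2) {k : Mom}
    (hk0 : k ≠ 0) (hk1 : 1 ≤ ‖toE3 k‖) (hkR : ‖toE3 k‖ < R) :
    ∑ α : P.IPlus δ k, ((P.pairs α.1 k).card : ℝ) / inner ℝ (toE3 k) (P.center α.1)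
      ≤ 352 * kF ^ 2 := by
  classical
  have hR := hP.R_pos
  have hRk := hP.R_lt
  have hkF : 0 < kF := hR.trans hRk
  have hN : (0 : ℝ) < numN kF := by exact_mod_cast one_le_numN hkF
  set x := (numN kF : ℝ) ^ (-δ) with hx
  have hx0 : 0 < x := Real.rpow_pos_of_pos hN _
  have hpair : ∀ α : P.IPlus δ k, ∀ p ∈ P.pairs α.1 k, kF < ‖toE3 p‖ ∧ ‖toE3 (p - k)‖ ≤ kF ∧
      kF * x / 2 ≤ inner ℝ (toE3 k) (toE3 p) ∧
      1 / inner ℝ (toE3 k) (P.center α.1) ≤ 4 * kF * (1 / inner ℝ (toE3 k) (toE3 p)) := by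
    intro α p hp
    obtain ⟨h1, h2, h3, h4⟩ := (P.mem_pairs _ _ _).mp hp
    rw [mem_fermiBall] at h1 h3
    push Not at h1
    have hp0 : toE3 p ≠ 0 := by
      intro h; rw [h, norm_zero] at h1; linarith
    have hα : x ≤ inner ℝ (toE3 k) (P.center α.1) := α.2
    set w := inner ℝ (toE3 k) (P.center α.1)
    have h5 := abs_le.mp (abs_inner_sub_le hP hkR hp0 h2)
    have h6 : ‖toE3 p‖ ≤ 2 * kF := by
      have : toE3 p = toE3 (p - k) + toE3 k := by rw [← toE3_add, sub_add_cancel]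
      rw [this]
      linarith [norm_add_le (toE3 (p - k)) (toE3 k)]
    have h7 : ‖toE3 p‖ * (ε * x) ≤ ‖toE3 p‖ * (w / 2) := by
      refine mul_le_mul_of_nonneg_left ?_ (norm_nonneg _)
      have := mul_le_mul hε2 hα hx0.le (by norm_num)
      linarith
    have h8 : kF * x ≤ ‖toE3 p‖ * w := mul_le_mul h1.le hα hx0.le (norm_nonneg _)
    have h9 : kF * x / 2 ≤ inner ℝ (toE3 k) (toE3 p) := by linarith [h5.1]
    refine ⟨h1, h3, h9, ?_⟩
    have hw : 0 < w := hx0.trans_le hα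
    have hi : 0 < inner ℝ (toE3 k) (toE3 p) := lt_of_lt_of_le (by positivity) h9
    rw [mul_one_div, div_le_div_iff₀ hw hi, one_mul]
    have := mul_le_mul_of_nonneg_right h6 hw.le
    linarith [h5.2]
  have hdisj : Set.PairwiseDisjoint ((Finset.univ : Finset (P.IPlus δ k)) : Set (P.IPlus δ k))
      (fun α : P.IPlus δ k => P.pairs α.1 k) := by
    intro α _ β _ hαβ
    refine Finset.disjoint_left.mpr fun p hp hp' => hαβ (Subtype.ext ?_)
    exact P.eq_of_mem_patch hR ((P.mem_pairs _ _ _).mp hp).2.1 ((P.mem_pairs _ _ _).mp hp').2.1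
  have hF := sum_exit_le (kF := kF) (J := kF * x / 2) hk0 hk1 (by linarith) (by positivity)
    (Finset.univ.biUnion fun α : P.IPlus δ k => P.pairs α.1 k) (by
      intro p hp
      obtain ⟨α, -, hp⟩ := Finset.mem_biUnion.mp hp
      obtain ⟨h1, h2, h3, -⟩ := hpair α p hp
      exact ⟨h1, h2, h3⟩)
  rw [Finset.sum_biUnion hdisj] at hF
  -- The cutoff term stays bounded because `|k| ≤ R² ≤ ε k_F N^{-δ}`; here `1 ≤ |k| < R` is used.
  have hbd : 2 * ‖toE3 k‖ / (kF * x / 2) ≤ 2 := by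
    rw [div_le_iff₀ (by positivity)]
    have h1 := hP.sq
    have h2 : ‖toE3 k‖ ≤ R ^ 2 := by nlinarith
    have h3 : ε * kF * x ≤ 1 / 2 * kF * x := by gcongr
    linarith
  calc ∑ α : P.IPlus δ k, ((P.pairs α.1 k).card : ℝ) / inner ℝ (toE3 k) (P.center α.1)
      ≤ ∑ α : P.IPlus δ k, ∑ p ∈ P.pairs α.1 k, 4 * kF * (1 / inner ℝ (toE3 k) (toE3 p)) := by
        refine Finset.sum_le_sum fun α _ => ?_
        rw [div_eq_mul_one_div, ← nsmul_eq_mul, ← Finset.sum_const]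
        exact Finset.sum_le_sum fun p hp => (hpair α p hp).2.2.2
    _ = 4 * kF * ∑ α : P.IPlus δ k, ∑ p ∈ P.pairs α.1 k, 1 / inner ℝ (toE3 k) (toE3 p) := by
        simp only [Finset.mul_sum]
    _ ≤ 4 * kF * (11 * kF * (2 * ‖toE3 k‖ / (kF * x / 2) + 6)) := by gcongr
    _ ≤ 4 * kF * (11 * kF * (2 + 6)) := by gcongr
    _ = 352 * kF ^ 2 := by ring

/-- If both momenta were close to the Fermi sphere, then `|p|² - |p - k|² ≤ 4 θ |p| N^{-δ}`. But
this difference is `2 k · p - |k|²`, which exceeds `(2 - 3ε) |p| N^{-δ}`, and `4 θ ≤ 2 - 4 ε`. -/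
theorem Fine.gap {δ ε θ : ℝ} (hP : P.Fine δ ε) (hε : 0 < ε) (hεθ : 2 * ε ≤ 1 - 2 * θ)
    {α : Fin n × Bool} {k : Mom} (hkR : ‖toE3 k‖ < R)
    (hα : (numN kF : ℝ) ^ (-δ) ≤ inner ℝ (toE3 k) (P.center α)) {p : Mom}
    (hp : p ∈ P.pairs α k) :
    p ∈ gapSet kF (θ * (numN kF : ℝ) ^ (-δ)) ∨ p - k ∈ gapSet kF (θ * (numN kF : ℝ) ^ (-δ)) := by
  have hR := hP.R_pos
  have hRk := hP.R_lt
  have hkF : 0 < kF := hR.trans hRk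
  have hN : (0 : ℝ) < numN kF := by exact_mod_cast one_le_numN hkF
  set x := (numN kF : ℝ) ^ (-δ) with hx
  have hx0 : 0 < x := Real.rpow_pos_of_pos hN _
  by_contra hcon
  rw [not_or] at hcon
  simp only [gapSet, Set.mem_ofPred_eq, not_lt] at hcon
  obtain ⟨hc1, hc2⟩ := hcon
  obtain ⟨h1, h2, h3, h4⟩ := (P.mem_pairs _ _ _).mp hp
  rw [mem_fermiBall] at h1 h3
  push Not at h1
  have hp0 : toE3 p ≠ 0 := by
    intro h; rw [h, norm_zero] at h1; linarith
  have h5 := abs_le.mp (abs_inner_sub_le hP hkR hp0 h2)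
  set w := inner ℝ (toE3 k) (P.center α)
  have h6 : ‖toE3 (p - k)‖ ^ 2
      = ‖toE3 p‖ ^ 2 - 2 * inner ℝ (toE3 k) (toE3 p) + ‖toE3 k‖ ^ 2 := by
    rw [toE3_sub, norm_sub_sq_real, real_inner_comm]
  set a := ‖toE3 p‖
  set b := ‖toE3 (p - k)‖
  have hab : a - b ≤ 2 * (θ * x) := by
    have e1 := (abs_le.mp hc1).2
    have e2 := (abs_le.mp hc2).1
    linarith
  have hb0 : 0 ≤ b := norm_nonneg _
  have hk2 : ‖toE3 k‖ ^ 2 < ε * a * x := by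
    have e1 : ‖toE3 k‖ ^ 2 < R ^ 2 := by
      have := norm_nonneg (toE3 k)
      nlinarith
    have e2 : ε * kF * x ≤ ε * a * x := by gcongr
    linarith [hP.sq]
  have e3 : a * x ≤ a * w := mul_le_mul_of_nonneg_left hα (norm_nonneg _)
  have e4 : (a - b) * (a + b) = 2 * inner ℝ (toE3 k) (toE3 p) - ‖toE3 k‖ ^ 2 := by
    linarith [h6, (by ring : (a - b) * (a + b) = a ^ 2 - b ^ 2)]
  have e5 : (a - b) * (a + b) ≤ (a - b) * (2 * a) :=
    mul_le_mul_of_nonneg_left (by linarith) (by linarith)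
  have e6 : (a - b) * (2 * a) ≤ 2 * (θ * x) * (2 * a) :=
    mul_le_mul_of_nonneg_right hab (by linarith)
  have hax : 0 < a * x := mul_pos (hkF.trans h1) hx0
  nlinarith [mul_le_mul_of_nonneg_right hεθ hax.le]

/-! ### The labels of the indices in `𝓘_k` -/

variable (P)

theorem le_inner_label (δ : ℝ) (k : Mom) (j : P.I δ k) :
    (numN kF : ℝ) ^ (-δ) ≤ inner ℝ (toE3 (P.signedMom δ k j)) (P.center (P.label δ k j)) := by
  rcases j with α | α
  · exact α.2
  · have h : P.center (α.1.1, !α.1.2) = -P.center α.1 := by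
      rcases α with ⟨⟨i, s⟩, hα⟩
      cases s
      · simp only [Bool.not_false]; rw [P.center_mirror, neg_neg]
      · simp only [Bool.not_true]; rw [P.center_mirror]
    simp only [label, signedMom, h, toE3_neg, inner_neg_neg]
    exact α.2

/-- `k · ω̂` cannot be both at least `N^{-δ}` and at most `-N^{-δ}`, so the two halves of the index
set label different patches. -/
theorem label_injective (hkF : 0 < kF) (δ : ℝ) (k : Mom) :
    Function.Injective (P.label δ k) := by
  have hN : (0 : ℝ) < numN kF := by exact_mod_cast one_le_numN hkF
  have hx0 : 0 < (numN kF : ℝ) ^ (-δ) := Real.rpow_pos_of_pos hN _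
  intro i j hij
  have hi := P.le_inner_label δ k i
  have hj := P.le_inner_label δ k j
  rw [hij] at hi
  rcases i with α | α <;> rcases j with β | β
  · exact congrArg _ (Subtype.ext hij)
  · simp only [signedMom, toE3_neg, inner_neg_left] at hi hj
    linarith
  · simp only [signedMom, toE3_neg, inner_neg_left] at hi hj
    linarith
  · refine congrArg _ (Subtype.ext ?_)
    simp only [label, Prod.mk.injEq] at hij
    exact Prod.ext hij.1 (by simpa using hij.2)

theorem norm_signedMom (δ : ℝ) (k : Mom) (j : P.I δ k) :
    ‖toE3 (P.signedMom δ k j)‖ = ‖toE3 k‖ := by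
  rcases j with α | α
  · rfl
  · simp only [signedMom, toE3_neg, norm_neg]

variable {P}

/-- The number of pairs contained in a set of momenta is at most the number of gapped momenta. -/
theorem Fine.sum_card_filter_le {δ ε θ : ℝ} (hP : P.Fine δ ε) (hε : 0 < ε)
    (hεθ : 2 * ε ≤ 1 - 2 * θ) {k : Mom} (hkR : ‖toE3 k‖ < R) (S : Finset Mom) :
    ∑ j : P.I δ k, ((P.pairs (P.label δ k j) (P.signedMom δ k j)).filter
      (fun p => p ∈ S ∧ p - P.signedMom δ k j ∈ S)).card ≤ nGap kF δ θ S := by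
  classical
  have hR := hP.R_pos
  rw [← Finset.card_sigma]
  unfold nGap cnt
  set G := gapSet kF (θ * (numN kF : ℝ) ^ (-δ)) with hG
  -- A pair is sent to one of its gapped members. The image determines the patch, hence the index,
  -- and its position inside or outside the Fermi ball tells whether it is `p` or `p - k`.
  refine Finset.card_le_card_of_injOn
    (fun x => if x.2 ∈ G then x.2 else x.2 - P.signedMom δ k x.1) ?_ ?_
  · rintro ⟨j, p⟩ hx
    have hx' := Finset.mem_sigma.mp (Finset.mem_coe.mp hx)
    obtain ⟨hp, hp1, hp2⟩ := Finset.mem_filter.mp hx'.2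
    simp only [Finset.coe_filter, Set.mem_ofPred_eq]
    have hgap := hP.gap hε hεθ (by rwa [P.norm_signedMom]) (P.le_inner_label δ k j) hp
    by_cases h : p ∈ G
    · simp only [h, if_true]; exact ⟨hp1, trivial⟩
    · simp only [h, if_false]
      exact ⟨hp2, hgap.resolve_left h⟩
  · rintro ⟨i, p⟩ hx ⟨j, q⟩ hy hxy
    have hx' := Finset.mem_sigma.mp (Finset.mem_coe.mp hx)
    have hy' := Finset.mem_sigma.mp (Finset.mem_coe.mp hy)
    obtain ⟨hp, -, -⟩ := Finset.mem_filter.mp hx'.2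
    obtain ⟨hq, -, -⟩ := Finset.mem_filter.mp hy'.2
    obtain ⟨p1, p2, p3, p4⟩ := (P.mem_pairs _ _ _).mp hp
    obtain ⟨q1, q2, q3, q4⟩ := (P.mem_pairs _ _ _).mp hq
    simp only at hxy
    have hij : i = j := by
      refine P.label_injective (hR.trans hP.R_lt) δ k ?_
      refine P.eq_of_mem_patch hR
        (p := toE3 (if p ∈ G then p else p - P.signedMom δ k i)) ?_ ?_
      · split_ifs <;> assumption
      · rw [hxy]; split_ifs <;> assumption
    subst hij
    have : p = q := by
      split_ifs at hxy with h1 h2 h2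
      · exact hxy
      · exact absurd (hxy ▸ q3) p1
      · exact absurd (hxy ▸ p3) q1
      · exact sub_left_injective hxy
    rw [this]

end PatchDecomposition

end RPA

namespace RPA

/-! ### Square roots, polar factors and Hilbert-Schmidt norms of real matrices -/

section Matrices

set_option linter.unusedSectionVars false

variable {ι : Type} [Fintype ι] [DecidableEq ι]

open Matrix

theorem posSemidef_transpose_mul_self (A : Matrix ι ι ℝ) : (Aᵀ * A).PosSemidef := by
  simpa using posSemidef_conjTranspose_mul_self A

theorem PosSemidef.transpose_eq {A : Matrix ι ι ℝ} (hA : A.PosSemidef) : Aᵀ = A := by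
  simpa [Matrix.IsHermitian] using hA.1

theorem PosSemidef.conj {A : Matrix ι ι ℝ} (hA : A.PosSemidef) (B : Matrix ι ι ℝ) :
    (B * A * Bᵀ).PosSemidef := by
  simpa using hA.mul_mul_conjTranspose_same B

theorem cfc_transpose (f : ℝ → ℝ) (A : Matrix ι ι ℝ) : (cfc f A)ᵀ = cfc f A := by
  have h : IsSelfAdjoint (cfc f A) := cfc_predicate f A
  simpa [IsSelfAdjoint, star_eq_conjTranspose] using h

theorem continuousOn_spectrum (f : ℝ → ℝ) (A : Matrix ι ι ℝ) :
    ContinuousOn f (spectrum ℝ A) := A.finite_real_spectrum.continuousOn f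

theorem cfc_posSemidef {f : ℝ → ℝ} {A : Matrix ι ι ℝ}
    (hf : ∀ x ∈ spectrum ℝ A, 0 ≤ f x) : (cfc f A).PosSemidef := by
  have h1 : cfc f A = cfc (fun x => √(f x)) A * cfc (fun x => √(f x)) A := by
    rw [← cfc_mul _ _ A (continuousOn_spectrum _ _) (continuousOn_spectrum _ _)]
    exact cfc_congr fun x hx => (Real.mul_self_sqrt (hf x hx)).symm
  rw [h1]
  nth_rewrite 1 [← cfc_transpose]
  exact posSemidef_transpose_mul_self _

theorem spectrum_nonneg {A : Matrix ι ι ℝ} (hA : A.PosSemidef) {x : ℝ} (hx : x ∈ spectrum ℝ A) :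
    0 ≤ x := by
  rw [hA.1.spectrum_real_eq_range_eigenvalues] at hx
  obtain ⟨i, rfl⟩ := hx
  exact hA.eigenvalues_nonneg i

theorem spectrum_pos {A : Matrix ι ι ℝ} (hA : A.PosDef) {x : ℝ} (hx : x ∈ spectrum ℝ A) :
    0 < x := by
  rw [hA.1.spectrum_real_eq_range_eigenvalues] at hx
  obtain ⟨i, rfl⟩ := hx
  exact hA.eigenvalues_pos i

theorem msqrt_posSemidef (A : Matrix ι ι ℝ) : (msqrt A).PosSemidef :=
  cfc_posSemidef fun x _ => Real.sqrt_nonneg x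

theorem msqrt_transpose (A : Matrix ι ι ℝ) : (msqrt A)ᵀ = msqrt A := cfc_transpose _ _

theorem msqrt_mul_self {A : Matrix ι ι ℝ} (hA : A.PosSemidef) : msqrt A * msqrt A = A := by
  rw [msqrt, ← cfc_mul _ _ A (continuousOn_spectrum _ _) (continuousOn_spectrum _ _)]
  rw [cfc_congr (g := fun x => x) fun x hx => Real.mul_self_sqrt (spectrum_nonneg hA hx)]
  exact cfc_id' ℝ A hA.1.isSelfAdjoint

theorem msqrt_mul_self_eq {B : Matrix ι ι ℝ} (hB : B.PosSemidef) : msqrt (B * B) = B := by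
  rw [← pow_two, msqrt, ← cfc_comp_pow Real.sqrt 2 B
    (Real.continuous_sqrt.continuousOn) hB.1.isSelfAdjoint]
  rw [cfc_congr (g := fun x => x) fun x hx => Real.sqrt_sq (spectrum_nonneg hB hx)]
  exact cfc_id' ℝ B hB.1.isSelfAdjoint

theorem PosSemidef.posDef {A : Matrix ι ι ℝ} (hA : A.PosSemidef) (h : IsUnit A) : A.PosDef :=
  hA.posDef_iff_isUnit.mpr h

theorem msqrt_posDef {A : Matrix ι ι ℝ} (hA : A.PosDef) : (msqrt A).PosDef := by
  refine PosSemidef.posDef (msqrt_posSemidef A) ?_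
  have h := hA.isUnit
  rw [← msqrt_mul_self hA.posSemidef] at h
  exact isUnit_of_mul_isUnit_left h

/-- Squaring reflects the order of positive matrices. -/
theorem posSemidef_sub_of_sq {E Q : Matrix ι ι ℝ} (hE : E.PosSemidef) (hQ : Q.PosDef)
    (h : (E * E - Q * Q).PosSemidef) : (E - Q).PosSemidef := by
  have hM : (E - Q).IsHermitian := hE.1.sub hQ.1
  rw [hM.posSemidef_iff_eigenvalues_nonneg]
  intro i
  -- For an eigenvector `v` of `E - Q` with eigenvalue `l`, `⟨v, (E² - Q²) v⟩ = l (⟨v, Q v⟩ + ⟨v, E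
  -- v⟩)`, and the bracket is positive.
  set v : ι → ℝ := ⇑(hM.eigenvectorBasis i) with hv
  set l := hM.eigenvalues i with hl
  have h1 : (E - Q) *ᵥ v = l • v := hM.mulVec_eigenvectorBasis i
  have hv0 : v ≠ 0 := by
    intro h0
    have := hM.eigenvectorBasis.toBasis.ne_zero i
    apply this
    ext j
    exact congrFun h0 j
  have h2 : E *ᵥ v = Q *ᵥ v + l • v := by rw [← h1, sub_mulVec]; abel
  have hQt := PosSemidef.transpose_eq hQ.posSemidef
  have hEt := PosSemidef.transpose_eq hE
  have h3 := h.dotProduct_mulVec_nonneg v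
  have h4 := hE.dotProduct_mulVec_nonneg v
  have h5 := hQ.dotProduct_mulVec_pos hv0
  simp only [star_trivial] at h3 h4 h5
  have h6 : v ⬝ᵥ ((E * E - Q * Q) *ᵥ v) = l * (v ⬝ᵥ (Q *ᵥ v) + v ⬝ᵥ (E *ᵥ v)) := by
    have e1 : v ⬝ᵥ (E *ᵥ (Q *ᵥ v)) = (E *ᵥ v) ⬝ᵥ (Q *ᵥ v) := by
      rw [dotProduct_mulVec, ← mulVec_transpose, hEt]
    have e2 : v ⬝ᵥ (Q *ᵥ (Q *ᵥ v)) = (Q *ᵥ v) ⬝ᵥ (Q *ᵥ v) := by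
      rw [dotProduct_mulVec, ← mulVec_transpose, hQt]
    rw [sub_mulVec, ← mulVec_mulVec, ← mulVec_mulVec, dotProduct_sub]
    nth_rewrite 1 [h2]
    rw [mulVec_add, dotProduct_add, e1, e2, mulVec_smul, dotProduct_smul, h2, add_dotProduct,
      smul_dotProduct]
    simp only [smul_eq_mul]
    ring
  rw [h6] at h3
  have h7 : 0 < v ⬝ᵥ (Q *ᵥ v) + v ⬝ᵥ (E *ᵥ v) := by linarith
  exact nonneg_of_mul_nonneg_left h3 h7

/-- The square of the Hilbert-Schmidt norm. -/
def hs {ι κ : Type} [Fintype ι] [Fintype κ] (A : Matrix ι κ ℝ) : ℝ := ∑ i, ∑ j, A i j ^ 2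

theorem hs_nonneg (A : Matrix ι ι ℝ) : 0 ≤ hs A :=
  Finset.sum_nonneg fun _ _ => Finset.sum_nonneg fun _ _ => sq_nonneg _

theorem hs_eq_trace (A : Matrix ι ι ℝ) : hs A = (Aᵀ * A).trace := by
  simp only [hs, Matrix.trace, diag_apply, mul_apply, transpose_apply]
  rw [Finset.sum_comm]
  simp only [pow_two]

theorem hs_transpose (A : Matrix ι ι ℝ) : hs Aᵀ = hs A := by
  simp only [hs, transpose_apply]
  exact Finset.sum_comm

theorem hs_add_le (A B : Matrix ι ι ℝ) : hs (A + B) ≤ 2 * hs A + 2 * hs B := by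
  simp only [hs, Finset.mul_sum, ← Finset.sum_add_distrib, Matrix.add_apply]
  gcongr with i _ j _
  nlinarith [sq_nonneg (A i j - B i j)]

theorem hs_neg (A : Matrix ι ι ℝ) : hs (-A) = hs A := by simp [hs]

theorem hs_mul_orthogonal (A : Matrix ι ι ℝ) {O : Matrix ι ι ℝ} (hO : Oᵀ * O = 1) :
    hs (A * Oᵀ) = hs A := by
  rw [← hs_transpose, hs_eq_trace, ← hs_transpose A, hs_eq_trace]
  simp only [transpose_transpose, transpose_mul]
  rw [mul_assoc, ← mul_assoc Oᵀ, hO, one_mul]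

/-- The Hilbert-Schmidt norm of a positive matrix is bounded by its trace. -/
theorem hs_le_trace_sq {X : Matrix ι ι ℝ} (hX : X.PosSemidef) : hs X ≤ X.trace ^ 2 := by
  set Y := msqrt X with hY
  have h1 : ∀ i j, X i j = ∑ l, Y i l * Y j l := fun i j => by
    conv_lhs => rw [← msqrt_mul_self hX, mul_apply]
    refine Finset.sum_congr rfl fun l _ => ?_
    have : Y l j = Y j l := by conv_lhs => rw [hY, ← msqrt_transpose, transpose_apply]
    rw [← this]
  have h2 : ∀ i j, X i j ^ 2 ≤ X i i * X j j := fun i j => by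
    rw [h1 i j, h1 i i, h1 j j]
    simpa only [pow_two] using Finset.sum_mul_sq_le_sq_mul_sq Finset.univ (Y i) (Y j)
  calc hs X ≤ ∑ i, ∑ j, X i i * X j j := by
        exact Finset.sum_le_sum fun i _ => Finset.sum_le_sum fun j _ => h2 i j
    _ = X.trace ^ 2 := by
        rw [pow_two, Matrix.trace, Finset.sum_mul_sum]; rfl

theorem isUnit_diagonal {s : ι → ℝ} (hs : ∀ i, 0 < s i) :
    diagonal s * diagonal (fun i => (s i)⁻¹) = 1 ∧ diagonal (fun i => (s i)⁻¹) * diagonal s = 1 := by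
  constructor <;> rw [diagonal_mul_diagonal, ← diagonal_one] <;> congr 1 <;> funext i
  · exact mul_inv_cancel₀ (hs i).ne'
  · exact inv_mul_cancel₀ (hs i).ne'

/-- If `E² = s (s² + 2b) s`, then `E = s (1 + X) s` with `0 ≤ X` and `tr X ≤ ∑ b_ii / s_i²`. -/
theorem exists_excess {s : ι → ℝ} (hs0 : ∀ i, 0 < s i) {b E : Matrix ι ι ℝ} (hb : b.PosSemidef)
    (hE : E.PosSemidef)
    (hEE : E * E = diagonal s * (diagonal s * diagonal s + (2 : ℝ) • b) * diagonal s) :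
    ∃ X : Matrix ι ι ℝ, X.PosSemidef ∧ E = diagonal s * (1 + X) * diagonal s ∧
      X.trace ≤ ∑ i, b i i / s i ^ 2 := by
  obtain ⟨hi1, hi2⟩ := isUnit_diagonal hs0
  set S := diagonal s with hS
  set T := diagonal (fun i => (s i)⁻¹) with hT
  have hSt : Sᵀ = S := diagonal_transpose _
  have hTt : Tᵀ = T := diagonal_transpose _
  have hSd : (S * S).PosDef := by
    rw [hS, diagonal_mul_diagonal]
    exact Matrix.PosDef.diagonal fun i => mul_pos (hs0 i) (hs0 i)
  have h1 : (E - S * S).PosSemidef := by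
    refine posSemidef_sub_of_sq hE hSd ?_
    have : E * E - S * S * (S * S) = S * ((2 : ℝ) • b) * Sᵀ := by
      rw [hEE, hSt]; noncomm_ring
    rw [this]
    exact PosSemidef.conj (hb.smul (by norm_num)) S
  -- `E ≥ s²` because `E² - s⁴ = 2 s b s ≥ 0`. The excess satisfies `X s² + s² X + X s² X = 2 b`,
  -- and its diagonal entries give the trace bound since the last term on the left is non-negative
  -- there.
  refine ⟨T * (E - S * S) * T, ?_, ?_, ?_⟩
  · nth_rewrite 2 [← hTt]
    exact PosSemidef.conj h1 T
  · have e1 : S * (1 + T * (E - S * S) * T) * S = S * S + (S * T) * (E - S * S) * (T * S) := by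
      noncomm_ring
    rw [e1, hi1, hi2]
    simp
  · set X := T * (E - S * S) * T with hX
    have hXt : Xᵀ = X := by
      refine PosSemidef.transpose_eq ?_
      rw [hX]; nth_rewrite 2 [← hTt]
      exact PosSemidef.conj h1 T
    have hEX : E = S * (1 + X) * S := by
      have e1 : S * (1 + X) * S = S * S + (S * T) * (E - S * S) * (T * S) := by
        rw [hX]; noncomm_ring
      rw [e1, hi1, hi2]; simp
    have e2 : (1 + X) * (S * S) * (1 + X) = S * S + (2 : ℝ) • b := by
      have e3 : S * ((1 + X) * (S * S) * (1 + X)) * S = S * (S * S + (2 : ℝ) • b) * S := by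
        rw [← hEE, hEX]; noncomm_ring
      have e4 := congrArg (fun M => T * M * T) e3
      have e5 : ∀ M : Matrix ι ι ℝ, T * (S * M * S) * T = M := fun M => by
        have : T * (S * M * S) * T = (T * S) * M * (S * T) := by noncomm_ring
        rw [this, hi1, hi2]; simp
      simpa only [e5] using e4
    have e6 : X * (S * S) + S * S * X + X * (S * S) * X = (2 : ℝ) • b := by
      have : (1 + X) * (S * S) * (1 + X)
          = S * S + (X * (S * S) + S * S * X + X * (S * S) * X) := by noncomm_ring
      rw [this] at e2
      exact add_left_cancel e2
    refine Finset.sum_le_sum fun i _ => ?_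
    have e7 := congrFun (congrFun e6 i) i
    rw [hS, diagonal_mul_diagonal] at e7
    simp only [Matrix.add_apply, mul_diagonal, diagonal_mul, Matrix.smul_apply, smul_eq_mul] at e7
    have e8 : 0 ≤ (X * diagonal (fun i => s i * s i) * X) i i := by
      rw [mul_apply]
      refine Finset.sum_nonneg fun j _ => ?_
      rw [mul_diagonal]
      have : X j i = X i j := by
        conv_lhs => rw [← hXt, transpose_apply]
      rw [this]
      nlinarith [mul_nonneg (sq_nonneg (X i j)) (sq_nonneg (s j))]
    rw [diag_apply, le_div_iff₀ (pow_pos (hs0 i) 2)]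
    nlinarith

/-- The square root of `s (1 + X) s` is close to `s^{1/2}`. -/
theorem hs_sqrt_excess_le {q : ι → ℝ} (hq : ∀ i, 0 < q i) {X F : Matrix ι ι ℝ} (hX : X.PosSemidef)
    (hF : F.PosSemidef)
    (hFF : F * F = diagonal q * (1 + X) * diagonal q) :
    hs (F * diagonal (fun i => (q i)⁻¹) - 1) ≤ 4 * X.trace ^ 2 := by
  obtain ⟨hi1, hi2⟩ := isUnit_diagonal hq
  set S := diagonal q with hS
  set T := diagonal (fun i => (q i)⁻¹) with hT
  have hSt : Sᵀ = S := diagonal_transpose _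
  have hSd : S.PosDef := Matrix.PosDef.diagonal hq
  have hY : (F - S).PosSemidef := by
    refine posSemidef_sub_of_sq hF hSd ?_
    have : F * F - S * S = S * X * Sᵀ := by
      rw [hFF, hSt]; noncomm_ring
    rw [this]
    exact PosSemidef.conj hX S
  set Y := F - S with hYdef
  have hYt := PosSemidef.transpose_eq hY
  have hYs : ∀ i j, Y j i = Y i j := fun i j => by conv_lhs => rw [← hYt, transpose_apply]
  set Z := F * T - 1 with hZ
  have hZY : ∀ i j, Z i j = Y i j * (q j)⁻¹ := by
    have : Z = Y * T := by rw [hZ, hYdef, sub_mul, hi1]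
    intro i j
    rw [this, hT, mul_diagonal]
  have hmain : S * Y + Y * S + Y * Y = S * X * S := by
    have h1 : (S + Y) * (S + Y) = S * (1 + X) * S := by
      rw [← hFF, hYdef]; congr 1 <;> abel
    have h2 : (S + Y) * (S + Y) = S * S + (S * Y + Y * S + Y * Y) := by noncomm_ring
    have h3 : S * (1 + X) * S = S * S + S * X * S := by noncomm_ring
    rw [h2, h3] at h1
    exact add_left_cancel h1
  have hent : ∀ i j, (q i + q j) * Y i j + ∑ l, Y i l * Y l j = q i * X i j * q j := by
    intro i j
    have := congrFun (congrFun hmain i) j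
    simp only [hS, Matrix.add_apply, mul_diagonal, diagonal_mul] at this
    rw [mul_apply] at this
    linarith
  -- A first bound, linear in the trace, from the diagonal entries of `q Y + Y q + Y² = q X q`.
  have hs1 : hs Z ≤ X.trace := by
    rw [← hs_transpose, hs, Matrix.trace]
    refine Finset.sum_le_sum fun i _ => ?_
    have h1 := hent i i
    have h2 : ∑ j, Zᵀ i j ^ 2 = (∑ l, Y i l * Y l i) / q i ^ 2 := by
      rw [Finset.sum_div]
      refine Finset.sum_congr rfl fun l _ => ?_
      rw [transpose_apply, hZY, hYs l i]
      field_simp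
    rw [h2, div_le_iff₀ (pow_pos (hq i) 2), diag_apply]
    have h3 : 0 ≤ Y i i := hY.diag_nonneg
    have := hq i
    nlinarith
  -- The same equation, read entrywise, is `Z i j = q i / (q i + q j) · (X - Zᵀ Z) i j`. Inserting
  -- the linear bound for `Zᵀ Z` upgrades it to a quadratic one.
  have hs2 : hs Z ≤ hs (X + -(Zᵀ * Z)) := by
    refine Finset.sum_le_sum fun i _ => Finset.sum_le_sum fun j _ => ?_
    have hqi := hq i
    have hqj := hq j
    have h1 : Z i j = q i / (q i + q j) * (X + -(Zᵀ * Z)) i j := by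
      have h2 : (Zᵀ * Z) i j = (∑ l, Y i l * Y l j) / (q i * q j) := by
        rw [mul_apply, Finset.sum_div]
        refine Finset.sum_congr rfl fun l _ => ?_
        rw [transpose_apply, hZY, hZY, hYs i l]
        field_simp
      have h3 := hent i j
      rw [Matrix.add_apply, Matrix.neg_apply, h2, hZY]
      have h4 : ∑ l, Y i l * Y l j = q i * X i j * q j - (q i + q j) * Y i j := by linarith
      rw [h4]
      field_simp
      ring
    rw [h1, mul_pow]
    have h5 : (q i / (q i + q j)) ^ 2 ≤ 1 := by
      refine pow_le_one₀ (by positivity) ?_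
      rw [div_le_one (by positivity)]
      linarith
    nlinarith [sq_nonneg ((X + -(Zᵀ * Z)) i j)]
  have hs3 : hs (Zᵀ * Z) ≤ X.trace ^ 2 := by
    refine (hs_le_trace_sq (posSemidef_transpose_mul_self Z)).trans ?_
    rw [← hs_eq_trace]
    have := hs_nonneg Z
    gcongr
  have hs4 := hs_le_trace_sq hX
  calc hs Z ≤ _ := hs2
    _ ≤ 2 * hs X + 2 * hs (-(Zᵀ * Z)) := hs_add_le _ _
    _ ≤ 4 * X.trace ^ 2 := by rw [hs_neg]; linarith

theorem polarFactor_spec {M : Matrix ι ι ℝ} (hM : IsUnit M) :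
    (mabs M).PosDef ∧ (polarFactor M)ᵀ * polarFactor M = 1 ∧ polarFactor M * mabs M = M := by
  have h0 := posSemidef_transpose_mul_self M
  have hMt : IsUnit Mᵀ := (isUnit_transpose M).mpr hM
  have h1 : (mabs M).PosDef := msqrt_posDef (PosSemidef.posDef h0 (hMt.mul hM))
  have hdet : IsUnit (mabs M).det := (isUnit_iff_isUnit_det _).mp h1.isUnit
  have h2 : mabs M * mabs M = Mᵀ * M := msqrt_mul_self h0
  have h3 : (mabs M)⁻¹ᵀ = (mabs M)⁻¹ := by
    rw [transpose_nonsing_inv]; congr 1; exact msqrt_transpose _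
  refine ⟨h1, ?_, ?_⟩
  · rw [polarFactor, transpose_mul, h3, mul_assoc, ← mul_assoc Mᵀ, ← h2, mul_assoc (mabs M),
      mul_nonsing_inv _ hdet, mul_one, nonsing_inv_mul _ hdet]
  · rw [polarFactor, mul_assoc, nonsing_inv_mul _ hdet, mul_one]

/-- Uniqueness of the polar decomposition, used to read off the factors from a product of an
orthogonal and a positive matrix. -/
theorem polarFactor_eq {Q H : Matrix ι ι ℝ} (hQ : Qᵀ * Q = 1) (hH : H.PosDef) :
    polarFactor (Q * H) = Q ∧ mabs (Q * H) = H := by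
  have h1 : mabs (Q * H) = H := by
    rw [mabs, transpose_mul, mul_assoc, ← mul_assoc Qᵀ, hQ, one_mul,
      PosSemidef.transpose_eq hH.posSemidef]
    exact msqrt_mul_self_eq hH.posSemidef
  have hdet : IsUnit H.det := (isUnit_iff_isUnit_det _).mp hH.isUnit
  refine ⟨?_, h1⟩
  rw [polarFactor, h1, mul_assoc, mul_nonsing_inv _ hdet, mul_one]

/-- The polar factor `O` of the inverse of `H Oᵀ` is at least half as close to `1` as `H Oᵀ`. -/
theorem hs_orthogonal_sub_one_le {O H : Matrix ι ι ℝ} (hO : Oᵀ * O = 1) (hH : H.PosSemidef) :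
    hs (O - 1) ≤ 4 * hs (H * Oᵀ - 1) := by
  have hO' : O * Oᵀ = 1 := mul_eq_one_comm.mp hO
  have hHt := PosSemidef.transpose_eq hH
  -- This is `tr (H Oᵀ) ≤ tr H`, which says that among the products of `H` with orthogonal matrices
  -- `H` itself is closest to `1`.
  have h0 : 0 ≤ ((O - 1) * H * (O - 1)ᵀ).trace := (PosSemidef.conj hH (O - 1)).trace_nonneg
  have tr1 : (O * H * Oᵀ).trace = H.trace := by
    rw [trace_mul_comm, ← mul_assoc, hO, one_mul]
  have tr2 : (O * H).trace = (H * Oᵀ).trace := by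
    rw [← trace_transpose, transpose_mul, hHt]
  have h1 : ((O - 1) * H * (O - 1)ᵀ).trace = 2 * H.trace - 2 * (H * Oᵀ).trace := by
    rw [transpose_sub, transpose_one]
    have : (O - 1) * H * (Oᵀ - 1) = O * H * Oᵀ - O * H - H * Oᵀ + H := by noncomm_ring
    rw [this]
    simp only [trace_add, trace_sub, tr1, tr2]
    ring
  have h2 : hs (H - 1) ≤ hs (H * Oᵀ - 1) := by
    have e1 : hs (H - 1) = (H * H).trace - 2 * H.trace + (1 : Matrix ι ι ℝ).trace := by
      rw [hs_eq_trace, transpose_sub, transpose_one, hHt]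
      have : (H - 1) * (H - 1) = H * H - H - H + 1 := by noncomm_ring
      rw [this]; simp only [trace_add, trace_sub]; ring
    have e2 : hs (H * Oᵀ - 1)
        = (H * H).trace - 2 * (H * Oᵀ).trace + (1 : Matrix ι ι ℝ).trace := by
      rw [hs_eq_trace, transpose_sub, transpose_one, transpose_mul, transpose_transpose, hHt]
      have : (O * H - 1) * (H * Oᵀ - 1) = O * (H * H) * Oᵀ - O * H - H * Oᵀ + 1 := by noncomm_ring
      have tr3 : (O * (H * H) * Oᵀ).trace = (H * H).trace := by
        rw [trace_mul_comm, ← mul_assoc, hO, one_mul]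
      rw [this]; simp only [trace_add, trace_sub, tr2, tr3]; ring
    rw [e1, e2]; linarith
  -- `Oᵀ - 1 = (H Oᵀ - 1) - (H - 1) Oᵀ`.
  have h3 : hs (O - 1) = hs ((H * Oᵀ - 1) + -((H - 1) * Oᵀ)) := by
    rw [← hs_transpose]
    congr 1
    rw [transpose_sub, transpose_one]
    noncomm_ring
  rw [h3]
  refine (hs_add_le _ _).trans ?_
  rw [hs_neg, hs_mul_orthogonal _ hO]
  linarith

/-- The right side is `4 sinh² (log x)`, and `|sinh u| ≥ |u|`. -/
theorem sq_log_le {x : ℝ} (hx : 0 < x) : 4 * Real.log x ^ 2 ≤ x ^ 2 + (x ^ 2)⁻¹ - 2 := by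
  have h1 : x ^ 2 + (x ^ 2)⁻¹ - 2 = (x - x⁻¹) ^ 2 := by field_simp; ring
  have h2 : x - x⁻¹ = 2 * Real.sinh (Real.log x) := by
    rw [Real.sinh_eq, Real.exp_neg, Real.exp_log hx]; ring
  have h3 : Real.log x ^ 2 ≤ Real.sinh (Real.log x) ^ 2 := by
    rw [sq_le_sq]
    rw [Real.abs_sinh]
    exact Real.self_le_sinh_iff.mpr (abs_nonneg _)
  rw [h1, h2]; nlinarith

/-- The trace of the scalar inequality `sq_log_le` applied to the spectrum of `H^{1/2}`. It avoids
computing the logarithm: only traces of `H` and `H⁻¹` enter. -/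
theorem hs_mlog_msqrt_le {H : Matrix ι ι ℝ} (hH : H.PosDef) :
    hs (mlog (msqrt H)) ≤ (H.trace + H⁻¹.trace - 2 * (1 : Matrix ι ι ℝ).trace) / 4 := by
  set M := msqrt H with hM
  have hMd : M.PosDef := msqrt_posDef hH
  have hMsa : IsSelfAdjoint M := hMd.1.isSelfAdjoint
  have hc : ∀ f : ℝ → ℝ, ContinuousOn f (spectrum ℝ M) := fun f => continuousOn_spectrum f M
  have h1 : H = cfc (fun x : ℝ => x ^ 2) M := by
    rw [cfc_pow_id M 2, pow_two, hM, msqrt_mul_self hH.posSemidef]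
  have h2 : H⁻¹ = cfc (fun x : ℝ => (x ^ 2)⁻¹) M := by
    refine inv_eq_right_inv ?_
    rw [h1, ← cfc_mul _ _ M (hc _) (hc _)]
    rw [cfc_congr (g := fun _ => 1) fun x hx => mul_inv_cancel₀ (pow_pos (spectrum_pos hMd hx) 2).ne']
    exact cfc_const_one ℝ M
  have h3 : (mlog M)ᵀ * mlog M = cfc (fun x => Real.log x * Real.log x) M := by
    rw [mlog, cfc_transpose, ← cfc_mul _ _ M (hc _) (hc _)]
  have h4 : (H + H⁻¹ - (2 : ℝ) • 1 - (4 : ℝ) • ((mlog M)ᵀ * mlog M)).PosSemidef := by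
    have : H + H⁻¹ - (2 : ℝ) • (1 : Matrix ι ι ℝ) - (4 : ℝ) • ((mlog M)ᵀ * mlog M)
        = cfc (fun x : ℝ => x ^ 2 + (x ^ 2)⁻¹ - 2 * 1 - 4 * (Real.log x * Real.log x)) M := by
      rw [cfc_sub _ _ M (hc _) (hc _), cfc_sub _ _ M (hc _) (hc _), cfc_add M _ _ (hc _) (hc _),
        ← h1, ← h2, h3, cfc_const_mul _ _ M (hc _), cfc_const_mul _ _ M (hc _), cfc_const_one ℝ M]
    rw [this]
    refine cfc_posSemidef fun x hx => ?_
    have := sq_log_le (spectrum_pos hMd hx)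
    nlinarith
  have h5 := h4.trace_nonneg
  simp only [trace_sub, trace_add, trace_smul, smul_eq_mul, ← hs_eq_trace] at h5
  linarith

/-! ### Matrices on two copies of an index set -/

/-- The matrix which acts as `a` on the symmetric and as `c` on the antisymmetric vectors. -/
noncomputable def blk (a c : Matrix ι ι ℝ) : Matrix (ι ⊕ ι) (ι ⊕ ι) ℝ :=
  fromBlocks ((1 / 2 : ℝ) • (a + c)) ((1 / 2 : ℝ) • (a - c)) ((1 / 2 : ℝ) • (a - c))
    ((1 / 2 : ℝ) • (a + c))

theorem blk_mul (a c a' c' : Matrix ι ι ℝ) : blk a c * blk a' c' = blk (a * a') (c * c') := by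
  simp only [blk, fromBlocks_multiply, smul_mul_smul_comm, ← smul_add]
  congr 1 <;>
  · rw [show ((1 / 2 : ℝ)) = (1 / 2 * (1 / 2)) * 2 by norm_num, mul_smul (1 / 2 * (1 / 2) : ℝ) 2,
      show (1 / 2 * (1 / 2) * 2 * (1 / 2 * (1 / 2) * 2) : ℝ) = 1 / 2 * (1 / 2) by norm_num]
    congr 1
    rw [two_smul]
    noncomm_ring

theorem blk_transpose (a c : Matrix ι ι ℝ) : (blk a c)ᵀ = blk aᵀ cᵀ := by
  simp [blk, fromBlocks_transpose]

theorem blk_one : blk (1 : Matrix ι ι ℝ) 1 = 1 := by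
  rw [blk, ← fromBlocks_one]
  congr 1 <;> simp [← two_smul ℝ (1 : Matrix ι ι ℝ), smul_smul]

theorem blk_sub (a c a' c' : Matrix ι ι ℝ) : blk a c - blk a' c' = blk (a - a') (c - c') := by
  simp only [blk, sub_eq_add_neg, fromBlocks_neg, fromBlocks_add, ← smul_neg, ← smul_add]
  congr 2 <;> abel

theorem trace_blk (a c : Matrix ι ι ℝ) : (blk a c).trace = a.trace + c.trace := by
  simp only [blk, Matrix.trace, Fintype.sum_sum_type, diag_apply, fromBlocks_apply₁₁,
    fromBlocks_apply₂₂, Matrix.smul_apply, Matrix.add_apply, smul_eq_mul,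
    ← Finset.sum_add_distrib]
  refine Finset.sum_congr rfl fun i _ => ?_
  ring

theorem hs_blk (a c : Matrix ι ι ℝ) : hs (blk a c) = hs a + hs c := by
  rw [hs_eq_trace, blk_transpose, blk_mul, trace_blk, ← hs_eq_trace, ← hs_eq_trace]

theorem blk_posSemidef {a c : Matrix ι ι ℝ} (ha : a.PosSemidef) (hc : c.PosSemidef) :
    (blk a c).PosSemidef := by
  rw [← msqrt_mul_self ha, ← msqrt_mul_self hc, ← blk_mul]
  nth_rewrite 1 [← msqrt_transpose a, ← msqrt_transpose c]
  rw [← blk_transpose]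
  exact posSemidef_transpose_mul_self _

theorem isUnit_blk {a c : Matrix ι ι ℝ} (ha : IsUnit a) (hc : IsUnit c) :
    IsUnit (blk a c) ∧ (blk a c)⁻¹ = blk a⁻¹ c⁻¹ := by
  have h : blk a c * blk a⁻¹ c⁻¹ = 1 := by
    rw [blk_mul, mul_nonsing_inv _ ((isUnit_iff_isUnit_det _).mp ha),
      mul_nonsing_inv _ ((isUnit_iff_isUnit_det _).mp hc), blk_one]
  exact ⟨IsUnit.of_mul_eq_one _ h, inv_eq_right_inv h⟩

theorem blk_posDef {a c : Matrix ι ι ℝ} (ha : a.PosDef) (hc : c.PosDef) : (blk a c).PosDef :=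
  PosSemidef.posDef (blk_posSemidef ha.posSemidef hc.posSemidef) (isUnit_blk ha.isUnit hc.isUnit).1

theorem msqrt_blk {a c : Matrix ι ι ℝ} (ha : a.PosSemidef) (hc : c.PosSemidef) :
    msqrt (blk a c) = blk (msqrt a) (msqrt c) := by
  have h : blk a c = blk (msqrt a) (msqrt c) * blk (msqrt a) (msqrt c) := by
    rw [blk_mul, msqrt_mul_self ha, msqrt_mul_self hc]
  rw [h, msqrt_mul_self_eq (blk_posSemidef (msqrt_posSemidef a) (msqrt_posSemidef c))]

end Matrices

end RPA

/-! ### Hilbert-Schmidt bounds for the Bogoliubov kernels and the logarithm of an orthogonal matrix.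
-/

namespace RPA

section Kernels

open Matrix

variable {ι : Type} [Fintype ι] [DecidableEq ι]

theorem inv_transpose {A : Matrix ι ι ℝ} (hA : Aᵀ = A) : A⁻¹ᵀ = A⁻¹ := by
  rw [transpose_nonsing_inv, hA]

/-- For scalars, `1/(1+x) - 1 + x = x²/(1+x) ≤ x²`. For matrices, with `G = (1 + X)⁻¹`, the
difference `X² - (X - 1 + G)` equals `X (1 - G) X ≥ 0`. -/
theorem trace_inv_one_add_le {X : Matrix ι ι ℝ} (hX : X.PosSemidef) :
    ((1 + X)⁻¹).trace + X.trace - (1 : Matrix ι ι ℝ).trace ≤ X.trace ^ 2 := by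
  have hXt := PosSemidef.transpose_eq hX
  have hu : IsUnit (1 + X).det :=
    (isUnit_iff_isUnit_det _).mp (PosDef.one.add_posSemidef hX).isUnit
  set G := (1 + X)⁻¹ with hG
  have h1 : G * (1 + X) = 1 := nonsing_inv_mul _ hu
  have h1' : (1 + X) * G = 1 := mul_nonsing_inv _ hu
  have hGt : Gᵀ = G := inv_transpose (by rw [transpose_add, transpose_one, hXt])
  have h2 : 1 - G = G * X := by
    rw [mul_add, mul_one] at h1; rw [← h1]; abel
  have h2' : 1 - G = X * G := by
    rw [add_mul, one_mul] at h1'; rw [← h1']; abel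
  have h3 : (1 - G).PosSemidef := by
    have : 1 - G = G * (X + Xᵀ * X) * Gᵀ := by
      rw [hGt, hXt]
      have : G * (X + X * X) * G = G * X * ((1 + X) * G) := by noncomm_ring
      rw [this, h1', mul_one, h2]
    rw [this]
    exact PosSemidef.conj (hX.add (posSemidef_transpose_mul_self X)) G
  have h4 := (PosSemidef.conj h3 X).trace_nonneg
  have h5 : X * (1 - G) * Xᵀ = Xᵀ * X - (X - (1 - G)) := by
    rw [hXt]
    have e : X * (1 - G) * X = X * X - (X * G) * X := by noncomm_ring
    rw [e, ← h2', sub_mul, one_mul, ← h2]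
  rw [h5, trace_sub, ← hs_eq_trace, trace_sub, trace_sub] at h4
  linarith [hs_le_trace_sq hX]

/-- Bounds on the Bogoliubov kernels. -/
theorem kernel_bounds {d : ι → ℝ} (hd : ∀ i, 0 < d i) {b : Matrix ι ι ℝ} (hb : b.PosSemidef)
    {S₁ : Matrix (ι ⊕ ι) (ι ⊕ ι) ℝ}
    (hS₁ : S₁ = msqrt (blk (diagonal d) (diagonal d + (2 : ℝ) • b))
      * (msqrt (msqrt (msqrt (blk (diagonal d) (diagonal d + (2 : ℝ) • b))
        * blk (diagonal d + (2 : ℝ) • b) (diagonal d)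
        * msqrt (blk (diagonal d) (diagonal d + (2 : ℝ) • b)))))⁻¹)
    {Q : Matrix (ι ⊕ ι) (ι ⊕ ι) ℝ}
    (hQ : Q = polarFactor S₁
      * blk 1 (polarFactor (msqrt (diagonal d + (2 : ℝ) • b) * msqrt (diagonal d)))) :
    hs (mlog (mabs S₁ᵀ)) ≤ (∑ i, b i i / d i) ^ 2 / 2 ∧ Qᵀ * Q = 1 ∧
      hs (Q - 1) ≤ 32 * (∑ i, b i i / d i) ^ 2 := by
  set s : ι → ℝ := fun i => √(d i) with hs_def
  have hs0 : ∀ i, 0 < s i := fun i => Real.sqrt_pos.mpr (hd i)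
  obtain ⟨hST, hTS⟩ := isUnit_diagonal hs0
  set S := diagonal s with hS
  set T := diagonal (fun i => (s i)⁻¹) with hT
  have hSt : Sᵀ = S := diagonal_transpose _
  have hTt : Tᵀ = T := diagonal_transpose _
  have hSd : S.PosDef := Matrix.PosDef.diagonal hs0
  have hSS : diagonal d = S * S := by
    rw [hS, diagonal_mul_diagonal]
    congr 1; funext i
    exact (Real.mul_self_sqrt (hd i).le).symm
  have hDd : (diagonal d).PosDef := Matrix.PosDef.diagonal hd
  have hmD : msqrt (diagonal d) = S := by rw [hSS, msqrt_mul_self_eq hSd.posSemidef]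
  set B := diagonal d + (2 : ℝ) • b with hB
  have hBd : B.PosDef := hDd.add_posSemidef (hb.smul (by norm_num))
  set r := msqrt B with hr
  have hrd : r.PosDef := msqrt_posDef hBd
  have hrt : rᵀ = r := msqrt_transpose _
  have hrr : r * r = B := msqrt_mul_self hBd.posSemidef
  have hSBS : (S * B * S).PosSemidef := by
    nth_rewrite 2 [← hSt]; exact PosSemidef.conj hBd.posSemidef S
  have hSBSd : (S * B * S).PosDef :=
    PosSemidef.posDef hSBS ((hSd.isUnit.mul hBd.isUnit).mul hSd.isUnit)
  set E := msqrt (S * B * S) with hE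
  have hEE : E * E = S * B * S := msqrt_mul_self hSBS
  have hEd : E.PosDef := msqrt_posDef hSBSd
  have hEt : Eᵀ = E := msqrt_transpose _
  set F := msqrt E with hF
  have hFd : F.PosDef := msqrt_posDef hEd
  have hFt : Fᵀ = F := msqrt_transpose _
  have hFF : F * F = E := msqrt_mul_self hEd.posSemidef
  have hFu : IsUnit F.det := (isUnit_iff_isUnit_det _).mp hFd.isUnit
  have hFit : F⁻¹ᵀ = F⁻¹ := inv_transpose hFt
  have hFF1 : F * F⁻¹ = 1 := mul_nonsing_inv _ hFu
  have hFF2 : F⁻¹ * F = 1 := nonsing_inv_mul _ hFu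
  obtain ⟨X, hX, hEX, hXtr⟩ := exists_excess hs0 hb hEd.posSemidef (by rw [hEE, ← hSS])
  have hτ : X.trace ≤ ∑ i, b i i / d i := by
    refine hXtr.trans (le_of_eq (Finset.sum_congr rfl fun i _ => ?_))
    rw [hs_def, Real.sq_sqrt (hd i).le]
  have hX0 : 0 ≤ X.trace := hX.trace_nonneg
  have hτ2 : X.trace ^ 2 ≤ (∑ i, b i i / d i) ^ 2 := by gcongr
  have hZ := hs_sqrt_excess_le hs0 hX hFd.posSemidef (by rw [hFF, hEX])
  -- `E` is the symmetric block of the matrix of the same name; since `r s = A E`, the antisymmetric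
  -- block is its conjugate `A E Aᵀ`. Both blocks of `S₁` can therefore be written with the one
  -- matrix `F = E^{1/2}`.
  obtain ⟨A_pd, hAA, hAE⟩ := polarFactor_spec (hrd.isUnit.mul hSd.isUnit)
  have hmabs : mabs (r * S) = E := by
    rw [mabs, transpose_mul, hSt, hrt, hE]; congr 1
    rw [← hrr]; noncomm_ring
  rw [hmabs] at hAE
  set A := polarFactor (r * S) with hA
  have hAA' : A * Aᵀ = 1 := mul_eq_one_comm.mp hAA
  have hEA : E * Aᵀ = S * r := by
    have := congrArg transpose hAE
    rwa [transpose_mul, transpose_mul, hEt, hSt, hrt] at this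
  have hconj : ∀ M : Matrix ι ι ℝ, A * M * Aᵀ * (A * M * Aᵀ) = A * (M * M) * Aᵀ := fun M => by
    have : A * M * Aᵀ * (A * M * Aᵀ) = A * M * (Aᵀ * A) * M * Aᵀ := by noncomm_ring
    rw [this, hAA]; noncomm_ring
  have hEo : msqrt (r * diagonal d * r) = A * E * Aᵀ := by
    have : r * diagonal d * r = A * E * Aᵀ * (A * E * Aᵀ) := by
      rw [hconj]
      have : A * (E * E) * Aᵀ = A * E * (E * Aᵀ) := by noncomm_ring
      rw [this, hAE, hEA, hSS]; noncomm_ring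
    rw [this, msqrt_mul_self_eq (PosSemidef.conj hEd.posSemidef A)]
  have hFo : msqrt (A * E * Aᵀ) = A * F * Aᵀ := by
    rw [← hFF, ← hconj, msqrt_mul_self_eq (PosSemidef.conj hFd.posSemidef A)]
  have hAu : IsUnit A := IsUnit.of_mul_eq_one _ hAA'
  have hAtu : IsUnit Aᵀ := IsUnit.of_mul_eq_one _ hAA
  have hFoinv : (A * F * Aᵀ)⁻¹ = A * F⁻¹ * Aᵀ := by
    refine inv_eq_right_inv ?_
    have : A * F * Aᵀ * (A * F⁻¹ * Aᵀ) = A * F * (Aᵀ * A) * F⁻¹ * Aᵀ := by noncomm_ring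
    rw [this, hAA, mul_one, mul_assoc A, hFF1, mul_one, hAA']
  have hrDr : (r * diagonal d * r).PosSemidef := by
    nth_rewrite 2 [← hrt]; exact PosSemidef.conj hDd.posSemidef r
  have hS₁' : S₁ = blk (S * F⁻¹) (r * (A * F⁻¹ * Aᵀ)) := by
    rw [hS₁, msqrt_blk hDd.posSemidef hBd.posSemidef, hmD, ← hr, blk_mul, blk_mul,
      msqrt_blk hSBS hrDr, ← hE, hEo,
      msqrt_blk hEd.posSemidef (PosSemidef.conj hEd.posSemidef A), hFo, ← hF,
      (isUnit_blk hFd.isUnit ((hAu.mul hFd.isUnit).mul hAtu)).2, hFoinv, blk_mul]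
  have hrA : r * A = T * E := by
    have h1 : T * E * Aᵀ * A = T * S * r * A := by
      rw [mul_assoc T E, hEA]; noncomm_ring
    rw [hTS, one_mul, mul_assoc, hAA, mul_one] at h1
    exact h1.symm
  have hSo : r * (A * F⁻¹ * Aᵀ) = T * F * Aᵀ := by
    have : r * (A * F⁻¹ * Aᵀ) = r * A * F⁻¹ * Aᵀ := by noncomm_ring
    rw [this, hrA, ← hFF]
    have : T * (F * F) * F⁻¹ * Aᵀ = T * F * (F * F⁻¹) * Aᵀ := by noncomm_ring
    rw [this, hFF1, mul_one]
  rw [hSo] at hS₁'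
  have hFiu : IsUnit F⁻¹ := IsUnit.of_mul_eq_one _ hFF2
  obtain ⟨hHd, hOO, hOH⟩ := polarFactor_spec (hSd.isUnit.mul hFiu)
  set O := polarFactor (S * F⁻¹) with hO
  set H := mabs (S * F⁻¹) with hH
  have hOO' : O * Oᵀ = 1 := mul_eq_one_comm.mp hOO
  have hHu : IsUnit H.det := (isUnit_iff_isUnit_det _).mp hHd.isUnit
  have hHt := PosSemidef.transpose_eq hHd.posSemidef
  have hHit : H⁻¹ᵀ = H⁻¹ := inv_transpose hHt
  have hHH1 : H * H⁻¹ = 1 := mul_nonsing_inv _ hHu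
  -- The block `s F⁻¹ = O H` and its inverse transpose `s⁻¹ F = O H⁻¹` share the orthogonal factor.
  -- The antisymmetric block is `s⁻¹ F Aᵀ`, so its factor is `O Aᵀ`, and `Õ` removes the `Aᵀ`.
  have hFT : F * T = H⁻¹ * Oᵀ := by
    have h1 : F * T * (O * H) = 1 := by
      rw [hOH]
      have : F * T * (S * F⁻¹) = F * (T * S) * F⁻¹ := by noncomm_ring
      rw [this, hTS, mul_one, hFF1]
    have h2 : F * T * (O * H) * (H⁻¹ * Oᵀ) = F * T * (O * (H * H⁻¹) * Oᵀ) := by noncomm_ring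
    rw [hHH1, mul_one, hOO', mul_one, h1, one_mul] at h2
    exact h2.symm
  have hTF : T * F = O * H⁻¹ := by
    have := congrArg transpose hFT
    rwa [transpose_mul, transpose_mul, hFt, hTt, hHit, transpose_transpose] at this
  have hHid : H⁻¹.PosDef := hHd.inv
  have hAHA : (A * H⁻¹ * Aᵀ).PosDef :=
    PosSemidef.posDef (PosSemidef.conj hHid.posSemidef A) ((hAu.mul hHid.isUnit).mul hAtu)
  have hpolar : polarFactor S₁ = blk O (O * Aᵀ) := by
    have h1 : S₁ = blk O (O * Aᵀ) * blk H (A * H⁻¹ * Aᵀ) := by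
      rw [hS₁', blk_mul, hOH, hTF]
      congr 1
      have : O * Aᵀ * (A * H⁻¹ * Aᵀ) = O * (Aᵀ * A) * H⁻¹ * Aᵀ := by noncomm_ring
      rw [this, hAA, mul_one]
    rw [h1]
    refine (polarFactor_eq ?_ (blk_posDef hHd hAHA)).1
    rw [blk_transpose, blk_mul, hOO, transpose_mul, transpose_transpose]
    have : A * Oᵀ * (O * Aᵀ) = A * (Oᵀ * O) * Aᵀ := by noncomm_ring
    rw [this, hOO, mul_one, hAA', blk_one]
  have hQ' : Q = blk O O := by
    rw [hQ, hpolar, hmD, ← hA, blk_mul, mul_one, mul_assoc, hAA, mul_one]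
  refine ⟨?_, ?_, ?_⟩
  · set G := (1 + X)⁻¹ with hG
    have h1Xd : (1 + X).PosDef := PosDef.one.add_posSemidef hX
    have hXu : IsUnit (1 + X).det := (isUnit_iff_isUnit_det _).mp h1Xd.isUnit
    have e1 : T * E * T = 1 + X := by
      rw [hEX]
      have : T * (S * (1 + X) * S) * T = (T * S) * (1 + X) * (S * T) := by noncomm_ring
      rw [this, hTS, hST, one_mul, mul_one]
    have e2 : S * F⁻¹ * (S * F⁻¹)ᵀ = G := by
      refine (inv_eq_right_inv ?_).symm
      rw [← e1, transpose_mul, hFit, hSt, ← hFF]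
      have : T * (F * F) * T * (S * F⁻¹ * (F⁻¹ * S))
          = T * F * F * (T * S) * F⁻¹ * F⁻¹ * S := by noncomm_ring
      rw [this, hTS, mul_one]
      have : T * F * F * F⁻¹ * F⁻¹ * S = T * (F * (F * F⁻¹) * F⁻¹) * S := by noncomm_ring
      rw [this, hFF1, mul_one, hFF1, mul_one, hTS]
    have e3 : T * F * Aᵀ * (T * F * Aᵀ)ᵀ = 1 + X := by
      rw [transpose_mul, transpose_mul, transpose_transpose, hTt, hFt, ← e1, ← hFF]
      have : T * F * Aᵀ * (A * (F * T)) = T * F * (Aᵀ * A) * F * T := by noncomm_ring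
      rw [this, hAA]; noncomm_ring
    -- The blocks of `S₁ S₁ᵀ` are mutually inverse, so the terms linear in `X` cancel in the trace
    -- bound and `τ²` remains.
    have e4 : S₁ᵀᵀ * S₁ᵀ = blk G (1 + X) := by
      rw [transpose_transpose, hS₁', blk_transpose, blk_mul, e2, e3]
    have hGd : G.PosDef := h1Xd.inv
    have e5 : (blk G (1 + X))⁻¹ = blk (1 + X) G := by
      rw [(isUnit_blk hGd.isUnit h1Xd.isUnit).2, hG, nonsing_inv_nonsing_inv _ hXu]
    have e6 := hs_mlog_msqrt_le (blk_posDef hGd h1Xd)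
    rw [e5, trace_blk, trace_blk, ← blk_one, trace_blk, trace_add] at e6
    have e7 := trace_inv_one_add_le hX
    rw [mabs, e4]
    linarith
  · rw [hQ', blk_transpose, blk_mul, hOO, blk_one]
  -- `F s⁻¹ = H⁻¹ Oᵀ` is close to `1` by `hs_sqrt_excess_le`, hence so is `O`. The constant is `32 =
  -- 2 · 4 · 4`, the `2` for two equal blocks.
  · have h1 := hs_orthogonal_sub_one_le hOO hHid.posSemidef
    rw [← hFT] at h1
    rw [hQ', ← blk_one, blk_sub, hs_blk]
    linarith

/-! ### The logarithm of orthogonal matrices -/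

theorem branchLog_neg_conj {t : ℝ} {z : ℂ} (hz : ‖z‖ = 1) :
    (starRingEnd ℂ) (branchLog t z) = -branchLog t z := by
  have h1 : ‖z * Complex.exp ((Real.pi - t : ℝ) * Complex.I)‖ = 1 := by
    rw [norm_mul, hz, Complex.norm_exp_ofReal_mul_I, one_mul]
  have h2 : (branchLog t z).re = 0 := by
    simp only [branchLog, Complex.sub_re, Complex.log_re, h1, Real.log_one, Complex.re_ofReal_mul,
      Complex.I_re, mul_zero, sub_zero]
  apply Complex.ext
  · simp [h2]
  · simp

/-- As `0 < t < 2π`, the point `1` is off the branch cut and the logarithm is differentiable there.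
Away from `1` its norm on the circle is at most `2π` while `|z - 1|` is bounded below. -/
theorem exists_norm_branchLog_le {t : ℝ} (h0 : 0 < t) (h1 : t < 2 * Real.pi) :
    ∃ C : ℝ, 0 < C ∧ ∀ z : ℂ, ‖z‖ = 1 → ‖branchLog t z‖ ≤ C * ‖z - 1‖ := by
  set w := Complex.exp ((Real.pi - t : ℝ) * Complex.I) with hw
  have hlogw : Complex.log w = (Real.pi - t : ℝ) * Complex.I := by
    rw [hw, Complex.log_exp]
    · simp; linarith
    · simp; linarith
  have hws : w ∈ Complex.slitPlane := by
    rw [Complex.mem_slitPlane_iff_arg]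
    refine ⟨?_, Complex.exp_ne_zero _⟩
    rw [← Complex.log_im, hlogw]
    simp only [Complex.im_ofReal_mul, Complex.I_im, mul_one]
    intro h; linarith
  have hdiff : HasDerivAt (branchLog t) (w / w) 1 := by
    have h2 : HasDerivAt (fun z : ℂ => z * w) w 1 := by
      simpa using (hasDerivAt_id (1 : ℂ)).mul_const w
    have := h2.clog (by simpa using hws)
    simp only [one_mul] at this
    exact this.sub_const _
  have hb1 : branchLog t 1 = 0 := by
    rw [branchLog, one_mul, ← hw, hlogw, sub_self]
  have hO := hdiff.isBigO_sub
  rw [Asymptotics.isBigO_iff] at hO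
  obtain ⟨c, hc⟩ := hO
  rw [Metric.eventually_nhds_iff] at hc
  obtain ⟨ε, hε, hc⟩ := hc
  have hbd : ∀ z : ℂ, ‖z‖ = 1 → ‖branchLog t z‖ ≤ 2 * Real.pi := by
    intro z hz
    have h3 : ‖z * w‖ = 1 := by
      rw [norm_mul, hz, hw, Complex.norm_exp_ofReal_mul_I, one_mul]
    have h4 : Complex.log (z * w) = (Complex.arg (z * w) : ℂ) * Complex.I := by
      rw [Complex.log, h3, Real.log_one]; simp
    rw [branchLog, ← hw, h4, ← sub_mul, norm_mul, Complex.norm_I, mul_one, ← Complex.ofReal_sub,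
      Complex.norm_real, Real.norm_eq_abs]
    have h5 := Complex.neg_pi_lt_arg (z * w)
    have h6 := Complex.arg_le_pi (z * w)
    have := Real.pi_pos
    rw [abs_le]; constructor <;> linarith
  refine ⟨max c (2 * Real.pi / ε), lt_max_of_lt_right (by have := Real.pi_pos; positivity),
    fun z hz => ?_⟩
  by_cases h : dist z 1 < ε
  · have := hc h
    rw [hb1, sub_zero] at this
    exact this.trans (mul_le_mul_of_nonneg_right (le_max_left _ _) (norm_nonneg _))
  · push Not at h
    rw [dist_eq_norm] at h
    refine (hbd z hz).trans ?_
    have h7 : 2 * Real.pi = 2 * Real.pi / ε * ε := by field_simp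
    calc 2 * Real.pi = 2 * Real.pi / ε * ε := h7
      _ ≤ _ := mul_le_mul (le_max_right _ _) h hε.le
        (le_max_of_le_right (by have := Real.pi_pos; positivity))

open scoped Matrix.Norms.L2Operator in
-- Functional calculus for the normal matrix `q`: the logarithm is purely imaginary on the circle,
-- and `C² |z - 1|² - |log z|² ≥ 0` makes `C² (q - 1)ᴴ (q - 1) - Lᴴ L` of the form `Yᴴ Y`, whose
-- trace is non-negative.
theorem orthLog_spec {t C : ℝ} (hC : ∀ z : ℂ, ‖z‖ = 1 → ‖branchLog t z‖ ≤ C * ‖z - 1‖)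
    {Q : Matrix ι ι ℝ} (hQ : Qᵀ * Q = 1) :
    (orthLog t Q)ᴴ = -orthLog t Q ∧
      ∑ i, ∑ j, ‖orthLog t Q i j‖ ^ 2 ≤ C ^ 2 * hs (Q - 1) := by
  set q : Matrix ι ι ℂ := Q.map (fun x => (x : ℂ)) with hq
  have hqt : qᴴ = Qᵀ.map (fun x => (x : ℂ)) := by
    ext i j; simp [hq]
  have hqq : qᴴ * q = 1 := by
    have : (Qᵀ * Q).map (Complex.ofRealHom : ℝ →+* ℂ) = 1 := by
      rw [hQ]; simp
    rw [Matrix.map_mul] at this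
    rw [hqt]; exact this
  have hqu : q ∈ unitary (Matrix ι ι ℂ) := by
    rw [Unitary.mem_iff]
    exact ⟨hqq, mul_eq_one_comm.mp hqq⟩
  have hqn : IsStarNormal q := ⟨by
    have := mul_eq_one_comm.mp hqq
    rw [Commute, SemiconjBy, star_eq_conjTranspose, hqq, this]⟩
  have hsp : ∀ z ∈ spectrum ℂ q, ‖z‖ = 1 := fun z hz => by
    simpa using spectrum.subset_circle_of_unitary hqu hz
  have hc : ∀ f : ℂ → ℂ, ContinuousOn f (spectrum ℂ q) := fun f =>
    q.finite_spectrum.continuousOn f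
  set L := orthLog t Q with hL
  have hLdef : L = cfc (branchLog t) q := rfl
  have hstar : Lᴴ = -L := by
    rw [← star_eq_conjTranspose, hLdef, ← cfc_star, ← cfc_neg]
    exact cfc_congr fun z hz => branchLog_neg_conj (hsp z hz)
  refine ⟨hstar, ?_⟩
  have hq1 : q - 1 = cfc (fun z : ℂ => z - 1) q := by
    rw [cfc_sub _ _ q (hc _) (hc _), cfc_id' ℂ q, cfc_const_one ℂ q]
  set g : ℂ → ℂ := fun z => ((√(C ^ 2 * ‖z - 1‖ ^ 2 - ‖branchLog t z‖ ^ 2) : ℝ) : ℂ) with hg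
  set Y := cfc g q with hY
  have hmain : Yᴴ * Y = ((C ^ 2 : ℝ) : ℂ) • ((q - 1)ᴴ * (q - 1)) - Lᴴ * L := by
    simp only [← star_eq_conjTranspose]
    rw [hq1, hLdef, hY, ← cfc_star, ← cfc_star, ← cfc_star, ← cfc_mul _ _ q (hc _) (hc _),
      ← cfc_mul _ _ q (hc _) (hc _), ← cfc_mul _ _ q (hc _) (hc _),
      ← cfc_const_mul _ _ q (hc _), ← cfc_sub _ _ q (hc _) (hc _)]
    refine cfc_congr fun z hz => ?_
    have h1 := hC z (hsp z hz)
    have h2 : ‖branchLog t z‖ ^ 2 ≤ C ^ 2 * ‖z - 1‖ ^ 2 := by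
      rw [← mul_pow]; gcongr
    have h3 : ∀ u : ℂ, star u * u = ((‖u‖ ^ 2 : ℝ) : ℂ) := fun u => by
      rw [Complex.star_def, mul_comm, Complex.mul_conj, Complex.normSq_eq_norm_sq]
    simp only [h3]
    simp only [hg, Complex.norm_real, Real.norm_eq_abs, sq_abs]
    rw [Real.sq_sqrt (by linarith)]
    push_cast; ring
  have htr : ∀ M : Matrix ι ι ℂ, (Mᴴ * M).trace = ((∑ i, ∑ j, ‖M i j‖ ^ 2 : ℝ) : ℂ) := by
    intro M
    simp only [Matrix.trace, diag_apply, mul_apply, conjTranspose_apply]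
    rw [Finset.sum_comm]
    push_cast
    refine Finset.sum_congr rfl fun i _ => Finset.sum_congr rfl fun j _ => ?_
    rw [Complex.star_def, mul_comm, Complex.mul_conj, Complex.normSq_eq_norm_sq]
    push_cast; rfl
  have h4 := congrArg Matrix.trace hmain
  rw [trace_sub, trace_smul, htr, htr, htr, smul_eq_mul, ← Complex.ofReal_mul,
    ← Complex.ofReal_sub, Complex.ofReal_inj] at h4
  have h5 : ∑ i, ∑ j, ‖(q - 1) i j‖ ^ 2 = hs (Q - 1) := by
    refine Finset.sum_congr rfl fun i _ => Finset.sum_congr rfl fun j _ => ?_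
    have : (q - 1) i j = (((Q - 1) i j : ℝ) : ℂ) := by
      rw [Matrix.sub_apply, Matrix.sub_apply, hq, map_apply, one_apply, one_apply]
      split_ifs <;> simp
    rw [this, Complex.norm_real, Real.norm_eq_abs, sq_abs]
  rw [h5] at h4
  have h6 : 0 ≤ ∑ i, ∑ j, ‖Y i j‖ ^ 2 :=
    Finset.sum_nonneg fun _ _ => Finset.sum_nonneg fun _ _ => sq_nonneg _
  linarith

end Kernels

end RPA

/-! ### Kernel bounds for the patch decomposition. -/

namespace RPA

namespace PatchDecomposition

open Matrix

variable {kF R C₀ : ℝ} {n : ℕ} (P : PatchDecomposition kF R C₀ n)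

theorem mem_cap_mirror (α : Fin n × Bool) (x : E3) :
    x ∈ P.cap (α.1, !α.2) ↔ -x ∈ P.cap α := by
  rcases α with ⟨i, s⟩
  cases s
  · have := P.cap_mirror i (-x)
    rw [neg_neg] at this
    exact this.symm
  · exact P.cap_mirror i x

theorem mem_patch_mirror (α : Fin n × Bool) (x : E3) :
    x ∈ P.patch (α.1, !α.2) ↔ -x ∈ P.patch α := by
  simp only [patch, shell, Set.mem_ofPred_eq, norm_neg, P.mem_cap_mirror, smul_neg]

/-- The reflection `p ↦ -p` preserves the Fermi ball and exchanges opposite patches. It is what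
makes the matrices `D`, `W`, `W̃` invariant under swapping the two copies of the index set. -/
theorem nrm_mirror (α : Fin n × Bool) (k : Mom) : P.nrm (α.1, !α.2) (-k) = P.nrm α k := by
  unfold nrm
  have h : ∀ p, p ∈ P.pairs (α.1, !α.2) (-k) ↔ -p ∈ P.pairs α k := by
    intro p
    have e : toE3 (-p - k) = -toE3 (p - -k) := by rw [← toE3_neg]; congr 1; abel
    simp only [mem_pairs, mem_patch_mirror, mem_fermiBall, toE3_neg, norm_neg, e]
  have : (P.pairs (α.1, !α.2) (-k)).card = (P.pairs α k).card := by
    refine Finset.card_bij (fun p _ => -p) (fun p hp => (h p).mp hp)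
      (fun p _ q _ hpq => neg_injective hpq) fun q hq => ⟨-q, ?_, neg_neg q⟩
    rw [h, neg_neg]; exact hq
  rw [this]

theorem cosAngle_mirror (α : Fin n × Bool) (k : Mom) :
    P.cosAngle k (α.1, !α.2) = P.cosAngle k α := by
  have h : P.center (α.1, !α.2) = -P.center α := by
    rcases α with ⟨i, s⟩
    cases s
    · simp only [Bool.not_false]; rw [P.center_mirror, neg_neg]
    · simp only [Bool.not_true]; rw [P.center_mirror]
  simp only [cosAngle, h, inner_neg_right, abs_neg]

variable {P} in
-- The identity behind it is `ħ³ N = 1`.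
theorem coupling_eq (hkF : 0 < kF) (V : ℝ) {x : ℝ} (hx : 0 < x) :
    V / (2 * hbar kF * kappa kF * numN kF * x)
      = kappa kF / 2 * V * (hbar kF / (kappa kF * √x)) ^ 2 := by
  have hN : (0 : ℝ) < numN kF := by exact_mod_cast one_le_numN hkF
  have hh : 0 < hbar kF := Real.rpow_pos_of_pos hN _
  have hκ : 0 < kappa kF := div_pos hkF (Real.rpow_pos_of_pos hN _)
  have hs : √x ^ 2 = x := Real.sq_sqrt hx.le
  have h3 : hbar kF ^ 3 * numN kF = 1 := by
    rw [hbar, ← Real.rpow_natCast, ← Real.rpow_mul hN.le]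
    nth_rewrite 2 [← Real.rpow_one (numN kF : ℝ)]
    rw [← Real.rpow_add hN]
    norm_num
  have hs0 := Real.sqrt_pos.mpr hx
  rw [div_pow, mul_pow, hs]
  field_simp
  linear_combination -V * h3

section kernels

variable (Vhat : Mom → ℝ) (δ : ℝ) (k : Mom)

theorem b_apply (hkF : 0 < kF) (hk : 0 < ‖toE3 k‖) (α β : P.IPlus δ k) :
    P.b Vhat δ k α β = Vhat k / (2 * hbar kF * kappa kF * numN kF * ‖toE3 k‖)
      * (P.nrm α.1 k * P.nrm β.1 k) := by
  rw [coupling_eq hkF _ hk]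
  simp only [b, v, Matrix.smul_apply, vecMulVec_apply, smul_eq_mul]
  ring

theorem D_add_W_sub_Wt (hkF : 0 < kF) (hk : 0 < ‖toE3 k‖) :
    P.D δ k + P.W Vhat δ k - P.Wt Vhat δ k
      = blk (P.d δ k) (P.d δ k + (2 : ℝ) • P.b Vhat δ k) := by
  ext i j
  rcases i with α | α <;> rcases j with β | β <;>
  · simp only [blk, fromBlocks_apply₁₁, fromBlocks_apply₁₂, fromBlocks_apply₂₁,
      fromBlocks_apply₂₂, Matrix.add_apply, Matrix.sub_apply, Matrix.smul_apply, smul_eq_mul,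
      P.b_apply Vhat δ k hkF hk, D, W, Wt, d, nI, diagonal_apply, label, signedMom, P.nrm_mirror,
      P.cosAngle_mirror, Sum.isLeft_inl, Sum.isLeft_inr, Sum.inl.injEq, Sum.inr.injEq,
      reduceCtorEq, if_true, if_false, Bool.false_eq_true, Bool.true_eq_false]
    ring

theorem D_add_W_add_Wt (hkF : 0 < kF) (hk : 0 < ‖toE3 k‖) :
    P.D δ k + P.W Vhat δ k + P.Wt Vhat δ k
      = blk (P.d δ k + (2 : ℝ) • P.b Vhat δ k) (P.d δ k) := by
  ext i j
  rcases i with α | α <;> rcases j with β | β <;>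
  · simp only [blk, fromBlocks_apply₁₁, fromBlocks_apply₁₂, fromBlocks_apply₂₁,
      fromBlocks_apply₂₂, Matrix.add_apply, Matrix.sub_apply, Matrix.smul_apply, smul_eq_mul,
      P.b_apply Vhat δ k hkF hk, D, W, Wt, d, nI, diagonal_apply, label, signedMom, P.nrm_mirror,
      P.cosAngle_mirror, Sum.isLeft_inl, Sum.isLeft_inr, Sum.inl.injEq, Sum.inr.injEq,
      reduceCtorEq, if_true, if_false, Bool.false_eq_true, Bool.true_eq_false]
    ring

theorem Ot_eq : P.Ot Vhat δ k = blk 1 (P.A Vhat δ k) := by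
  have h2 : (√2 : ℝ)⁻¹ * (√2)⁻¹ = 1 / 2 := by
    rw [← mul_inv, Real.mul_self_sqrt (by norm_num)]; norm_num
  simp only [Ot, U, transpose_smul, fromBlocks_transpose, transpose_one, transpose_neg,
    Matrix.smul_mul, Matrix.mul_smul, smul_smul, h2, fromBlocks_multiply, blk]
  rw [fromBlocks_smul]
  congr 1 <;> simp [sub_eq_add_neg]

variable {P Vhat δ k}

/-- Everything reduces to `τ ≤ 352 V̂(k)`. The prefactor in `τ` is `V̂(k) / (2 ħ κ N)` with `ħ κ N =
k_F N^{1/3} ≥ k_F² / 2`, and the remaining sum is at most `352 k_F²`. The constant for `L` is `2112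
= 6 · 352`, as `32 ≤ 6²`. -/
theorem Fine.kernel_bounds {ε : ℝ} (hP : P.Fine δ ε) (hε : 0 < ε) (hε2 : ε ≤ 1 / 2)
    (hV : 0 ≤ Vhat k) (hk0 : k ≠ 0) (hk1 : 1 ≤ ‖toE3 k‖) (hkR : ‖toE3 k‖ < R)
    {t C : ℝ} (hC : ∀ z : ℂ, ‖z‖ = 1 → ‖branchLog t z‖ ≤ C * ‖z - 1‖) :
    ∑ i, ∑ j, P.K Vhat δ k i j ^ 2 ≤ (352 * Vhat k) ^ 2 ∧
      (P.L Vhat δ k t)ᴴ = -P.L Vhat δ k t ∧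
      ∑ i, ∑ j, ‖P.L Vhat δ k t i j‖ ^ 2 ≤ (2112 * C * Vhat k) ^ 2 := by
  have hkF : 0 < kF := hP.R_pos.trans hP.R_lt
  have hk : 0 < ‖toE3 k‖ := by linarith
  have hN : (0 : ℝ) < numN kF := by exact_mod_cast one_le_numN hkF
  have hx0 : 0 < (numN kF : ℝ) ^ (-δ) := Real.rpow_pos_of_pos hN _
  have hκ : 0 < kappa kF := div_pos hkF (Real.rpow_pos_of_pos hN _)
  have hinner : ∀ α : P.IPlus δ k, 0 < inner ℝ (toE3 k) (P.center α.1) := fun α =>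
    hx0.trans_le α.2
  have hd : ∀ α : P.IPlus δ k, 0 < P.cosAngle k α.1 := fun α =>
    div_pos (abs_pos.mpr (hinner α).ne') hk
  have hb : (P.b Vhat δ k).PosSemidef := by
    have := posSemidef_vecMulVec_self_star (P.v δ k)
    rw [star_trivial] at this
    exact this.smul (by positivity)
  obtain ⟨h1, h2, h3⟩ := RPA.kernel_bounds hd hb (S₁ := P.S1 Vhat δ k)
    (by
      rw [S1, E, P.D_add_W_sub_Wt Vhat δ k hkF hk, P.D_add_W_add_Wt Vhat δ k hkF hk]
      rfl)
    (Q := P.O Vhat δ k * P.Ot Vhat δ k) (by rw [P.Ot_eq]; rfl)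
  set τ := ∑ α : P.IPlus δ k, P.b Vhat δ k α α / P.cosAngle k α.1 with hτ
  have hτ0 : 0 ≤ τ := Finset.sum_nonneg fun α _ => div_nonneg hb.diag_nonneg (hd α).le
  have hτV : τ ≤ 352 * Vhat k := by
    have e1 : τ = Vhat k / (2 * hbar kF * kappa kF * numN kF)
        * ∑ α : P.IPlus δ k, ((P.pairs α.1 k).card : ℝ) / inner ℝ (toE3 k) (P.center α.1) := by
      rw [hτ, Finset.mul_sum]
      refine Finset.sum_congr rfl fun α _ => ?_
      rw [P.b_apply Vhat δ k hkF hk, nrm, Real.mul_self_sqrt (by positivity), cosAngle,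
        abs_of_pos (hinner α)]
      have := hinner α
      have hh : 0 < hbar kF := Real.rpow_pos_of_pos hN _
      field_simp
    have e2 : hbar kF * kappa kF * numN kF = kF * (numN kF : ℝ) ^ (1 / 3 : ℝ) := by
      have e3 : hbar kF * numN kF
          = (numN kF : ℝ) ^ (1 / 3 : ℝ) * (numN kF : ℝ) ^ (1 / 3 : ℝ) := by
        rw [hbar, ← Real.rpow_add hN]
        nth_rewrite 2 [← Real.rpow_one (numN kF : ℝ)]
        rw [← Real.rpow_add hN]
        norm_num
      have hr := Real.rpow_pos_of_pos hN (1 / 3 : ℝ)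
      rw [mul_right_comm, e3, kappa]
      field_simp
    have e4 := hP.sum_card_pairs_le hε hε2 hk0 hk1 hkR
    have e5 := half_le_numN_rpow hkF
    rw [e1, mul_assoc 2, mul_assoc 2, e2]
    have hr := Real.rpow_pos_of_pos hN (1 / 3 : ℝ)
    refine (mul_le_mul_of_nonneg_left e4 (by positivity)).trans ?_
    rw [div_mul_eq_mul_div, div_le_iff₀ (by positivity)]
    have : 0 ≤ Vhat k * kF := mul_nonneg hV hkF.le
    nlinarith
  have hτ2 : τ ^ 2 ≤ (352 * Vhat k) ^ 2 := by gcongr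
  obtain ⟨h4, h5⟩ := orthLog_spec hC h2
  refine ⟨?_, h4, ?_⟩
  · have : hs (P.K Vhat δ k) ≤ τ ^ 2 / 2 := h1
    have h6 : ∑ i, ∑ j, P.K Vhat δ k i j ^ 2 = hs (P.K Vhat δ k) := rfl
    rw [h6]
    nlinarith [sq_nonneg τ]
  · refine h5.trans ?_
    have : C ^ 2 * hs (P.O Vhat δ k * P.Ot Vhat δ k - 1) ≤ C ^ 2 * (32 * (352 * Vhat k) ^ 2) := by
      gcongr
      linarith
    refine this.trans ?_
    nlinarith [sq_nonneg (C * Vhat k)]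

end kernels

end PatchDecomposition

end RPA

namespace RPA

noncomputable section

/-! ### Bounded diagonal operators -/

/-- Multiplication of the coefficients by a bounded real function. -/
def diagOp (w : Finset Mom → ℝ) (hw : ∃ M, ∀ S, |w S| ≤ M) : Fock →L[ℂ] Fock :=
  have hM : ∀ S, |w S| ≤ hw.choose := hw.choose_spec
  have hM0 : 0 ≤ hw.choose := (abs_nonneg _).trans (hM ∅)
  have hsum : ∀ (ψ : Fock) (s : Finset (Finset Mom)),
      ∑ S ∈ s, ‖(w S : ℂ) * ψ S‖ ^ (2 : ℝ≥0∞).toReal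
        ≤ (hw.choose * ‖ψ‖) ^ (2 : ℝ≥0∞).toReal := fun ψ s => by
    have h1 : ∀ S ∈ s, ‖(w S : ℂ) * ψ S‖ ^ (2 : ℝ≥0∞).toReal
        ≤ hw.choose ^ (2 : ℝ≥0∞).toReal * ‖ψ S‖ ^ (2 : ℝ≥0∞).toReal := fun S _ => by
      rw [← Real.mul_rpow hM0 (norm_nonneg _), norm_mul, Complex.norm_real, Real.norm_eq_abs]
      have := hM S
      gcongr
    refine (Finset.sum_le_sum h1).trans ?_
    rw [← Finset.mul_sum, Real.mul_rpow hM0 (norm_nonneg _)]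
    gcongr
    exact lp.sum_rpow_le_norm_rpow (by norm_num) ψ s
  LinearMap.mkContinuous
    { toFun := fun ψ => ⟨fun S => (w S : ℂ) * ψ S, memℓp_gen' (hsum ψ)⟩
      map_add' := fun ψ φ => by
        ext S
        change (w S : ℂ) * (ψ S + φ S) = w S * ψ S + w S * φ S
        ring
      map_smul' := fun c ψ => by
        ext S
        change (w S : ℂ) * (c * ψ S) = c * (w S * ψ S)
        ring }
    hw.choose (fun ψ =>
      lp.norm_le_of_forall_sum_le (by norm_num) (mul_nonneg hM0 (norm_nonneg _)) (hsum ψ))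

theorem diagOp_apply (w : Finset Mom → ℝ) (hw : ∃ M, ∀ S, |w S| ≤ M) (ψ : Fock) (S : Finset Mom) :
    diagOp w hw ψ S = w S * ψ S := rfl

theorem hasSum_inner_diagOp (w : Finset Mom → ℝ) (hw : ∃ M, ∀ S, |w S| ≤ M) (ψ : Fock) :
    HasSum (fun S => w S * ‖ψ S‖ ^ 2) (RCLike.re (inner ℂ ψ (diagOp w hw ψ))) := by
  have h := (lp.hasSum_inner ψ (diagOp w hw ψ)).mapL Complex.reCLM
  convert h using 1
  · funext S
    rw [diagOp_apply, RCLike.inner_apply, Complex.reCLM_apply, mul_assoc,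
      Complex.mul_conj, ← Complex.ofReal_mul, Complex.ofReal_re, Complex.normSq_eq_norm_sq]
  · rfl

theorem adjoint_diagOp (w : Finset Mom → ℝ) (hw : ∃ M, ∀ S, |w S| ≤ M) :
    ContinuousLinearMap.adjoint (diagOp w hw) = diagOp w hw := by
  symm
  rw [ContinuousLinearMap.eq_adjoint_iff]
  intro ψ φ
  rw [lp.inner_eq_tsum, lp.inner_eq_tsum]
  refine tsum_congr fun S => ?_
  rw [diagOp_apply, diagOp_apply, RCLike.inner_apply, RCLike.inner_apply, map_mul,
    Complex.conj_ofReal]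
  ring

theorem inner_diagOp_left (w : Finset Mom → ℝ) (hw : ∃ M, ∀ S, |w S| ≤ M) (ψ φ : Fock) :
    inner ℂ (diagOp w hw ψ) φ = inner ℂ ψ (diagOp w hw φ) := by
  conv_lhs => rw [← adjoint_diagOp]
  exact ContinuousLinearMap.adjoint_inner_left _ _ _

/-! ### Propagation of forms along exponentials -/

/-- Grönwall: `e^{-cs} ⟨y(s), V y(s)⟩` with `y(s) = e^{sX} x` is non-increasing. -/
theorem re_inner_exp_le {H : Type*} [NormedAddCommGroup H] [InnerProductSpace ℂ H] [CompleteSpace H]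
    (V X : H →L[ℂ] H) (hV : ∀ x y, inner ℂ (V x) y = inner ℂ x (V y)) (c : ℝ)
    (h : ∀ x, 2 * RCLike.re (inner ℂ (V x) (X x)) ≤ c * RCLike.re (inner ℂ x (V x))) (x : H) :
    RCLike.re (inner ℂ (NormedSpace.exp X x) (V (NormedSpace.exp X x)))
      ≤ Real.exp c * RCLike.re (inner ℂ x (V x)) := by
  set y : ℝ → H := fun s => NormedSpace.exp (s • X) x with hy
  have hyd : ∀ s, HasDerivAt y (X (y s)) s := fun s => by
    have h1 : HasDerivAt (fun u : ℝ => NormedSpace.exp (u • X)) (X * NormedSpace.exp (s • X)) s :=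
      hasDerivAt_exp_smul_const' X s
    exact ((ContinuousLinearMap.apply ℂ H x).restrictScalars ℝ).hasFDerivAt.comp_hasDerivAt s h1
  set g : ℝ → ℝ := fun s => RCLike.re (inner ℂ (y s) (V (y s))) with hg
  have hgd : ∀ s, HasDerivAt g (2 * RCLike.re (inner ℂ (V (y s)) (X (y s)))) s := fun s => by
    have h2 : HasDerivAt (fun u => V (y u)) (V (X (y s))) s :=
      ((V.restrictScalars ℝ).hasFDerivAt.comp_hasDerivAt s (hyd s))
    have h3 := Complex.reCLM.hasFDerivAt.comp_hasDerivAt s ((hyd s).inner ℂ h2)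
    refine h3.congr_deriv ?_
    rw [← hV, map_add, Complex.reCLM_apply, Complex.reCLM_apply,
      ← inner_conj_symm (X (y s)) (V (y s)), Complex.conj_re]
    simp only [RCLike.re_to_complex]
    ring
  set f : ℝ → ℝ := fun s => Real.exp (-c * s) * g s with hf
  have hfd : ∀ s, HasDerivAt f (Real.exp (-c * s) * (-c) * g s
      + Real.exp (-c * s) * (2 * RCLike.re (inner ℂ (V (y s)) (X (y s))))) s := fun s => by
    have h4 : HasDerivAt (fun u : ℝ => Real.exp (-c * u)) (Real.exp (-c * s) * (-c)) s := by
      simpa using ((hasDerivAt_id s).const_mul (-c)).exp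
    exact h4.mul (hgd s)
  have hanti : Antitone f := by
    refine antitone_of_deriv_nonpos (fun s => (hfd s).differentiableAt) fun s => ?_
    rw [(hfd s).deriv]
    have h5 := mul_le_mul_of_nonneg_left (h (y s)) (Real.exp_pos (-c * s)).le
    simp only [hg]
    linarith
  have h01 := hanti (zero_le_one : (0 : ℝ) ≤ 1)
  simp only [hf, hg, hy, one_smul, zero_smul, NormedSpace.exp_zero, mul_one, mul_zero,
    Real.exp_zero, one_mul, one_apply_eq_self] at h01
  rw [Real.exp_neg, inv_mul_le_iff₀ (Real.exp_pos c)] at h01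
  exact h01

theorem form_eq_ofReal (w : Finset Mom → ℕ) (hw : ∃ M, ∀ S, |(w S : ℝ)| ≤ M) (ψ : Fock) :
    form w ψ = ENNReal.ofReal (RCLike.re (inner ℂ ψ (diagOp (fun S => (w S : ℝ)) hw ψ))) := by
  have h := hasSum_inner_diagOp (fun S => (w S : ℝ)) hw ψ
  rw [← h.tsum_eq, ENNReal.ofReal_tsum_of_nonneg (fun S => by positivity) h.summable, form]
  refine tsum_congr fun S => ?_
  rw [ENNReal.ofReal_mul (by positivity), ENNReal.ofReal_natCast,
    ENNReal.ofReal_pow (norm_nonneg _), ofReal_norm]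

theorem form_exp_le (X : Fock →L[ℂ] Fock) (w : Finset Mom → ℕ)
    (hw : ∃ M, ∀ S, |(w S : ℝ)| ≤ M) (c : ℝ)
    (h : ∀ ψ, 2 * RCLike.re (inner ℂ (diagOp (fun S => (w S : ℝ)) hw ψ) (X ψ))
      ≤ c * RCLike.re (inner ℂ ψ (diagOp (fun S => (w S : ℝ)) hw ψ))) (ψ : Fock) :
    form w (NormedSpace.exp X ψ) ≤ ENNReal.ofReal (Real.exp c) * form w ψ := by
  rw [form_eq_ofReal w hw, form_eq_ofReal w hw, ← ENNReal.ofReal_mul (Real.exp_pos c).le]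
  exact ENNReal.ofReal_le_ofReal (re_inner_exp_le _ X (inner_diagOp_left _ hw) c h ψ)

theorem form_mono {w w' : Finset Mom → ℕ} (h : ∀ S, w S ≤ w' S) (ψ : Fock) :
    form w ψ ≤ form w' ψ :=
  ENNReal.tsum_le_tsum fun S => by gcongr; exact_mod_cast h S

/-- A form is the supremum of the forms of an exhausting family of weights. -/
theorem form_le_of_forall {w : Finset Mom → ℕ} {v : ℕ → Finset Mom → ℕ}
    (hv : ∀ s : Finset (Finset Mom), ∃ n, ∀ S ∈ s, w S ≤ v n S) {ψ : Fock} {B : ℝ≥0∞}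
    (h : ∀ n, form (v n) ψ ≤ B) : form w ψ ≤ B := by
  rw [form, ENNReal.tsum_eq_iSup_sum]
  refine iSup_le fun s => ?_
  obtain ⟨n, hn⟩ := hv s
  refine le_trans ?_ ((ENNReal.sum_le_tsum s).trans (h n))
  refine Finset.sum_le_sum fun S hS => ?_
  gcongr
  exact_mod_cast hn S hS

/-! ### Pair annihilation operators -/

/-- The set obtained by adding the pair `p`, `p - k`. -/
def addPair (k p : Mom) (S : Finset Mom) : Finset Mom := by
  classical exact insert p (insert (p - k) S)

/-- The pair `p`, `p - k` consists of two momenta outside `S`. -/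
def Free (k p : Mom) (S : Finset Mom) : Prop := p - k ∉ S ∧ p ∉ S ∧ k ≠ 0

theorem mem_addPair {k p q : Mom} {S : Finset Mom} :
    q ∈ addPair k p S ↔ q = p ∨ q = p - k ∨ q ∈ S := by
  classical
  simp [addPair]

theorem card_addPair {k p : Mom} {S : Finset Mom} (h : Free k p S) :
    (addPair k p S).card = S.card + 2 := by
  classical
  have h1 : p ∉ insert (p - k) S := by
    rw [Finset.mem_insert, not_or]
    exact ⟨fun h0 => h.2.2 (by simpa using h0.symm), h.2.1⟩
  have h2 : addPair k p S = insert p (insert (p - k) S) := by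
    ext q; simp [mem_addPair]
  rw [h2, Finset.card_insert_of_notMem h1, Finset.card_insert_of_notMem h.1]

theorem subset_addPair (k p : Mom) (S : Finset Mom) : S ⊆ addPair k p S := fun _ hq =>
  mem_addPair.mpr (Or.inr (Or.inr hq))

open Classical in
/-- The sum of a function over all ways of adding a pair from `F`. -/
def pairSum {A : Type*} [AddCommMonoid A] (F : Finset Mom) (k : Mom) (h : Finset Mom → A)
    (S : Finset Mom) : A :=
  ∑ p ∈ F, if Free k p S then h (addPair k p S) else 0

open Classical in
-- Adding a fixed pair is injective on the sets disjoint from it, and every set produced contains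
-- the pair.
theorem tsum_addPair_le (k p : Mom) (h : Finset Mom → ℝ≥0∞) :
    ∑' S, (if Free k p S then h (addPair k p S) else 0)
      ≤ ∑' S : Finset Mom, if p ∈ S ∧ p - k ∈ S then h S else 0 := by
  set g : Finset Mom → ℝ≥0∞ := fun S => if p ∈ S ∧ p - k ∈ S then h S else 0 with hg
  have h1 : ∀ S, (if Free k p S then h (addPair k p S) else 0)
      = Set.indicator {S | Free k p S} (fun S => g (addPair k p S)) S := fun S => by
    by_cases hS : Free k p S
    · have : p ∈ addPair k p S ∧ p - k ∈ addPair k p S := by simp [mem_addPair]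
      simp [hS, hg, this]
    · simp [hS]
  rw [tsum_congr h1, ← tsum_subtype]
  refine ENNReal.tsum_comp_le_tsum_of_injective
    (f := fun S : {S | Free k p S} => addPair k p S.1) ?_ g
  rintro ⟨S, hS⟩ ⟨S', hS'⟩ heq
  refine Subtype.ext (Finset.ext fun q => ?_)
  have heq' : addPair k p S = addPair k p S' := heq
  have key : ∀ {A B : Finset Mom}, Free k p A → addPair k p A = addPair k p B → q ∈ A → q ∈ B := by
    intro A B hA hAB hq
    have h2 : q ∈ addPair k p B := hAB ▸ subset_addPair k p A hq
    rcases mem_addPair.mp h2 with rfl | rfl | h3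
    · exact absurd hq hA.2.1
    · exact absurd hq hA.1
    · exact h3
  exact ⟨key hS heq', key hS' heq'.symm⟩

section family

variable {J : Type} [Fintype J] {F : J → Finset Mom} {κ : J → Mom} {G : Finset Mom → ℕ}

open Classical in
-- A set is reached once for each admissible pair it contains, and there are at most `G` of these.
-- This is the form of `∑ c* c ≤ 𝓝_δ` on coefficients.
theorem sum_tsum_pairSum_le
    (hG : ∀ S, ∑ j, ((F j).filter (fun p => p ∈ S ∧ p - κ j ∈ S)).card ≤ G S)
    (h : Finset Mom → ℝ≥0∞) :
    ∑ j, ∑' S, pairSum (F j) (κ j) h S ≤ ∑' S, (G S : ℝ≥0∞) * h S := by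
  calc ∑ j, ∑' S, pairSum (F j) (κ j) h S
      = ∑ j, ∑ p ∈ F j, ∑' S, (if Free (κ j) p S then h (addPair (κ j) p S) else 0) := by
        refine Finset.sum_congr rfl fun j _ => ?_
        exact Summable.tsum_finsetSum fun _ _ => ENNReal.summable
    _ ≤ ∑ j, ∑ p ∈ F j, ∑' S : Finset Mom, (if p ∈ S ∧ p - κ j ∈ S then h S else 0) :=
        Finset.sum_le_sum fun j _ => Finset.sum_le_sum fun p _ => tsum_addPair_le _ _ _
    _ = ∑' S : Finset Mom, ∑ j, ∑ p ∈ F j, (if p ∈ S ∧ p - κ j ∈ S then h S else 0) := by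
        rw [Summable.tsum_finsetSum fun _ _ => ENNReal.summable]
        refine Finset.sum_congr rfl fun j _ => ?_
        rw [Summable.tsum_finsetSum fun _ _ => ENNReal.summable]
    _ ≤ ∑' S, (G S : ℝ≥0∞) * h S := by
        refine ENNReal.tsum_le_tsum fun S => ?_
        have : ∑ j, ∑ p ∈ F j, (if p ∈ S ∧ p - κ j ∈ S then h S else 0)
            = ((∑ j, ((F j).filter (fun p => p ∈ S ∧ p - κ j ∈ S)).card : ℕ) : ℝ≥0∞) * h S := by
          rw [Nat.cast_sum, Finset.sum_mul]
          refine Finset.sum_congr rfl fun j _ => ?_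
          rw [← Finset.sum_filter, Finset.sum_const, nsmul_eq_mul]
        rw [this]
        gcongr
        exact_mod_cast hG S

open Classical in
-- The one-pair bound used twice; monotonicity of `G` moves the factor from the first application to
-- the larger set before the second.
theorem sum_tsum_pairSum_pairSum_le
    (hG : ∀ S, ∑ j, ((F j).filter (fun p => p ∈ S ∧ p - κ j ∈ S)).card ≤ G S)
    (hGm : Monotone G) (h : Finset Mom → ℝ≥0∞) :
    ∑ i, ∑ j, ∑' S, pairSum (F i) (κ i) (pairSum (F j) (κ j) h) S
      ≤ ∑' S, (G S : ℝ≥0∞) ^ 2 * h S := by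
  rw [Finset.sum_comm]
  calc ∑ j, ∑ i, ∑' S, pairSum (F i) (κ i) (pairSum (F j) (κ j) h) S
      ≤ ∑ j, ∑' S, (G S : ℝ≥0∞) * pairSum (F j) (κ j) h S :=
        Finset.sum_le_sum fun j _ => sum_tsum_pairSum_le hG _
    _ ≤ ∑ j, ∑' S, pairSum (F j) (κ j) (fun S => (G S : ℝ≥0∞) * h S) S := by
        refine Finset.sum_le_sum fun j _ => ENNReal.tsum_le_tsum fun S => ?_
        rw [pairSum, pairSum, Finset.mul_sum]
        refine Finset.sum_le_sum fun p _ => ?_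
        split_ifs
        · gcongr
          exact hGm (subset_addPair _ _ _)
        · simp
    _ ≤ ∑' S, (G S : ℝ≥0∞) * ((G S : ℝ≥0∞) * h S) := sum_tsum_pairSum_le hG _
    _ = _ := by
        refine tsum_congr fun S => ?_
        rw [pow_two, mul_assoc]

end family

theorem ofReal_pairSum {F : Finset Mom} {k : Mom} {h : Finset Mom → ℝ} (hh : ∀ S, 0 ≤ h S)
    (S : Finset Mom) :
    ENNReal.ofReal (pairSum F k h S) = pairSum F k (fun S => ENNReal.ofReal (h S)) S := by
  classical
  rw [pairSum, pairSum, ENNReal.ofReal_sum_of_nonneg]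
  · refine Finset.sum_congr rfl fun p _ => ?_
    split_ifs <;> simp
  · intro p _
    split_ifs
    · exact hh _
    · exact le_rfl

theorem pairSum_nonneg {F : Finset Mom} {k : Mom} {h : Finset Mom → ℝ} (hh : ∀ S, 0 ≤ h S)
    (S : Finset Mom) : 0 ≤ pairSum F k h S := by
  classical
  refine Finset.sum_nonneg fun p _ => ?_
  split_ifs
  · exact hh _
  · exact le_rfl

/-- The sum over all ways of adding a pair from `F`, divided by `|F|^{1/2}`. -/
def pairAvg (F : Finset Mom) (k : Mom) (h : Finset Mom → ℝ) (S : Finset Mom) : ℝ :=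
  (√(F.card : ℝ))⁻¹ * pairSum F k h S

theorem pairAvg_nonneg {F : Finset Mom} {k : Mom} {h : Finset Mom → ℝ} (hh : ∀ S, 0 ≤ h S)
    (S : Finset Mom) : 0 ≤ pairAvg F k h S :=
  mul_nonneg (inv_nonneg.mpr (Real.sqrt_nonneg _)) (pairSum_nonneg hh S)

/-- Cauchy-Schwarz: the number of terms cancels the normalization. For empty `F` both sides vanish,
the inverse of `0` being `0`. -/
theorem pairAvg_sq_le (F : Finset Mom) (k : Mom) (h : Finset Mom → ℝ) (S : Finset Mom) :
    pairAvg F k h S ^ 2 ≤ pairSum F k (fun S => h S ^ 2) S := by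
  classical
  rw [pairAvg, mul_pow, inv_pow, Real.sq_sqrt (by positivity)]
  have h1 : pairSum F k h S ^ 2 ≤ F.card * pairSum F k (fun S => h S ^ 2) S := by
    rw [pairSum, pairSum]
    refine sq_sum_le_card_mul_sum_sq.trans (le_of_eq ?_)
    congr 1
    refine Finset.sum_congr rfl fun p _ => ?_
    split_ifs <;> simp
  by_cases hF : F.card = 0
  · rw [Finset.card_eq_zero] at hF
    subst hF
    simp [pairSum]
  · have hF' : (0 : ℝ) < F.card := by exact_mod_cast Nat.pos_of_ne_zero hF
    rwa [inv_mul_le_iff₀ hF']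

theorem pairAvg_pairAvg_sq_le (F F' : Finset Mom) (k k' : Mom) (h : Finset Mom → ℝ)
    (S : Finset Mom) : pairAvg F k (pairAvg F' k' h) S ^ 2
      ≤ pairSum F k (pairSum F' k' (fun S => h S ^ 2)) S := by
  classical
  refine (pairAvg_sq_le F k _ S).trans ?_
  refine Finset.sum_le_sum fun p _ => ?_
  split_ifs
  · exact pairAvg_sq_le F' k' h _
  · exact le_rfl

/-- The pair annihilation operator of the pairs `p`, `p - k`, `p ∈ F`. -/
def pairAnn (F : Finset Mom) (k : Mom) : Fock →L[ℂ] Fock :=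
  (((√(F.card : ℝ))⁻¹ : ℝ) : ℂ) • ∑ p ∈ F, ann (p - k) ∘L ann p

/-- The sign in the action of `a_{p-k} a_p`. -/
def pairSign (k p : Mom) (S : Finset Mom) : ℂ := by
  classical exact jwSign (p - k) S * jwSign p (insert (p - k) S)

theorem norm_pairSign (k p : Mom) (S : Finset Mom) : ‖pairSign k p S‖ = 1 := by
  rw [pairSign, norm_mul, norm_jwSign, norm_jwSign, one_mul]

theorem ann_apply (p : Mom) (ψ : Fock) (S : Finset Mom) : ann p ψ S = annCoeff p ψ S := rfl

open Classical in
theorem pairAnn_apply (F : Finset Mom) {k : Mom} (hk : k ≠ 0) (ψ : Fock) (S : Finset Mom) :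
    pairAnn F k ψ S = (((√(F.card : ℝ))⁻¹ : ℝ) : ℂ)
      * ∑ p ∈ F, if Free k p S then pairSign k p S * ψ (addPair k p S) else 0 := by
  have h1 : ∀ p, (ann (p - k) (ann p ψ)) S
      = if Free k p S then pairSign k p S * ψ (addPair k p S) else 0 := by
    intro p
    rw [ann_apply, annCoeff, ann_apply, annCoeff]
    have hne : p ≠ p - k := fun h => hk (by simpa using h.symm)
    have e1 : addPair k p S = insert p (insert (p - k) S) := by ext q; simp [mem_addPair]
    by_cases h1 : p - k ∈ S
    · have : ¬ Free k p S := fun h => h.1 h1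
      simp [h1, this]
    · by_cases h2 : p ∈ S
      · have : ¬ Free k p S := fun h => h.2.1 h2
        simp [h1, h2, this]
      · have : Free k p S := ⟨h1, h2, hk⟩
        have h3 : p ∉ insert (p - k) S := by simp [h2, hne]
        rw [if_neg h1, if_neg h3, if_pos this, pairSign, e1, mul_assoc]
  have h2 : pairAnn F k ψ S = (((√(F.card : ℝ))⁻¹ : ℝ) : ℂ)
      * (∑ p ∈ F, ann (p - k) (ann p ψ)) S := by
    simp only [pairAnn, smul_apply, sum_apply, ContinuousLinearMap.comp_apply]
    rfl
  rw [h2, lp.coeFn_sum, Finset.sum_apply]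
  congr 1
  exact Finset.sum_congr rfl fun p _ => h1 p

end

end RPA

namespace RPA

noncomputable section

/-! ### Commutators of weights with sums of pair operators -/

theorem norm_le_of_hasSum {f : Finset Mom → ℂ} {z : ℂ} (hf : HasSum f z) {a : Finset Mom → ℝ}
    (ha : ∀ S, ‖f S‖ ≤ a S) {B : ℝ} (hB : 0 ≤ B)
    (h : ∑' S, ENNReal.ofReal (a S) ≤ ENNReal.ofReal B) : ‖z‖ ≤ B := by
  have h1 : ‖z‖ₑ ≤ ENNReal.ofReal B := by
    rw [← hf.tsum_eq]
    refine (enorm_tsum_le_tsum_enorm).trans ((ENNReal.tsum_le_tsum fun S => ?_).trans h)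
    rw [← ofReal_norm]
    exact ENNReal.ofReal_le_ofReal (ha S)
  rw [← ofReal_norm] at h1
  exact (ENNReal.ofReal_le_ofReal_iff hB).mp h1

/-- The Cauchy-Schwarz inequality for sums over two indices. -/
theorem sum_sum_mul_le {J : Type} [Fintype J] (K z : J → J → ℝ) {B : ℝ} (hB : 0 ≤ B)
    (hK : ∑ i, ∑ j, K i j ^ 2 ≤ B ^ 2) :
    ∑ i, ∑ j, K i j * z i j ≤ B * √(∑ i, ∑ j, z i j ^ 2) := by
  rw [← Fintype.sum_prod_type' (f := fun i j => K i j * z i j),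
    ← Fintype.sum_prod_type' (f := fun i j => z i j ^ 2)]
  rw [← Fintype.sum_prod_type' (f := fun i j => K i j ^ 2)] at hK
  refine (Real.sum_mul_le_sqrt_mul_sqrt _ _ _).trans ?_
  refine mul_le_mul_of_nonneg_right ?_ (Real.sqrt_nonneg _)
  rw [Real.sqrt_le_left hB]
  exact hK

section family

variable {J : Type} [Fintype J] {F : J → Finset Mom} {κ : J → Mom} {G : Finset Mom → ℕ}
  {w : Finset Mom → ℝ} {C : ℝ}

/-- The coefficient at `S` collects values of `ψ` on sets `S'` with four more elements, multiplied
by `w S' - w S`. The hypothesis splits this difference symmetrically into `√(w S) √(w S')` and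
supplies the `1 / (G + 1)` that later absorbs the two pair counts. -/
theorem norm_comm_apply_le {F F' : Finset Mom} {k k' : Mom} (hk : k ≠ 0) (hk' : k' ≠ 0)
    (hw : ∃ M, ∀ S, |w S| ≤ M)
    (hwG : ∀ S S', S ⊆ S' → S'.card = S.card + 4 →
      |w S' - w S| * (G S' + 1) ≤ C * (√(w S) * √(w S'))) (ψ : Fock) (S : Finset Mom) :
    ‖pairAnn F k (pairAnn F' k' (diagOp w hw ψ)) S - w S * pairAnn F k (pairAnn F' k' ψ) S‖
      ≤ C * √(w S) * pairAvg F k (pairAvg F' k' fun S => √(w S) * ‖ψ S‖ / (G S + 1)) S := by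
  classical
  set y : Finset Mom → ℝ := fun S => √(w S) * ‖ψ S‖ / (G S + 1) with hy
  have hmain : ∀ p, Free k p S →
      ‖pairAnn F' k' (diagOp w hw ψ) (addPair k p S) - w S * pairAnn F' k' ψ (addPair k p S)‖
        ≤ C * √(w S) * pairAvg F' k' y (addPair k p S) := by
    intro p hp
    rw [pairAnn_apply F' hk', pairAnn_apply F' hk', mul_left_comm, ← mul_sub, norm_mul,
      Complex.norm_real, Real.norm_of_nonneg (by positivity), pairAvg, mul_left_comm,
      Finset.mul_sum, ← Finset.sum_sub_distrib, pairSum, Finset.mul_sum]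
    gcongr
    refine (norm_sum_le _ _).trans (Finset.sum_le_sum fun q _ => ?_)
    split_ifs with hq
    · set S₁ := addPair k p S with hS₁
      set S₂ := addPair k' q S₁ with hS₂
      have hsub : S ⊆ S₂ := (subset_addPair k p S).trans (subset_addPair k' q S₁)
      have hcard : S₂.card = S.card + 4 := by
        rw [hS₂, card_addPair hq, hS₁, card_addPair hp]
      have h1 := hwG S S₂ hsub hcard
      have h2 : pairSign k' q S₁ * diagOp w hw ψ S₂ - w S * (pairSign k' q S₁ * ψ S₂)
          = pairSign k' q S₁ * (((w S₂ - w S : ℝ) : ℂ) * ψ S₂) := by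
        rw [diagOp_apply]; push_cast; ring
      rw [h2, norm_mul, norm_pairSign, one_mul, norm_mul, Complex.norm_real, Real.norm_eq_abs, hy]
      have hg : (0 : ℝ) < G S₂ + 1 := by positivity
      rw [← le_div_iff₀ hg] at h1
      refine (mul_le_mul_of_nonneg_right h1 (norm_nonneg _)).trans (le_of_eq ?_)
      ring
    · simp
  rw [pairAnn_apply F hk, pairAnn_apply F hk, mul_left_comm, ← mul_sub, norm_mul,
    Complex.norm_real, Real.norm_of_nonneg (by positivity), pairAvg, mul_left_comm,
    Finset.mul_sum, ← Finset.sum_sub_distrib, pairSum, Finset.mul_sum]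
  gcongr
  refine (norm_sum_le _ _).trans (Finset.sum_le_sum fun p _ => ?_)
  split_ifs with hp
  · rw [mul_left_comm, ← mul_sub, norm_mul, norm_pairSign, one_mul]
    exact hmain p hp
  · simp

theorem sum_ofReal_form (hw : ∃ M, ∀ S, |w S| ≤ M) (hw0 : ∀ S, 0 ≤ w S) (ψ : Fock) :
    ∑' S, ENNReal.ofReal (w S * ‖ψ S‖ ^ 2)
      = ENNReal.ofReal (RCLike.re (inner ℂ ψ (diagOp w hw ψ))) ∧
    0 ≤ RCLike.re (inner ℂ ψ (diagOp w hw ψ)) := by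
  have h := hasSum_inner_diagOp w hw ψ
  have h0 : ∀ S, 0 ≤ w S * ‖ψ S‖ ^ 2 := fun S => mul_nonneg (hw0 S) (by positivity)
  rw [← h.tsum_eq]
  exact ⟨(ENNReal.ofReal_tsum_of_nonneg h0 h.summable).symm, tsum_nonneg h0⟩

theorem hasSum_sum_mul_inner (L : J → J → ℂ) (φ φ' : J → J → Fock) :
    HasSum (fun S => ∑ i, ∑ j, L i j * inner ℂ (φ i j S) (φ' i j S))
      (∑ i, ∑ j, L i j * inner ℂ (φ i j) (φ' i j)) := by
  refine hasSum_sum fun i _ => hasSum_sum fun j _ => ?_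
  have h : HasSum (fun S => inner ℂ (φ i j S) (φ' i j S)) (inner ℂ (φ i j) (φ' i j)) :=
    lp.hasSum_inner _ _
  exact h.mul_left (L i j)

open Classical in
/-- The commutator of a slowly varying weight with a sum of products of two pair operators. -/
theorem norm_sum_comm_le (hκ : ∀ j, κ j ≠ 0)
    (hG : ∀ S, ∑ j, ((F j).filter (fun p => p ∈ S ∧ p - κ j ∈ S)).card ≤ G S) (hGm : Monotone G)
    (hw : ∃ M, ∀ S, |w S| ≤ M) (hw0 : ∀ S, 0 ≤ w S) (hC : 0 ≤ C)
    (hwG : ∀ S S', S ⊆ S' → S'.card = S.card + 4 →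
      |w S' - w S| * (G S' + 1) ≤ C * (√(w S) * √(w S')))
    (K : J → J → ℝ) {B : ℝ} (hB : 0 ≤ B) (hK : ∑ i, ∑ j, K i j ^ 2 ≤ B ^ 2) (ψ : Fock) :
    ‖∑ i, ∑ j, (K i j : ℂ) * inner ℂ
      (pairAnn (F i) (κ i) (pairAnn (F j) (κ j) (diagOp w hw ψ))
        - diagOp w hw (pairAnn (F i) (κ i) (pairAnn (F j) (κ j) ψ))) ψ‖
      ≤ C * B * RCLike.re (inner ℂ ψ (diagOp w hw ψ)) := by
  obtain ⟨hf1, hf0⟩ := sum_ofReal_form hw hw0 ψ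
  set f₀ := RCLike.re (inner ℂ ψ (diagOp w hw ψ)) with hf₀
  set y : Finset Mom → ℝ := fun S => √(w S) * ‖ψ S‖ / (G S + 1) with hy
  have hy0 : ∀ S, 0 ≤ y S := fun S => by positivity
  set x : J → J → Finset Mom → ℝ := fun i j S =>
    pairAvg (F i) (κ i) (pairAvg (F j) (κ j) y) S with hx
  set ℓ : Finset Mom → ℝ := fun S =>
    ∑ i, ∑ j, pairSum (F i) (κ i) (pairSum (F j) (κ j) fun S => y S ^ 2) S with hℓ
  have hys0 : ∀ S, 0 ≤ y S ^ 2 := fun S => sq_nonneg _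
  have hℓ0 : ∀ S, 0 ≤ ℓ S := fun S => Finset.sum_nonneg fun i _ => Finset.sum_nonneg fun j _ =>
    pairSum_nonneg (pairSum_nonneg hys0) S
  set A : J → J → Fock := fun i j => pairAnn (F i) (κ i) (pairAnn (F j) (κ j) (diagOp w hw ψ))
        - diagOp w hw (pairAnn (F i) (κ i) (pairAnn (F j) (κ j) ψ)) with hA
  have hsum : HasSum (fun S => ∑ i, ∑ j, (K i j : ℂ) * inner ℂ (A i j S) (ψ S))
      (∑ i, ∑ j, (K i j : ℂ) * inner ℂ (A i j) ψ) :=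
    hasSum_sum_mul_inner (fun i j => (K i j : ℂ)) A fun _ _ => ψ
  refine norm_le_of_hasSum hsum (a := fun S => C * B / 2 * (w S * ‖ψ S‖ ^ 2 + ℓ S)) ?_
    (by positivity) ?_
  · intro S
    have h1 : ∀ i j, ‖(K i j : ℂ) * inner ℂ (A i j S) (ψ S)‖
        ≤ C * (√(w S) * ‖ψ S‖) * (|K i j| * x i j S) := by
      intro i j
      have h2 : ‖A i j S‖ ≤ C * √(w S) * x i j S :=
        norm_comm_apply_le (hκ i) (hκ j) hw hwG ψ S
      rw [norm_mul, Complex.norm_real, Real.norm_eq_abs]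
      have h3 := (norm_inner_le_norm (𝕜 := ℂ) (A i j S) (ψ S)).trans
        (mul_le_mul_of_nonneg_right h2 (norm_nonneg _))
      refine (mul_le_mul_of_nonneg_left h3 (abs_nonneg _)).trans (le_of_eq ?_)
      ring
    -- Cauchy-Schwarz over the pair of indices at fixed `S`, where only the Hilbert-Schmidt norm of
    -- the kernel enters.
    have h4 : ∑ i, ∑ j, |K i j| * x i j S ≤ B * √(ℓ S) := by
      refine (sum_sum_mul_le (fun i j => |K i j|) (fun i j => x i j S) hB ?_).trans ?_
      · simpa only [sq_abs] using hK
      · gcongr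
        refine Finset.sum_le_sum fun i _ => Finset.sum_le_sum fun j _ => ?_
        exact pairAvg_pairAvg_sq_le _ _ _ _ _ _
    have h5 : √(w S) ^ 2 = w S := Real.sq_sqrt (hw0 S)
    have h6 : √(ℓ S) ^ 2 = ℓ S := Real.sq_sqrt (hℓ0 S)
    calc ‖∑ i, ∑ j, (K i j : ℂ) * inner ℂ (A i j S) (ψ S)‖
        ≤ ∑ i, ∑ j, C * (√(w S) * ‖ψ S‖) * (|K i j| * x i j S) :=
          (norm_sum_le _ _).trans (Finset.sum_le_sum fun i _ =>
            (norm_sum_le _ _).trans (Finset.sum_le_sum fun j _ => h1 i j))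
      _ = C * (√(w S) * ‖ψ S‖) * ∑ i, ∑ j, |K i j| * x i j S := by
          simp only [Finset.mul_sum]
      _ ≤ C * (√(w S) * ‖ψ S‖) * (B * √(ℓ S)) := by gcongr
      _ = C * B * ((√(w S) * ‖ψ S‖) * √(ℓ S)) := by ring
      _ ≤ C * B * ((w S * ‖ψ S‖ ^ 2 + ℓ S) / 2) := by
          gcongr
          nlinarith [sq_nonneg (√(w S) * ‖ψ S‖ - √(ℓ S))]
      _ = _ := by ring
  -- Summing over `S` costs `G²`, which the `(G + 1)⁻²` contained in `y²` compensates.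
  · have h7 : ∑' S, ENNReal.ofReal (ℓ S) ≤ ENNReal.ofReal f₀ := by
      have e1 : ∀ S, ENNReal.ofReal (ℓ S) = ∑ i, ∑ j,
          pairSum (F i) (κ i) (pairSum (F j) (κ j) fun S => ENNReal.ofReal (y S ^ 2)) S := by
        intro S
        rw [hℓ, ENNReal.ofReal_sum_of_nonneg fun i _ => Finset.sum_nonneg fun j _ =>
          pairSum_nonneg (pairSum_nonneg hys0) S]
        refine Finset.sum_congr rfl fun i _ => ?_
        rw [ENNReal.ofReal_sum_of_nonneg fun j _ => pairSum_nonneg (pairSum_nonneg hys0) S]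
        refine Finset.sum_congr rfl fun j _ => ?_
        rw [ofReal_pairSum (pairSum_nonneg hys0)]
        congr 1
        funext S'
        exact ofReal_pairSum hys0 S'
      rw [tsum_congr e1, Summable.tsum_finsetSum fun _ _ => ENNReal.summable,
        Finset.sum_congr rfl fun i _ => Summable.tsum_finsetSum fun _ _ => ENNReal.summable]
      refine (sum_tsum_pairSum_pairSum_le hG hGm _).trans ?_
      rw [← hf1]
      refine ENNReal.tsum_le_tsum fun S => ?_
      rw [← ENNReal.ofReal_natCast, ← ENNReal.ofReal_pow (by positivity),
        ← ENNReal.ofReal_mul (by positivity)]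
      refine ENNReal.ofReal_le_ofReal ?_
      rw [hy]
      have h8 : (√(w S) * ‖ψ S‖ / (G S + 1)) ^ 2 = w S * ‖ψ S‖ ^ 2 / ((G S : ℝ) + 1) ^ 2 := by
        rw [div_pow, mul_pow, Real.sq_sqrt (hw0 S)]
      rw [h8, mul_div_assoc', div_le_iff₀ (by positivity), mul_comm]
      have := hw0 S
      gcongr
      linarith
    simp only [ENNReal.ofReal_mul (by positivity : 0 ≤ C * B / 2)]
    rw [ENNReal.tsum_mul_left, tsum_congr fun S => ENNReal.ofReal_add
      (mul_nonneg (hw0 S) (by positivity)) (hℓ0 S), ENNReal.tsum_add, hf1]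
    calc ENNReal.ofReal (C * B / 2) * (ENNReal.ofReal f₀ + ∑' S, ENNReal.ofReal (ℓ S))
        ≤ ENNReal.ofReal (C * B / 2) * (ENNReal.ofReal f₀ + ENNReal.ofReal f₀) := by gcongr
      _ = ENNReal.ofReal (C * B * f₀) := by
          rw [← ENNReal.ofReal_add hf0 hf0, ← ENNReal.ofReal_mul (by positivity)]
          congr 1; ring

open Classical in
/-- The commutator of a weight with a sum of operators that move one pair. -/
theorem norm_sum_comm_move_le (hκ : ∀ j, κ j ≠ 0)
    (hG : ∀ S, ∑ j, ((F j).filter (fun p => p ∈ S ∧ p - κ j ∈ S)).card ≤ G S) (hGm : Monotone G)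
    (hG2 : ∀ S S', S ⊆ S' → S'.card = S.card + 2 → G S' ≤ G S + 2)
    {h : ℕ → ℝ} (hh : ∀ m, 0 ≤ h m) (hwh : ∀ S, w S = G S * h S.card)
    (hw : ∃ M, ∀ S, |w S| ≤ M)
    (L : J → J → ℂ) {B : ℝ} (hB : 0 ≤ B) (hL : ∑ i, ∑ j, ‖L i j‖ ^ 2 ≤ B ^ 2) (ψ : Fock) :
    ‖∑ i, ∑ j, L i j *
      (inner ℂ (pairAnn (F i) (κ i) (diagOp w hw ψ)) (pairAnn (F j) (κ j) ψ)
        - inner ℂ (pairAnn (F i) (κ i) ψ) (pairAnn (F j) (κ j) (diagOp w hw ψ)))‖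
      ≤ 2 * B * RCLike.re (inner ℂ ψ (diagOp w hw ψ)) := by
  have hw0 : ∀ S, 0 ≤ w S := fun S => by
    rw [hwh]; exact mul_nonneg (by positivity) (hh _)
  obtain ⟨hf1, hf0⟩ := sum_ofReal_form hw hw0 ψ
  set f₀ := RCLike.re (inner ℂ ψ (diagOp w hw ψ)) with hf₀
  set y : Finset Mom → ℝ := fun S => √(h S.card) * ‖ψ S‖ with hy
  have hy0 : ∀ S, 0 ≤ y S := fun S => by positivity
  have hys0 : ∀ S, 0 ≤ y S ^ 2 := fun S => sq_nonneg _
  set x : J → Finset Mom → ℝ := fun j S => pairAvg (F j) (κ j) y S with hx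
  have hx0 : ∀ j S, 0 ≤ x j S := fun j S => pairAvg_nonneg hy0 S
  set ℓ : Finset Mom → ℝ := fun S => ∑ j, pairSum (F j) (κ j) (fun S => y S ^ 2) S with hℓ
  have hℓ0 : ∀ S, 0 ≤ ℓ S := fun S => Finset.sum_nonneg fun j _ => pairSum_nonneg hys0 S
  set c : J → Fock → Fock := fun j φ => pairAnn (F j) (κ j) φ with hc
  set D : Fock → Fock := fun φ => diagOp w hw φ with hD
  have hsum : HasSum (fun S => ∑ i, ∑ j, L i j * (inner ℂ (c i (D ψ) S) (c j ψ S)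
        - inner ℂ (c i ψ S) (c j (D ψ) S)))
      (∑ i, ∑ j, L i j * (inner ℂ (c i (D ψ)) (c j ψ) - inner ℂ (c i ψ) (c j (D ψ)))) :=
    by
    have h1 := hasSum_sum_mul_inner L (fun i _ => c i (D ψ)) fun _ j => c j ψ
    have h2 := hasSum_sum_mul_inner L (fun i _ => c i ψ) fun _ j => c j (D ψ)
    have h3 := h1.sub h2
    simp only [← Finset.sum_sub_distrib, ← mul_sub] at h3
    exact h3
  refine norm_le_of_hasSum hsum (a := fun S => 2 * B * ℓ S) ?_ (by positivity) ?_
  · intro S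
    have h1 : ∀ i j, ‖inner ℂ (c i (D ψ) S) (c j ψ S) - inner ℂ (c i ψ S) (c j (D ψ) S)‖
        ≤ 2 * (x i S * x j S) := by
      intro i j
      set ni := (√((F i).card : ℝ))⁻¹ with hni
      set nj := (√((F j).card : ℝ))⁻¹ with hnj
      have hni0 : 0 ≤ ni := by positivity
      have hnj0 : 0 ≤ nj := by positivity
      have e1 : inner ℂ (c i (D ψ) S) (c j ψ S) - inner ℂ (c i ψ S) (c j (D ψ) S)
          = (ni : ℂ) * nj * ∑ p ∈ F i, ∑ q ∈ F j,
            if Free (κ i) p S then if Free (κ j) q S then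
              (((w (addPair (κ i) p S) - w (addPair (κ j) q S) : ℝ)) : ℂ)
                * ((starRingEnd ℂ) (pairSign (κ i) p S * ψ (addPair (κ i) p S))
                  * (pairSign (κ j) q S * ψ (addPair (κ j) q S))) else 0 else 0 := by
        simp only [hc, hD, RCLike.inner_apply]
        rw [pairAnn_apply _ (hκ i), pairAnn_apply _ (hκ j), pairAnn_apply _ (hκ i),
          pairAnn_apply _ (hκ j)]
        simp only [map_mul, Complex.conj_ofReal, map_sum, ← hni, ← hnj]
        have e2 : ∀ a b a' b' : ℂ, (nj : ℂ) * a * (ni * b) - nj * a' * (ni * b')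
            = ni * nj * (b * a - b' * a') := fun a b a' b' => by ring
        rw [e2, Finset.sum_mul_sum, Finset.sum_mul_sum, ← Finset.sum_sub_distrib]
        congr 1
        refine Finset.sum_congr rfl fun p _ => ?_
        rw [← Finset.sum_sub_distrib]
        refine Finset.sum_congr rfl fun q _ => ?_
        split_ifs
        · simp only [diagOp_apply, map_mul, Complex.conj_ofReal]
          push_cast
          ring
        · simp
        · simp
        · simp
      rw [e1, norm_mul, norm_mul, Complex.norm_real, Complex.norm_real,
        Real.norm_of_nonneg hni0, Real.norm_of_nonneg hnj0]
      have e3 : x i S * x j S = ni * nj * ∑ p ∈ F i, ∑ q ∈ F j,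
          if Free (κ i) p S then if Free (κ j) q S then
            y (addPair (κ i) p S) * y (addPair (κ j) q S) else 0 else 0 := by
        simp only [hx, pairAvg, pairSum, ← hni, ← hnj]
        have e2 : ∀ a b : ℝ, ni * a * (nj * b) = ni * nj * (a * b) := fun a b => by ring
        rw [e2, Finset.sum_mul_sum]
        congr 1
        refine Finset.sum_congr rfl fun p _ => Finset.sum_congr rfl fun q _ => ?_
        split_ifs <;> simp
      rw [e3, mul_left_comm]
      refine mul_le_mul_of_nonneg_left ?_ (mul_nonneg hni0 hnj0)
      rw [Finset.mul_sum]
      refine (norm_sum_le _ _).trans (Finset.sum_le_sum fun p _ => ?_)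
      rw [Finset.mul_sum]
      refine (norm_sum_le _ _).trans (Finset.sum_le_sum fun q _ => ?_)
      split_ifs with hp hq
      · set S₁ := addPair (κ i) p S with hS₁
        set S₂ := addPair (κ j) q S with hS₂
        have hc1 : S₁.card = S.card + 2 := card_addPair hp
        have hc2 : S₂.card = S.card + 2 := card_addPair hq
        have g1 : (G S₁ : ℝ) ≤ G S + 2 := by
          exact_mod_cast hG2 S S₁ (subset_addPair _ _ _) hc1
        have g2 : (G S₂ : ℝ) ≤ G S + 2 := by
          exact_mod_cast hG2 S S₂ (subset_addPair _ _ _) hc2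
        have g3 : (G S : ℝ) ≤ G S₁ := by exact_mod_cast hGm (subset_addPair _ _ _)
        have g4 : (G S : ℝ) ≤ G S₂ := by exact_mod_cast hGm (subset_addPair _ _ _)
        have e4 : w S₁ - w S₂ = (G S₁ - G S₂) * h (S.card + 2) := by
          rw [hwh, hwh, hc1, hc2]; ring
        -- Both sets arise from `S` by adding one pair: they have the same cardinality, and `G` lies
        -- in `[G S, G S + 2]` for both. The difference thus loses the factor `G`, which the single
        -- pair count restores.
        have e5 : |w S₁ - w S₂| ≤ 2 * h (S.card + 2) := by
          rw [e4, abs_mul, abs_of_nonneg (hh _)]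
          refine mul_le_mul_of_nonneg_right ?_ (hh _)
          rw [abs_le]; constructor <;> linarith
        have e6 : y S₁ * y S₂ = h (S.card + 2) * (‖ψ S₁‖ * ‖ψ S₂‖) := by
          simp only [hy, hc1, hc2]
          have := Real.mul_self_sqrt (hh (S.card + 2))
          linear_combination (‖ψ S₁‖ * ‖ψ S₂‖) * this
        rw [norm_mul, Complex.norm_real, Real.norm_eq_abs, norm_mul, RCLike.norm_conj, norm_mul,
          norm_mul, norm_pairSign, norm_pairSign, one_mul, one_mul, e6, ← mul_assoc 2]
        exact mul_le_mul_of_nonneg_right e5 (by positivity)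
      · simp
      · simp
    -- The second factor in Cauchy-Schwarz is the rank-one matrix `x i x j`, with Hilbert-Schmidt
    -- norm `∑ x i²`.
    have h2 : ∑ i, ∑ j, ‖L i j‖ * (x i S * x j S) ≤ B * ℓ S := by
      refine (sum_sum_mul_le (fun i j => ‖L i j‖) (fun i j => x i S * x j S) hB hL).trans ?_
      gcongr
      rw [Real.sqrt_le_left (hℓ0 S)]
      have e7 : ∑ i, ∑ j, (x i S * x j S) ^ 2 = (∑ i, x i S ^ 2) ^ 2 := by
        simp only [mul_pow]
        rw [pow_two (∑ i, x i S ^ 2), Finset.sum_mul_sum]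
      rw [e7]
      refine pow_le_pow_left₀ (Finset.sum_nonneg fun i _ => sq_nonneg _) ?_ 2
      exact Finset.sum_le_sum fun i _ => pairAvg_sq_le _ _ _ _
    calc ‖∑ i, ∑ j, L i j * (inner ℂ (c i (D ψ) S) (c j ψ S)
          - inner ℂ (c i ψ S) (c j (D ψ) S))‖
        ≤ ∑ i, ∑ j, 2 * (‖L i j‖ * (x i S * x j S)) := by
          refine (norm_sum_le _ _).trans (Finset.sum_le_sum fun i _ =>
            (norm_sum_le _ _).trans (Finset.sum_le_sum fun j _ => ?_))
          rw [norm_mul]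
          have := mul_le_mul_of_nonneg_left (h1 i j) (norm_nonneg (L i j))
          linarith
      _ = 2 * ∑ i, ∑ j, ‖L i j‖ * (x i S * x j S) := by simp only [Finset.mul_sum]
      _ ≤ 2 * (B * ℓ S) := by gcongr
      _ = 2 * B * ℓ S := by ring
  · have h7 : ∑' S, ENNReal.ofReal (ℓ S) ≤ ENNReal.ofReal f₀ := by
      have e1 : ∀ S, ENNReal.ofReal (ℓ S) = ∑ j,
          pairSum (F j) (κ j) (fun S => ENNReal.ofReal (y S ^ 2)) S := by
        intro S
        rw [hℓ, ENNReal.ofReal_sum_of_nonneg fun j _ => pairSum_nonneg hys0 S]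
        exact Finset.sum_congr rfl fun j _ => ofReal_pairSum hys0 S
      rw [tsum_congr e1, Summable.tsum_finsetSum fun _ _ => ENNReal.summable]
      refine (sum_tsum_pairSum_le hG _).trans (le_of_eq ?_)
      rw [← hf1]
      refine tsum_congr fun S => ?_
      rw [← ENNReal.ofReal_natCast, ← ENNReal.ofReal_mul (by positivity)]
      congr 1
      simp only [hy]
      rw [mul_pow, Real.sq_sqrt (hh _), hwh]
      ring
    simp only [ENNReal.ofReal_mul (by positivity : 0 ≤ 2 * B)]
    rw [ENNReal.tsum_mul_left]
    gcongr

end family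

end

end RPA

namespace RPA

noncomputable section

/-! ### The multipliers of the number operators -/

theorem nTot_eq_card (S : Finset Mom) : nTot S = S.card := by
  simp [nTot, cnt]

theorem nGap_mono (kF δ θ : ℝ) : Monotone (nGap kF δ θ) := fun _ _ h => by
  classical
  exact Finset.card_le_card (Finset.filter_subset_filter _ h)

theorem nGap_le_card (kF δ θ : ℝ) (S : Finset Mom) : nGap kF δ θ S ≤ S.card := by
  classical
  exact Finset.card_filter_le _ _

theorem nGap_le_add (kF δ θ : ℝ) {S S' : Finset Mom} (h : S ⊆ S') {j : ℕ}
    (hj : S'.card = S.card + j) : nGap kF δ θ S' ≤ nGap kF δ θ S + j := by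
  classical
  have h1 : (S' \ S).card = j := by
    rw [Finset.card_sdiff_of_subset h, hj, Nat.add_sub_cancel_left]
  rw [← h1]
  unfold nGap cnt
  conv_lhs => rw [← Finset.union_sdiff_of_subset h, Finset.filter_union]
  refine (Finset.card_union_le _ _).trans ?_
  gcongr
  exact Finset.filter_subset _ _

/-! ### Growth of the weights when four particles are added -/

theorem mul_pow_sub_pow_le {x y : ℝ} (hy : 0 ≤ y) (hxy : y ≤ x) (m : ℕ) :
    x * (x ^ m - y ^ m) ≤ m * x ^ m * (x - y) := by
  have hx : 0 ≤ x := hy.trans hxy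
  induction m with
  | zero => simp
  | succ m ih =>
    have h1 : x * (x ^ (m + 1) - y ^ (m + 1))
        = x ^ (m + 1) * (x - y) + y * (x * (x ^ m - y ^ m)) := by ring
    have h2 : y * (x * (x ^ m - y ^ m)) ≤ x * (m * x ^ m * (x - y)) :=
      (mul_le_mul_of_nonneg_left ih hy).trans
        (mul_le_mul_of_nonneg_right hxy
          (mul_nonneg (by positivity) (sub_nonneg.mpr hxy)))
    rw [h1]
    push_cast
    calc x ^ (m + 1) * (x - y) + y * (x * (x ^ m - y ^ m))
        ≤ x ^ (m + 1) * (x - y) + x * (m * x ^ m * (x - y)) := by linarith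
      _ = _ := by ring

theorem mul_add_four_pow_sub_le {a : ℝ} (ha : 1 ≤ a) (m : ℕ) :
    (a + 4) * ((a + 4) ^ m - a ^ m) ≤ 4 * m * 5 ^ m * a ^ m := by
  have h1 := mul_pow_sub_pow_le (by linarith : 0 ≤ a) (by linarith : a ≤ a + 4) m
  have h2 : (a + 4) ^ m ≤ 5 ^ m * a ^ m := by
    rw [← mul_pow]
    exact pow_le_pow_left₀ (by linarith) (by linarith) m
  calc (a + 4) * ((a + 4) ^ m - a ^ m) ≤ m * (a + 4) ^ m * (a + 4 - a) := h1
    _ = 4 * m * (a + 4) ^ m := by ring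
    _ ≤ 4 * m * (5 ^ m * a ^ m) := by gcongr
    _ = _ := by ring

/-- The increment of the `m`-th power is smaller than the power by a factor of order `1 / |S|`, and
`nGap ≤ |S|`. The summand `20` only serves to share the constant with `gapped_weight_growth`. -/
theorem number_weight_growth (kF δ θ : ℝ) (m : ℕ) {S S' : Finset Mom}
    (hj : S'.card = S.card + 4) :
    ((((nTot S' + 1) ^ m : ℕ) : ℝ) - ((nTot S + 1) ^ m : ℕ)) * (nGap kF δ θ S' + 1)
      ≤ (20 + 4 * m) * 5 ^ m * ((nTot S + 1) ^ m : ℕ) := by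
  have h1 : (nGap kF δ θ S' : ℝ) ≤ S'.card := by exact_mod_cast nGap_le_card kF δ θ S'
  rw [hj] at h1
  push_cast at h1
  simp only [nTot_eq_card, hj]
  push_cast
  set a : ℝ := S.card + 1 with ha
  have ha1 : 1 ≤ a := by rw [ha]; linarith [Nat.cast_nonneg (α := ℝ) S.card]
  have e : (S.card : ℝ) + 4 + 1 = a + 4 := by rw [ha]; ring
  rw [e]
  have h2 : a ^ m ≤ (a + 4) ^ m := pow_le_pow_left₀ (by linarith) (by linarith) m
  have h3 : ((a + 4) ^ m - a ^ m) * (nGap kF δ θ S' + 1) ≤ ((a + 4) ^ m - a ^ m) * (a + 4) :=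
    mul_le_mul_of_nonneg_left (by rw [ha]; linarith) (by linarith)
  have h4 := mul_add_four_pow_sub_le ha1 m
  have h5 : 0 ≤ 20 * (5 : ℝ) ^ m * a ^ m := by positivity
  nlinarith [h3, h4, h5]

/-- Product rule for increments: when `nGap` grows, by at most `4`, the extra factor is at most `5
(nGap S + 1)`, which gives the `20`; when the power grows, the extra factor is at most the particle
number. -/
theorem gapped_weight_growth (kF δ θ : ℝ) (m : ℕ) {S S' : Finset Mom} (h : S ⊆ S')
    (hj : S'.card = S.card + 4) :
    ((((nGap kF δ θ S' + 1) * (nTot S' + 1) ^ m : ℕ) : ℝ)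
        - ((nGap kF δ θ S + 1) * (nTot S + 1) ^ m : ℕ)) * (nGap kF δ θ S' + 1)
      ≤ (20 + 4 * m) * 5 ^ m * ((nGap kF δ θ S + 1) * (nTot S + 1) ^ m : ℕ) := by
  have h1 : (nGap kF δ θ S' : ℝ) ≤ S'.card := by exact_mod_cast nGap_le_card kF δ θ S'
  have h2 : (nGap kF δ θ S' : ℝ) ≤ nGap kF δ θ S + 4 := by
    exact_mod_cast nGap_le_add kF δ θ h hj
  have h3 : (nGap kF δ θ S : ℝ) ≤ nGap kF δ θ S' := by exact_mod_cast nGap_mono kF δ θ h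
  rw [hj] at h1
  push_cast at h1
  simp only [nTot_eq_card, hj]
  push_cast
  set a : ℝ := S.card + 1 with ha
  have hg0 : (0 : ℝ) ≤ nGap kF δ θ S := Nat.cast_nonneg _
  generalize (nGap kF δ θ S : ℝ) = g at *
  set b : ℝ := nGap kF δ θ S' + 1 with hb
  have ha1 : 1 ≤ a := by rw [ha]; linarith [Nat.cast_nonneg (α := ℝ) S.card]
  have e : (S.card : ℝ) + 4 + 1 = a + 4 := by rw [ha]; ring
  rw [e]
  have h4 := mul_add_four_pow_sub_le ha1 m
  have h5 : a ^ m ≤ (a + 4) ^ m := pow_le_pow_left₀ (by linarith) (by linarith) m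
  have h6 : (a + 4) ^ m ≤ 5 ^ m * a ^ m := by
    rw [← mul_pow]
    exact pow_le_pow_left₀ (by linarith) (by linarith) m
  have hb0 : 0 ≤ b := by rw [hb]; positivity
  have hba : b ≤ a + 4 := by rw [ha]; linarith
  have hb5 : b ≤ 5 * (g + 1) := by linarith
  have h7 : (b - (g + 1)) * (a + 4) ^ m * b ≤ 4 * (5 ^ m * a ^ m) * (5 * (g + 1)) := by
    gcongr
    linarith
  have h8 : (g + 1) * ((a + 4) ^ m - a ^ m) * b ≤ (g + 1) * (4 * m * 5 ^ m * a ^ m) := by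
    rw [mul_assoc]
    refine mul_le_mul_of_nonneg_left ?_ (by linarith)
    refine le_trans ?_ h4
    rw [mul_comm]
    exact mul_le_mul_of_nonneg_right hba (by linarith)
  calc (b * (a + 4) ^ m - (g + 1) * a ^ m) * b
      = (b - (g + 1)) * (a + 4) ^ m * b + (g + 1) * ((a + 4) ^ m - a ^ m) * b := by ring
    _ ≤ 4 * (5 ^ m * a ^ m) * (5 * (g + 1)) + (g + 1) * (4 * m * 5 ^ m * a ^ m) :=
        add_le_add h7 h8
    _ = _ := by ring

/-! ### Operators that conserve the particle number -/

theorem pairAnn_diagOp (F : Finset Mom) {k : Mom} (hk : k ≠ 0) (f : ℕ → ℝ)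
    (hf : ∃ M, ∀ S : Finset Mom, |f S.card| ≤ M)
    (hf2 : ∃ M, ∀ S : Finset Mom, |f (S.card + 2)| ≤ M) :
    pairAnn F k ∘L diagOp (fun S => f S.card) hf
      = diagOp (fun S => f (S.card + 2)) hf2 ∘L pairAnn F k := by
  classical
  ext ψ S
  rw [ContinuousLinearMap.comp_apply, ContinuousLinearMap.comp_apply, diagOp_apply,
    pairAnn_apply F hk, pairAnn_apply F hk, mul_left_comm]
  congr 1
  rw [Finset.mul_sum]
  refine Finset.sum_congr rfl fun p _ => ?_
  split_ifs with h
  · rw [diagOp_apply, card_addPair h, mul_left_comm]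
  · rw [mul_zero]

theorem commute_adjoint_pairAnn_mul (F F' : Finset Mom) {k k' : Mom} (hk : k ≠ 0) (hk' : k' ≠ 0)
    (f : ℕ → ℝ) (hf : ∃ M, ∀ S : Finset Mom, |f S.card| ≤ M)
    (hf2 : ∃ M, ∀ S : Finset Mom, |f (S.card + 2)| ≤ M) :
    Commute (diagOp (fun S => f S.card) hf)
      (ContinuousLinearMap.adjoint (pairAnn F k) ∘L pairAnn F' k') := by
  have h1 := congrArg ContinuousLinearMap.adjoint (pairAnn_diagOp F hk f hf hf2)
  rw [ContinuousLinearMap.adjoint_comp, ContinuousLinearMap.adjoint_comp, adjoint_diagOp,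
    adjoint_diagOp] at h1
  have h2 := pairAnn_diagOp F' hk' f hf hf2
  show diagOp _ hf ∘L (_ ∘L _) = (_ ∘L _) ∘L diagOp _ hf
  rw [← ContinuousLinearMap.comp_assoc, h1, ContinuousLinearMap.comp_assoc,
    ContinuousLinearMap.comp_assoc, h2]

/-- The projection to the sector of `j` particles. -/
def sector (j : ℕ) : Fock →L[ℂ] Fock :=
  diagOp (fun S => if S.card = j then 1 else 0) ⟨1, fun S => by split_ifs <;> simp⟩

theorem sector_apply (j : ℕ) (ψ : Fock) (S : Finset Mom) :
    sector j ψ S = if S.card = j then ψ S else 0 := by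
  rw [sector, diagOp_apply]
  split_ifs <;> simp

theorem commute_sector_adjoint_pairAnn_mul (F F' : Finset Mom) {k k' : Mom} (hk : k ≠ 0)
    (hk' : k' ≠ 0) (j : ℕ) :
    Commute (sector j) (ContinuousLinearMap.adjoint (pairAnn F k) ∘L pairAnn F' k') :=
  commute_adjoint_pairAnn_mul F F' hk hk' (fun i => if i = j then 1 else 0) _
    ⟨1, fun S => by split_ifs <;> simp⟩

/-- The coefficient of `U χ` at `S` depends only on the part of `χ` in the sector of `|S|`
particles, where `φ` is a scalar multiple of `ψ`. Working sector by sector handles unbounded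
functions of the particle number with bounded operators alone. -/
theorem apply_eq_of_commute_sector {U : Fock →L[ℂ] Fock} (hU : ∀ j, Commute (sector j) U)
    (f : ℕ → ℂ) {ψ φ : Fock} (h : ∀ S, φ S = f S.card * ψ S) (S : Finset Mom) :
    U φ S = f S.card * U ψ S := by
  have h1 : ∀ χ : Fock, U χ S = U (sector S.card χ) S := fun χ => by
    have h2 : sector S.card (U χ) S = U (sector S.card χ) S :=
      congrArg (fun T : Fock →L[ℂ] Fock => T χ S) (hU S.card)
    rw [← h2, sector_apply, if_pos rfl]
  have h3 : sector S.card φ = f S.card • sector S.card ψ := by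
    ext S'
    rw [lp.coeFn_smul, Pi.smul_apply, sector_apply, sector_apply, smul_eq_mul]
    split_ifs with h4
    · rw [h, h4]
    · rw [mul_zero]
  rw [h1 φ, h1 ψ, h3, map_smul]
  rfl

/-- Both `U` and its adjoint preserve the sectors, hence map the maximal domain into itself; that is
what makes the domains equal and not merely nested. -/
theorem conjOp_mulOp_eq {U : Fock →L[ℂ] Fock} (hU : ∀ j, Commute (sector j) U)
    (hUU : ContinuousLinearMap.adjoint U * U = 1) (f : ℕ → ℕ) :
    conjOp U (mulOp fun S => f S.card) = mulOp fun S => f S.card := by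
  have hU' : ∀ j, Commute (sector j) (ContinuousLinearMap.adjoint U) := fun j => by
    have h := congrArg ContinuousLinearMap.adjoint (hU j).eq
    rw [ContinuousLinearMap.mul_def, ContinuousLinearMap.mul_def,
      ContinuousLinearMap.adjoint_comp, ContinuousLinearMap.adjoint_comp, sector,
      adjoint_diagOp] at h
    exact h.symm
  have hUU' : ∀ ψ, ContinuousLinearMap.adjoint U (U ψ) = ψ := fun ψ =>
    congrArg (fun T : Fock →L[ℂ] Fock => T ψ) hUU
  have hdom : ∀ {W : Fock →L[ℂ] Fock}, (∀ j, Commute (sector j) W) → ∀ {ψ : Fock},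
      ψ ∈ (mulOp fun S => f S.card).domain → W ψ ∈ (mulOp fun S => f S.card).domain := by
    intro W hW ψ hψ
    have h1 := apply_eq_of_commute_sector hW (fun j => (f j : ℂ)) (ψ := ψ)
      (φ := (mulOp fun S => f S.card) ⟨ψ, hψ⟩) (fun _ => rfl)
    have h2 : (fun S => (f S.card : ℂ) * W ψ S)
        = fun S => W ((mulOp fun S => f S.card) ⟨ψ, hψ⟩) S := funext fun S => (h1 S).symm
    show Memℓp (fun S => (f S.card : ℂ) * W ψ S) 2
    rw [h2]
    exact lp.memℓp _
  refine LinearPMap.ext ?_ ?_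
  · ext ψ
    constructor
    · intro h
      have h1 := hdom hU' (ψ := U ψ) h
      rwa [hUU'] at h1
    · exact fun h => hdom hU h
  · intro ψ h h'
    have h1 : (mulOp fun S => f S.card) ⟨U ψ, hdom hU h'⟩
        = U ((mulOp fun S => f S.card) ⟨ψ, h'⟩) := by
      ext S
      exact (apply_eq_of_commute_sector hU (fun j => (f j : ℂ)) (fun _ => rfl) S).symm
    have h2 : conjOp U (mulOp fun S => f S.card) ⟨ψ, h⟩
        = ContinuousLinearMap.adjoint U ((mulOp fun S => f S.card) ⟨U ψ, hdom hU h'⟩) := rfl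
    rw [h2, h1, hUU']

end

end RPA

/-! ### Number operators along `T` and `Z`. -/

namespace RPA

noncomputable section

open scoped Matrix

theorem rclike_re_ofReal_mul (r : ℝ) (z : ℂ) :
    RCLike.re ((r : ℂ) * z) = r * RCLike.re z :=
  Complex.re_ofReal_mul r z

namespace PatchDecomposition

variable {kF R C₀ : ℝ} {n : ℕ} (P : PatchDecomposition kF R C₀ n) (Vhat : Mom → ℝ) (δ : ℝ)

theorem c_eq_pairAnn (k : Mom) (α : P.I δ k) :
    P.c δ k α = pairAnn (P.pairs (P.label δ k α) (P.signedMom δ k α)) (P.signedMom δ k α) := by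
  unfold c cStar bStar pairAnn nrm cre
  rw [map_smulₛₗ, map_sum, Complex.conj_ofReal]
  congr 1
  refine Finset.sum_congr rfl fun p _ => ?_
  rw [ContinuousLinearMap.adjoint_comp, ContinuousLinearMap.adjoint_adjoint,
    ContinuousLinearMap.adjoint_adjoint]

theorem cStar_eq_adjoint (k : Mom) (α : P.I δ k) :
    P.cStar δ k α = ContinuousLinearMap.adjoint (P.c δ k α) := by
  rw [c, ContinuousLinearMap.adjoint_adjoint]

theorem signedMom_ne_zero {k : Mom} (hk : k ≠ 0) (α : P.I δ k) : P.signedMom δ k α ≠ 0 := by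
  cases α
  · exact hk
  · exact neg_ne_zero.mpr hk

theorem adjoint_expT : ContinuousLinearMap.adjoint (P.expT Vhat δ)
    = (1 / 2 : ℂ) • ∑ k ∈ gammaNor R, ∑ β : P.I δ k, ∑ α : P.I δ k,
      (P.K Vhat δ k α β : ℂ) • (P.c δ k β ∘L P.c δ k α) := by
  unfold expT
  rw [map_smulₛₗ, map_sum]
  congr 1
  · rw [map_div₀, map_one, map_ofNat]
  · refine Finset.sum_congr rfl fun k _ => ?_
    rw [Finset.sum_comm]
    simp only [map_sum, map_smulₛₗ, ContinuousLinearMap.adjoint_comp, Complex.conj_ofReal]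
    rfl

theorem adjoint_expZ (t : ℝ) (hL : ∀ k ∈ gammaNor R, (P.L Vhat δ k t)ᴴ = -P.L Vhat δ k t) :
    ContinuousLinearMap.adjoint (P.expZ Vhat δ t) = -P.expZ Vhat δ t := by
  unfold expZ
  rw [map_sum, ← Finset.sum_neg_distrib]
  refine Finset.sum_congr rfl fun k hk => ?_
  have h1 : ∀ α β, (starRingEnd ℂ) (P.L Vhat δ k t α β) = -P.L Vhat δ k t β α := fun α β =>
    congrFun (congrFun (hL k hk) β) α
  simp only [cStar_eq_adjoint, map_sum, map_smulₛₗ, ContinuousLinearMap.adjoint_comp,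
    ContinuousLinearMap.adjoint_adjoint, h1, neg_smul, Finset.sum_neg_distrib]
  rw [Finset.sum_comm]

variable {P Vhat δ}

/-- The exponent is a difference of an operator and its adjoint, so taking real parts reduces the
commutator to the annihilating half `Q`. The factor `2` cancels the `1/2` in `expT`, and the adjoint
reverses the two indices of the kernel. -/
theorem two_mul_re_inner_T_le {ε θ : ℝ} (hP : P.Fine δ ε) (hε : 0 < ε)
    (hεθ : 2 * ε ≤ 1 - 2 * θ) {b : Mom → ℝ} (hb : ∀ k, 0 ≤ b k)
    (hK : ∀ k ∈ gammaNor R, ∑ i, ∑ j, P.K Vhat δ k i j ^ 2 ≤ b k ^ 2)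
    {w : Finset Mom → ℝ} (hw : ∃ M, ∀ S, |w S| ≤ M) (hw0 : ∀ S, 0 ≤ w S) {C : ℝ} (hC : 0 ≤ C)
    (hwG : ∀ S S', S ⊆ S' → S'.card = S.card + 4 →
      |w S' - w S| * (nGap kF δ θ S' + 1) ≤ C * (√(w S) * √(w S')))
    {lam : ℝ} (hlam : |lam| ≤ 1) (ψ : Fock) :
    2 * RCLike.re (inner ℂ (diagOp w hw ψ) (((lam : ℂ) •
      (P.expT Vhat δ - ContinuousLinearMap.adjoint (P.expT Vhat δ))) ψ))
      ≤ C * (∑ k ∈ gammaNor R, b k) * RCLike.re (inner ℂ ψ (diagOp w hw ψ)) := by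
  classical
  set V := diagOp w hw with hV
  set Q := ContinuousLinearMap.adjoint (P.expT Vhat δ) with hQ
  set c : (k : Mom) → P.I δ k → Fock →L[ℂ] Fock := fun k i => P.c δ k i with hc
  have h1 : ∀ φ φ' : Fock, inner ℂ (Q φ) φ'
      = (1 / 2 : ℂ) * ∑ k ∈ gammaNor R, ∑ i, ∑ j,
        (P.K Vhat δ k j i : ℂ) * inner ℂ (c k i (c k j φ)) φ' := fun φ φ' => by
    rw [hQ, adjoint_expT]
    simp only [smul_apply, sum_apply, ContinuousLinearMap.comp_apply, inner_smul_left, sum_inner,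
      Complex.conj_ofReal, map_div₀, map_one, map_ofNat]
    rfl
  have h2 : ∀ k ∈ gammaNor R, ‖∑ i, ∑ j, (P.K Vhat δ k j i : ℂ)
      * inner ℂ (c k i (c k j (V ψ)) - V (c k i (c k j ψ))) ψ‖
        ≤ C * b k * RCLike.re (inner ℂ ψ (V ψ)) := fun k hk => by
    simp only [hc, c_eq_pairAnn]
    refine norm_sum_comm_le (fun j => P.signedMom_ne_zero δ (gammaNor_spec hk).1 j) (fun S => ?_)
      (nGap_mono kF δ θ) hw hw0 hC hwG (fun i j => P.K Vhat δ k j i) (hb k) ?_ ψ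
    · convert hP.sum_card_filter_le hε hεθ (gammaNor_spec hk).2.2 S
    · rw [Finset.sum_comm]
      exact hK k hk
  have h3 : 2 * RCLike.re (inner ℂ (V ψ) (((lam : ℂ) • (P.expT Vhat δ - Q)) ψ))
      = 2 * (lam * RCLike.re (inner ℂ (Q (V ψ)) ψ - inner ℂ (V (Q ψ)) ψ)) := by
    have e1 : inner ℂ (V ψ) (P.expT Vhat δ ψ) = inner ℂ (Q (V ψ)) ψ := by
      rw [hQ, ContinuousLinearMap.adjoint_inner_left]
    have e2 : RCLike.re (inner ℂ (V ψ) (Q ψ)) = RCLike.re (inner ℂ (V (Q ψ)) ψ) := by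
      rw [hV, inner_diagOp_left, inner_diagOp_left, ← inner_conj_symm, RCLike.conj_re,
        inner_diagOp_left]
    rw [smul_apply, sub_apply, inner_smul_right, inner_sub_right, e1, rclike_re_ofReal_mul,
      map_sub, map_sub, e2]
  have h4 : inner ℂ (Q (V ψ)) ψ - inner ℂ (V (Q ψ)) ψ
      = (1 / 2 : ℂ) * ∑ k ∈ gammaNor R, ∑ i, ∑ j, (P.K Vhat δ k j i : ℂ)
        * inner ℂ (c k i (c k j (V ψ)) - V (c k i (c k j ψ))) ψ := by
    rw [hV, inner_diagOp_left, h1, h1, ← mul_sub, ← Finset.sum_sub_distrib]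
    simp only [← Finset.sum_sub_distrib, ← mul_sub, inner_sub_left, inner_diagOp_left]
  set f₀ := RCLike.re (inner ℂ ψ (V ψ)) with hf₀
  have h5 : ‖inner ℂ (Q (V ψ)) ψ - inner ℂ (V (Q ψ)) ψ‖
      ≤ 1 / 2 * (C * (∑ k ∈ gammaNor R, b k) * f₀) := by
    rw [h4, norm_mul]
    have e : ‖(1 / 2 : ℂ)‖ = 1 / 2 := by simp
    rw [e]
    refine mul_le_mul_of_nonneg_left ((norm_sum_le _ _).trans ((Finset.sum_le_sum h2).trans ?_))
      (by norm_num)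
    rw [Finset.mul_sum, Finset.sum_mul]
  rw [h3]
  have h6 : lam * RCLike.re (inner ℂ (Q (V ψ)) ψ - inner ℂ (V (Q ψ)) ψ)
      ≤ ‖inner ℂ (Q (V ψ)) ψ - inner ℂ (V (Q ψ)) ψ‖ := by
    refine (le_abs_self _).trans ?_
    rw [abs_mul]
    refine (mul_le_mul hlam (RCLike.abs_re_le_norm _) (abs_nonneg _) zero_le_one).trans ?_
    rw [one_mul]
  linarith

/-- The weight is truncated to `min w m`. If `w S` already exceeds `m`, the increment vanishes by
monotonicity; otherwise it is at most that of `w`, so the truncations satisfy the growth condition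
with the same constant. -/
theorem form_T_le {ε θ : ℝ} (hP : P.Fine δ ε) (hε : 0 < ε)
    (hεθ : 2 * ε ≤ 1 - 2 * θ) {b : Mom → ℝ} (hb : ∀ k, 0 ≤ b k)
    (hK : ∀ k ∈ gammaNor R, ∑ i, ∑ j, P.K Vhat δ k i j ^ 2 ≤ b k ^ 2)
    {w : Finset Mom → ℕ} {C : ℝ} (hC : 0 ≤ C) (hwm : Monotone w)
    (hwG : ∀ S S', S ⊆ S' → S'.card = S.card + 4 →
      ((w S' : ℝ) - w S) * (nGap kF δ θ S' + 1) ≤ C * w S)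
    {lam : ℝ} (hlam : |lam| ≤ 1) (ψ : Fock) :
    form w (P.T Vhat δ lam ψ)
      ≤ ENNReal.ofReal (Real.exp (C * ∑ k ∈ gammaNor R, b k)) * form w ψ := by
  set v : ℕ → Finset Mom → ℕ := fun m S => min (w S) m with hv
  refine form_le_of_forall (v := v) (fun s => ⟨s.sup w, fun S hS => ?_⟩) fun m => ?_
  · exact le_min le_rfl (Finset.le_sup (f := w) hS)
  have hvb : ∃ M, ∀ S, |((v m S : ℕ) : ℝ)| ≤ M := ⟨m, fun S => by
    rw [Nat.abs_cast]
    exact_mod_cast min_le_right _ _⟩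
  have hvw : ∀ S, v m S ≤ w S := fun S => min_le_left _ _
  refine (form_exp_le _ (v m) hvb (C * ∑ k ∈ gammaNor R, b k) (fun φ => ?_) ψ).trans
    (mul_le_mul_right (form_mono hvw ψ) _)
  refine two_mul_re_inner_T_le hP hε hεθ hb hK hvb (fun S => Nat.cast_nonneg _) hC ?_ hlam φ
  intro S S' hS hcard
  have hmono : v m S ≤ v m S' := min_le_min_right m (hwm hS)
  have hmono' : ((v m S : ℕ) : ℝ) ≤ (v m S' : ℕ) := by exact_mod_cast hmono
  have h1 : ((v m S : ℕ) : ℝ) ≤ √(v m S : ℕ) * √(v m S' : ℕ) := by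
    conv_lhs => rw [← Real.mul_self_sqrt (Nat.cast_nonneg (v m S))]
    gcongr
  refine le_trans ?_ (mul_le_mul_of_nonneg_left h1 hC)
  rw [abs_of_nonneg (sub_nonneg.mpr hmono')]
  by_cases hm : m ≤ w S
  · have e1 : v m S = m := min_eq_right hm
    have e2 : v m S' = m := min_eq_right (hm.trans (hwm hS))
    rw [e1, e2, sub_self, zero_mul]
    positivity
  · have e1 : v m S = w S := min_eq_left (not_le.mp hm).le
    rw [e1]
    refine le_trans ?_ (hwG S S' hS hcard)
    have h2 : ((v m S' : ℕ) : ℝ) ≤ w S' := by exact_mod_cast hvw S'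
    gcongr

/-- The exponent is skew-adjoint, so the left side is the real part of the commutator form estimated
in `norm_sum_comm_move_le`. -/
theorem two_mul_re_inner_Z_le {ε θ t : ℝ} (hP : P.Fine δ ε) (hε : 0 < ε)
    (hεθ : 2 * ε ≤ 1 - 2 * θ) {b : Mom → ℝ} (hb : ∀ k, 0 ≤ b k)
    (hL : ∀ k ∈ gammaNor R, (P.L Vhat δ k t)ᴴ = -P.L Vhat δ k t)
    (hLb : ∀ k ∈ gammaNor R, ∑ i, ∑ j, ‖P.L Vhat δ k t i j‖ ^ 2 ≤ b k ^ 2)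
    {w : Finset Mom → ℝ} (hw : ∃ M, ∀ S, |w S| ≤ M) {h : ℕ → ℝ} (hh : ∀ m, 0 ≤ h m)
    (hwh : ∀ S, w S = nGap kF δ θ S * h S.card)
    {lam : ℝ} (hlam : |lam| ≤ 1) (ψ : Fock) :
    2 * RCLike.re (inner ℂ (diagOp w hw ψ) (((lam : ℂ) • P.expZ Vhat δ t) ψ))
      ≤ 2 * (∑ k ∈ gammaNor R, b k) * RCLike.re (inner ℂ ψ (diagOp w hw ψ)) := by
  classical
  set V := diagOp w hw with hV
  set Y := P.expZ Vhat δ t with hY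
  set c : (k : Mom) → P.I δ k → Fock →L[ℂ] Fock := fun k i => P.c δ k i with hc
  have h1 : ∀ φ φ' : Fock, inner ℂ φ (Y φ')
      = ∑ k ∈ gammaNor R, ∑ i, ∑ j, P.L Vhat δ k t i j * inner ℂ (c k i φ) (c k j φ') :=
    fun φ φ' => by
    rw [hY, expZ]
    simp only [cStar_eq_adjoint, smul_apply, sum_apply, ContinuousLinearMap.comp_apply,
      inner_smul_right, inner_sum, ContinuousLinearMap.adjoint_inner_right]
    rfl
  have h2 : ∀ k ∈ gammaNor R, ‖∑ i, ∑ j, P.L Vhat δ k t i j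
      * (inner ℂ (c k i (V ψ)) (c k j ψ) - inner ℂ (c k i ψ) (c k j (V ψ)))‖
        ≤ 2 * b k * RCLike.re (inner ℂ ψ (V ψ)) := fun k hk => by
    simp only [hc, c_eq_pairAnn]
    refine norm_sum_comm_move_le (fun j => P.signedMom_ne_zero δ (gammaNor_spec hk).1 j)
      (fun S => ?_) (nGap_mono kF δ θ) (fun S S' h1 h2 => nGap_le_add kF δ θ h1 h2) hh hwh hw _ (hb k)
      (hLb k hk) ψ
    convert hP.sum_card_filter_le hε hεθ (gammaNor_spec hk).2.2 S
  have h3 : 2 * RCLike.re (inner ℂ (V ψ) (((lam : ℂ) • Y) ψ))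
      = lam * RCLike.re (inner ℂ (V ψ) (Y ψ) - inner ℂ ψ (Y (V ψ))) := by
    have e1 : RCLike.re (inner ℂ ψ (Y (V ψ))) = -RCLike.re (inner ℂ (V ψ) (Y ψ)) := by
      rw [← ContinuousLinearMap.adjoint_inner_left, hY, adjoint_expZ P Vhat δ t hL, neg_apply,
        inner_neg_left, map_neg, ← inner_conj_symm, RCLike.conj_re]
    rw [smul_apply, inner_smul_right, rclike_re_ofReal_mul, map_sub, e1]
    ring
  set f₀ := RCLike.re (inner ℂ ψ (V ψ)) with hf₀
  have h5 : ‖inner ℂ (V ψ) (Y ψ) - inner ℂ ψ (Y (V ψ))‖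
      ≤ 2 * (∑ k ∈ gammaNor R, b k) * f₀ := by
    rw [h1, h1, ← Finset.sum_sub_distrib]
    simp only [← Finset.sum_sub_distrib, ← mul_sub]
    refine (norm_sum_le _ _).trans ((Finset.sum_le_sum h2).trans ?_)
    rw [Finset.mul_sum, Finset.sum_mul]
  rw [h3]
  refine le_trans ?_ h5
  refine (le_abs_self _).trans ?_
  rw [abs_mul]
  refine (mul_le_mul hlam (RCLike.abs_re_le_norm _) (abs_nonneg _) zero_le_one).trans ?_
  rw [one_mul]

theorem form_Z_le {ε θ t : ℝ} (hP : P.Fine δ ε) (hε : 0 < ε)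
    (hεθ : 2 * ε ≤ 1 - 2 * θ) {b : Mom → ℝ} (hb : ∀ k, 0 ≤ b k)
    (hL : ∀ k ∈ gammaNor R, (P.L Vhat δ k t)ᴴ = -P.L Vhat δ k t)
    (hLb : ∀ k ∈ gammaNor R, ∑ i, ∑ j, ‖P.L Vhat δ k t i j‖ ^ 2 ≤ b k ^ 2) (m : ℕ)
    {lam : ℝ} (hlam : |lam| ≤ 1) (ψ : Fock) :
    form (fun S => nGap kF δ θ S * nTot S ^ m) (P.Z Vhat δ t lam ψ)
      ≤ ENNReal.ofReal (Real.exp (2 * ∑ k ∈ gammaNor R, b k))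
        * form (fun S => nGap kF δ θ S * nTot S ^ m) ψ := by
  -- The truncation is in the particle number rather than in the value of the weight: it must keep
  -- the product form `nGap · h |S|`, and since the particle number is conserved, `h` may be cut off
  -- sharply. Boundedness follows from `nGap ≤ |S|`.
  set h : ℕ → ℕ → ℕ := fun l j => if j ≤ l then j ^ m else 0 with hh
  set v : ℕ → Finset Mom → ℕ := fun l S => nGap kF δ θ S * h l S.card with hv
  refine form_le_of_forall (v := v) (fun s => ⟨s.sup Finset.card, fun S hS => ?_⟩) fun l => ?_
  · have h1 : S.card ≤ s.sup Finset.card := Finset.le_sup (f := Finset.card) hS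
    simp only [hv, hh, h1, if_true, nTot_eq_card, le_refl]
  have hvb : ∃ M, ∀ S, |((v l S : ℕ) : ℝ)| ≤ M := ⟨(l * l ^ m : ℕ), fun S => by
    rw [Nat.abs_cast]
    norm_cast
    simp only [hv, hh]
    split_ifs with h1
    · gcongr
      exact (nGap_le_card kF δ θ S).trans h1
    · simp⟩
  have hvw : ∀ S, v l S ≤ nGap kF δ θ S * nTot S ^ m := fun S => by
    simp only [hv, hh, nTot_eq_card]
    split_ifs <;> simp
  refine (form_exp_le _ (v l) hvb (2 * ∑ k ∈ gammaNor R, b k) (fun φ => ?_) ψ).trans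
    (mul_le_mul_right (form_mono hvw ψ) _)
  exact two_mul_re_inner_Z_le hP hε hεθ hb hL hLb hvb (h := fun j => (h l j : ℝ))
    (fun _ => Nat.cast_nonneg _) (fun S => by simp only [hv]; push_cast; rfl) hlam φ

theorem conjOp_Z_eq {t : ℝ} (hL : ∀ k ∈ gammaNor R, (P.L Vhat δ k t)ᴴ = -P.L Vhat δ k t)
    (m : ℕ) (lam : ℝ) :
    conjOp (P.Z Vhat δ t lam) (mulOp fun S => nTot S ^ m) = mulOp fun S => nTot S ^ m := by
  simp only [nTot_eq_card]
  let _ : NormedAlgebra ℚ (Fock →L[ℂ] Fock) := NormedAlgebra.restrictScalars ℚ ℂ _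
  refine conjOp_mulOp_eq (fun j => ?_) ?_ (fun i => i ^ m)
  · refine Commute.exp_right ?_
    refine Commute.smul_right ?_ _
    unfold expZ
    refine Commute.sum_right _ _ _ fun k hk => Commute.sum_right _ _ _ fun α _ =>
      Commute.sum_right _ _ _ fun β _ => Commute.smul_right ?_ _
    rw [cStar_eq_adjoint, c_eq_pairAnn, c_eq_pairAnn]
    exact commute_sector_adjoint_pairAnn_mul _ _ (P.signedMom_ne_zero δ (gammaNor_spec hk).1 α)
      (P.signedMom_ne_zero δ (gammaNor_spec hk).1 β) j
  · have h1 : (lam : ℂ) • P.expZ Vhat δ t ∈ skewAdjoint (Fock →L[ℂ] Fock) := by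
      rw [skewAdjoint.mem_iff, star_smul, ContinuousLinearMap.star_eq_adjoint,
        adjoint_expZ P Vhat δ t hL, smul_neg, Complex.star_def, Complex.conj_ofReal]
    have h2 := NormedSpace.exp_mem_unitary_of_mem_skewAdjoint h1
    have h3 := Unitary.star_mul_self_of_mem h2
    rwa [ContinuousLinearMap.star_eq_adjoint] at h3

end PatchDecomposition

end

end RPA

/-! ### Assembly of the lemma. -/

theorem lemma6p3
    (Vhat : RPA.Mom → ℝ) (hV_nonneg : ∀ k, 0 ≤ Vhat k) (hV_sum : Summable Vhat)
    (δ : ℝ) (hδ_pos : 0 < δ) (hδ_lt : δ < 1 / 6)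
    (θ : ℝ) (hθ_pos : 0 < θ) (hθ_lt : θ < 1 / 2)
    (t : ℝ) (ht_pos : 0 < t) (ht_lt : t < 2 * Real.pi)
    (C₀ : ℝ) :
    ∃ A : ℝ, 0 < A ∧ ∀ m : ℕ, ∃ C : NNReal, 0 < C ∧
      ∀ (kF R : ℝ), 0 < kF → 0 < R →
      ∀ (n : ℕ) (P : RPA.PatchDecomposition kF R C₀ n),
        A * ((RPA.numN kF : ℝ) ^ (2 * δ) * R ^ 2) ≤ 2 * n →
        ∀ lam ∈ Set.Icc (-1 : ℝ) 1,
          (∀ ψ : RPA.Fock,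
            RPA.form (fun S => RPA.nTot S ^ m) (P.T Vhat δ lam ψ)
              ≤ C * RPA.form (fun S => (RPA.nTot S + 1) ^ m) ψ) ∧
          (∀ ψ : RPA.Fock,
            RPA.form (fun S => RPA.nGap kF δ θ S * RPA.nTot S ^ m) (P.T Vhat δ lam ψ)
              ≤ C * RPA.form
                  (fun S => (RPA.nGap kF δ θ S + 1) * (RPA.nTot S + 1) ^ m) ψ) ∧
          RPA.conjOp (P.Z Vhat δ t lam) (RPA.mulOp (fun S => RPA.nTot S ^ m))
            = RPA.mulOp (fun S => RPA.nTot S ^ m) ∧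
          (∀ ψ : RPA.Fock,
            RPA.form (fun S => RPA.nGap kF δ θ S * RPA.nTot S ^ m) (P.Z Vhat δ t lam ψ)
              ≤ C * RPA.form (fun S => RPA.nGap kF δ θ S * RPA.nTot S ^ m) ψ) := by
  obtain ⟨Ct, hCt, hlog⟩ := RPA.exists_norm_branchLog_le ht_pos ht_lt
  -- The largest value allowed by `Fine.gap`.
  set ε : ℝ := (1 - 2 * θ) / 2 with hε_def
  have hε : 0 < ε := by rw [hε_def]; linarith
  have hε2 : ε ≤ 1 / 2 := by rw [hε_def]; linarith
  have hεθ : 2 * ε ≤ 1 - 2 * θ := by rw [hε_def]; linarith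
  refine ⟨(C₀ ^ 2 + 32) / ε ^ 2, by positivity, fun m => ?_⟩
  set v := ∑' k, Vhat k with hv
  have hv0 : 0 ≤ v := tsum_nonneg hV_nonneg
  set c : ℝ := (20 + 4 * m) * 5 ^ m with hc
  have hc0 : 0 ≤ c := by positivity
  -- The sum of the Grönwall exponents for `T` and for `Z`, so that one constant serves all the
  -- estimates.
  set x : ℝ := c * (352 * v) + 2 * (2112 * Ct * v) with hx
  have hx1 : c * (352 * v) ≤ x := le_add_of_nonneg_right (by positivity)
  have hx2 : 2 * (2112 * Ct * v) ≤ x := le_add_of_nonneg_left (by positivity)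
  refine ⟨(Real.exp x).toNNReal, by simpa using Real.exp_pos x, ?_⟩
  intro kF R hkF hR n P hM lam hlam
  have hC : (((Real.exp x).toNNReal : NNReal) : ENNReal) = ENNReal.ofReal (Real.exp x) := rfl
  rw [hC]
  have hlam' : |lam| ≤ 1 := abs_le.mpr hlam
  have hP := P.fine_of_le hε hkF hR hM
  have hb := fun k (hk : k ∈ RPA.gammaNor R) => hP.kernel_bounds (Vhat := Vhat) hε hε2
    (hV_nonneg k) (RPA.gammaNor_spec hk).1 (RPA.gammaNor_spec hk).2.1 (RPA.gammaNor_spec hk).2.2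
    hlog
  have hsum : ∀ a : ℝ, 0 ≤ a → ∑ k ∈ RPA.gammaNor R, a * Vhat k ≤ a * v := fun a ha => by
    rw [← Finset.mul_sum]
    exact mul_le_mul_of_nonneg_left
      (hV_sum.sum_le_tsum _ fun k _ => hV_nonneg k) ha
  have hT1 : c * ∑ k ∈ RPA.gammaNor R, 352 * Vhat k ≤ x :=
    (mul_le_mul_of_nonneg_left (hsum 352 (by norm_num)) hc0).trans hx1
  have hZ1 : 2 * ∑ k ∈ RPA.gammaNor R, 2112 * Ct * Vhat k ≤ x :=
    (mul_le_mul_of_nonneg_left (hsum (2112 * Ct) (by positivity)) (by norm_num)).trans hx2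
  have hbT : ∀ k, 0 ≤ 352 * Vhat k := fun k => mul_nonneg (by norm_num) (hV_nonneg k)
  have hbZ : ∀ k, 0 ≤ 2112 * Ct * Vhat k := fun k => mul_nonneg (by positivity) (hV_nonneg k)
  refine ⟨fun ψ => ?_, fun ψ => ?_, ?_, fun ψ => ?_⟩
  -- The propagated weights are the ones shifted by `1`: the increments must be bounded by the
  -- weight itself, which has to be positive on the empty configuration because `T` creates pairs
  -- there.
  · refine (RPA.form_mono (fun S => Nat.pow_le_pow_left (Nat.le_succ _) m) _).trans
      ((RPA.PatchDecomposition.form_T_le hP hε hεθ hbT (fun k hk => (hb k hk).1) hc0 ?_ ?_ hlam'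
        ψ).trans ?_)
    · intro S S' h
      simp only [RPA.nTot_eq_card]
      have := Finset.card_le_card h
      gcongr
    · exact fun S S' _ hj => RPA.number_weight_growth kF δ θ m hj
    · gcongr
  · refine (RPA.form_mono (fun S => Nat.mul_le_mul (Nat.le_succ _)
      (Nat.pow_le_pow_left (Nat.le_succ _) m)) _).trans
      ((RPA.PatchDecomposition.form_T_le hP hε hεθ hbT (fun k hk => (hb k hk).1) hc0 ?_ ?_ hlam'
        ψ).trans ?_)
    · intro S S' h
      simp only [RPA.nTot_eq_card]
      have h1 := Finset.card_le_card h
      have h2 := RPA.nGap_mono kF δ θ h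
      gcongr
    · exact fun S S' h hj => RPA.gapped_weight_growth kF δ θ m h hj
    · gcongr
  · exact RPA.PatchDecomposition.conjOp_Z_eq (fun k hk => (hb k hk).2.1) m lam
  · refine (RPA.PatchDecomposition.form_Z_le hP hε hεθ hbZ (fun k hk => (hb k hk).2.1)
      (fun k hk => (hb k hk).2.2) m hlam' ψ).trans ?_
    gcongr
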